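/- Let $n\ge 2$ be an integer, $1<p<n$, $p^\star=\frac{np}{n-p}$, $1\le s<q<p^\star$, and let $\theta$ be the number determined by $\frac{\theta}{p^\star}+\frac{1-\theta}{s}=\frac1q$. Write $\|\cdot\|_r$ for the norm of $L^r(\mathbb R^n)$, and let $D^{p,s}(\mathbb R^n)$ be the closure of $C_c^\infty(\mathbb R^n)$ (real-valued functions) under the norm $\|\nabla u\|_p+\|u\|_s$. Let $$G=\inf\Big\{\frac{\|\nabla u\|_p^\theta\|u\|_s^{1-\theta}}{\|u\|_q}:\ 0\ne u\in D^{p,s}(\mathbb R^n)\Big\}$$ be the sharp constant in $G\|u\|_q\le\|\nabla u\|_p^\theta\|u\|_s^{1-\theta}$. A function $0\neq v\in D^{p,s}(\mathbb R^n)$ is called optimal if equality holds for it. For $0\ne u\in D^{p,s}(\mathbb R^n)$ define the deficit and the asymmetry $$\delta(u)=\frac{\|\nabla u\|_p^\theta\|u\|_s^{1-\theta}}{G\|u\|_q}-1,\qquad \lambda(u)=\inf\Big\{\frac{\|u-v\|_q^q}{\|u\|_q^q}:\ v\text{ optimal},\ \|v\|_q=\|u\|_q\Big\}.$$ **Theorem.**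 For every $M\in\mathbb R$ there are constants $C_0,C_1>0$, depending only on $n,p,q,s$ and $M$, such that the following holds. Let $(u_h)_{h\in\mathbb N}$ be a sequence of nonzero functions in $D^{p,s}(\mathbb R^n)$ with $\delta(u_h)\to0$ as $h\to\infty$. Then there exist $(\lambda_h)_h\subset(0,+\infty)$ and $(x_h)_h\subset\mathbb R^n$ such that the rescaled functions $$w_h(x)=\lambda_h^{n/q}\,u_h(\lambda_h(x-x_h))$$ belong to $D^{p,s}(\mathbb R^n)$ and satisfy: (i) $\delta(w_h)=\delta(u_h)$ and $\lambda(w_h)=\lambda(u_h)$ for every $h$; (ii) $\|w_h\|_q=\|u_h\|_q$ for every $h$; (iii) for every $h$ with $\delta(u_h)\le M$, $$\frac{1}{C_0}\|u_h\|_q\le\|\nabla w_h\|_p\le C_0\|u_h\|_q,\qquad \frac1{C_1}\|u_h\|_q\le\|w_h\|_s\le C_1\|u_h\|_q;$$ (iv) there are a subsequence $(w_{h_k})_k$ and a function $w\in D^{p,s}(\mathbb R^n)\cap L^q(\mathbb R^n)$ such that $w_{h_k}/\|u_{h_k}\|_q\to w$ strongly in $L^q(\mathbb R^n)$ as $k\to\infty$.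 In particular, if $\|u_h\|_q=1$ for all $h$, then (iii) reads $\frac1{C_0}\le\|\nabla w_h\|_p\le C_0$, $\frac1{C_1}\le\|w_h\|_s\le C_1$, and (iv) reads $w_{h_k}\to w$ in $L^q(\mathbb R^n)$. Taking for instance $M=1$, the bounds (iii) hold for all sufficiently large $h$ with constants depending only on $n,p,q,s$; taking $M=\sup_h\delta(u_h)$, they hold for all $h$. -/

import Mathlib

open MeasureTheory Filter Topology
open scoped ContDiff

noncomputable section

/-- `ℝⁿ` with the Euclidean norm. -/
abbrev Rn (n : ℕ) : Type := EuclideanSpace ℝ (Fin n)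

/-- The norm `‖f‖_r = (∫ |f|^r)^{1/r}` on `ℝⁿ`, for a real exponent `r ≥ 1` and scalar or vector
valued `f`. -/
def norml {n : ℕ} {F : Type*} [NormedAddCommGroup F] (r : ℝ) (f : Rn n → F) : ℝ :=
  lpNorm f (ENNReal.ofReal r) volume

/-- `φ ∈ C_c^∞(ℝⁿ)`. -/
def IsTestFunction {n : ℕ} (φ : Rn n → ℝ) : Prop :=
  ContDiff ℝ ∞ φ ∧ HasCompactSupport φ

/-- `g` is a weak gradient of `u`: both are locally integrable and
`∫ u ∂_v φ = - ∫ φ ⟨g, v⟩` for every test function `φ` and every direction `v`. -/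
def HasWeakGradient {n : ℕ} (u : Rn n → ℝ) (g : Rn n → Rn n) : Prop :=
  LocallyIntegrable u volume ∧ LocallyIntegrable g volume ∧
    ∀ φ : Rn n → ℝ, IsTestFunction φ → ∀ v : Rn n,
      ∫ x, u x * fderiv ℝ φ x v = - ∫ x, φ x * inner ℝ (g x) v

open Classical in
/-- The weak gradient `∇u` (unique up to null sets; `0` if there is none). -/
def weakGradient {n : ℕ} (u : Rn n → ℝ) : Rn n → Rn n :=
  if h : ∃ g, HasWeakGradient u g then h.choose else 0

/-- `u ∈ D^{p,s}(ℝⁿ)`, the closure of `C_c^∞(ℝⁿ)` under the norm `‖∇u‖_p + ‖u‖_s`: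
`u ∈ L^s` has a weak gradient `g ∈ L^p`, and some sequence of test functions `φ_k` satisfies
`φ_k → u` in `L^s` and `∇φ_k → g` in `L^p`. -/
def MemD {n : ℕ} (p s : ℝ) (u : Rn n → ℝ) : Prop :=
  MemLp u (ENNReal.ofReal s) volume ∧
    ∃ g : Rn n → Rn n, HasWeakGradient u g ∧ MemLp g (ENNReal.ofReal p) volume ∧
      ∃ φ : ℕ → Rn n → ℝ, (∀ k, IsTestFunction (φ k)) ∧
        Tendsto (fun k => eLpNorm (fun x => φ k x - u x) (ENNReal.ofReal s) volume) atTop (𝓝 0) ∧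
        Tendsto (fun k => eLpNorm (fun x => gradient (φ k) x - g x) (ENNReal.ofReal p) volume)
          atTop (𝓝 0)

/-- `u` is not the zero element, i.e. `u` does not vanish almost everywhere. -/
def IsNonzero {n : ℕ} (u : Rn n → ℝ) : Prop := ¬ (u =ᵐ[volume] 0)

/-- The functional `‖∇u‖_p^θ ‖u‖_s^{1-θ}`. -/
def gnsFunctional {n : ℕ} (p s θ : ℝ) (u : Rn n → ℝ) : ℝ :=
  norml p (weakGradient u) ^ θ * norml s u ^ (1 - θ)

/-- The sharp constant `G` in `G ‖u‖_q ≤ ‖∇u‖_p^θ ‖u‖_s^{1-θ}`, `u ∈ D^{p,s}(ℝⁿ)`. -/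
def gnsConst (n : ℕ) (p s q θ : ℝ) : ℝ :=
  sInf {t : ℝ | ∃ u : Rn n → ℝ, MemD p s u ∧ IsNonzero u ∧
    t = gnsFunctional p s θ u / norml q u}

/-- The deficit `δ(u) = ‖∇u‖_p^θ ‖u‖_s^{1-θ} / (G ‖u‖_q) - 1`. -/
def deficit {n : ℕ} (p s q θ : ℝ) (u : Rn n → ℝ) : ℝ :=
  gnsFunctional p s θ u / (gnsConst n p s q θ * norml q u) - 1

/-- `v` is optimal: a nonzero function in `D^{p,s}` with equality in the sharp inequality. -/
def IsGNSOptimal {n : ℕ} (p s q θ : ℝ) (v : Rn n → ℝ) : Prop :=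
  MemD p s v ∧ IsNonzero v ∧ gnsConst n p s q θ * norml q v = gnsFunctional p s θ v

/-- The asymmetry
`λ(u) = inf {‖u - v‖_q^q / ‖u‖_q^q : v optimal, ‖v‖_q = ‖u‖_q}`. -/
def asymmetry {n : ℕ} (p s q θ : ℝ) (u : Rn n → ℝ) : ℝ :=
  sInf {t : ℝ | ∃ v : Rn n → ℝ, IsGNSOptimal p s q θ v ∧ norml q v = norml q u ∧
    t = norml q (fun x => u x - v x) ^ q / norml q u ^ q}

/-- The rescaled and translated function `x ↦ lam^{n/q} u(lam (x - x₀))`. -/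
def rescale {n : ℕ} (q lam : ℝ) (x₀ : Rn n) (u : Rn n → ℝ) : Rn n → ℝ :=
  fun x => lam ^ ((n : ℝ) / q) * u (lam • (x - x₀))

end

/-!
# Compactness of almost optimal sequences for the Gagliardo–Nirenberg–Sobolev inequality

The functional `‖∇u‖_p^θ ‖u‖_s^{1-θ} / ‖u‖_q` is invariant under `u ↦ lam^{n/q} u(lam (x - x₀))`,
and a suitable dilation makes `‖∇w‖_p` and `‖w‖_s` equal (`exists_balanced_rescale`). Their common
value is then `(1 + δ(u)) G ‖u‖_q`, which gives the two-sided bounds. After division by `‖u‖_q`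
the sequence satisfies `‖∇w‖_p → G`, `‖w‖_s → G` and `‖w‖_q = 1`, and it remains to show that such
a sequence is precompact in `L^q` up to translations. By density it suffices to treat test
functions (`exists_translates_tendsto`). There are four ingredients.

* *No vanishing* (`exists_nonvanishing_const`): some ball of fixed radius carries a fixed amount
  of `L^q` mass. A local Sobolev estimate `‖χ_y φ‖_r^t ≤ A ∫_{B(y, 2)} (|∇φ|^p + |φ|^t)` with
  `t < r` is integrated over all centres `y`; if all local `L^q` norms were small, the surplus power
  `r - t` would make `‖φ‖_r`, and hence `‖φ‖_q`, small.
* *Rellich's theorem* (`exists_subseq_cauchy_L1_loc`): a subsequence of the translated functions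
  converges in `L^1`, hence in `L^q`, of every ball. The proof compares functions with their
  averages over small balls, which are equi-Lipschitz.
* *No dichotomy* (`gns_split`, `tendsto_norml_sub_of_nonvanishing`): let
  `1/κ = θ/p + (1-θ)/s`, so that `κ < q`. Cutting `φ` at a large radius, applying the sharp
  inequality to both parts and making it additive by the weighted arithmetic-geometric mean
  inequality gives `m^{κ/q} + (1-m)^{κ/q} ≤ 1` for the limiting fraction `m` of `L^q` mass that
  stays bounded. As `κ/q < 1` and `m > 0`, this forces `m = 1`, and the sequence is Cauchy in `L^q`.
* *The limit lies in `D^{p,s}`*: the sharp inequality at the midpoints of two members of the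
  sequence shows that the convexity defect of `‖∇·‖_p^p` vanishes, so uniform convexity makes the
  gradients Cauchy in `L^p` (`tendsto_norml_gradient_sub`). The limit belongs to `L^s` by Fatou's
  lemma, and cutoffs at slowly increasing radii turn the sequence into one converging in `D^{p,s}`
  (`isTestLimit_of_tendsto`).
-/

/-! ### Real-exponent `L^r` norms -/

lemma norml_eq_toReal {n : ℕ} {F : Type*} [NormedAddCommGroup F] {r : ℝ} {f : Rn n → F}
    (hf : AEStronglyMeasurable f volume) :
    norml r f = (eLpNorm f (ENNReal.ofReal r) volume).toReal :=
  (toReal_eLpNorm hf).symm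

lemma norml_nonneg {n : ℕ} {F : Type*} [NormedAddCommGroup F] (r : ℝ) (f : Rn n → F) :
    0 ≤ norml r f := lpNorm_nonneg

lemma norml_congr_ae {n : ℕ} {F : Type*} [NormedAddCommGroup F] {r : ℝ} {f g : Rn n → F}
    (h : f =ᵐ[volume] g) : norml r f = norml r g := by
  unfold norml
  by_cases hf : AEStronglyMeasurable f volume
  · rw [← toReal_eLpNorm hf, ← toReal_eLpNorm (hf.congr h), eLpNorm_congr_ae h]
  · rw [lpNorm_of_not_aestronglyMeasurable hf,
      lpNorm_of_not_aestronglyMeasurable (fun hg => hf (hg.congr h.symm))]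

lemma lpNorm_rpow {α F : Type*} [MeasurableSpace α] {μ : Measure α} [NormedAddCommGroup F] {r : ℝ}
    (hr : 0 < r) {f : α → F} (hf : AEStronglyMeasurable f μ) :
    lpNorm f (ENNReal.ofReal r) μ ^ r = ∫ x, ‖f x‖ ^ r ∂μ := by
  rw [lpNorm_eq_integral_norm_rpow_toReal (by simpa using hr) (by simp) hf,
    ENNReal.toReal_ofReal hr.le, ← Real.rpow_mul (by positivity), inv_mul_cancel₀ hr.ne',
    Real.rpow_one]

lemma norml_rpow {n : ℕ} {F : Type*} [NormedAddCommGroup F] {r : ℝ} (hr : 0 < r) {f : Rn n → F}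
    (hf : AEStronglyMeasurable f volume) : norml r f ^ r = ∫ x, ‖f x‖ ^ r :=
  lpNorm_rpow hr hf

lemma integrable_norm_rpow_of_memLp {α F : Type*} [MeasurableSpace α] {μ : Measure α}
    [NormedAddCommGroup F] {r : ℝ} (hr : 0 < r) {f : α → F} (hf : MemLp f (ENNReal.ofReal r) μ) :
    Integrable (fun x => ‖f x‖ ^ r) μ := by
  have := hf.integrable_norm_rpow (by simpa using hr) (by simp)
  rwa [ENNReal.toReal_ofReal hr.le] at this

lemma one_le_ofReal {r : ℝ} (hr : 1 ≤ r) : 1 ≤ ENNReal.ofReal r := by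
  simpa using ENNReal.ofReal_le_ofReal hr

/-- The interpolation inequality `‖f‖_b ≤ ‖f‖_a^{1-t} ‖f‖_c^t` for `1/b = (1-t)/a + t/c`. -/
lemma eLpNorm_le_interpolation {α F : Type*} [MeasurableSpace α] {μ : Measure α}
    [NormedAddCommGroup F] {f : α → F} (hf : AEStronglyMeasurable f μ) {a b c t : ℝ}
    (ha : 0 < a) (hb : 0 < b) (hc : 0 < c) (ht0 : 0 ≤ t) (ht1 : t ≤ 1)
    (h : (1 - t) / a + t / c = 1 / b) :
    eLpNorm f (ENNReal.ofReal b) μ ≤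
      eLpNorm f (ENNReal.ofReal a) μ ^ (1 - t) * eLpNorm f (ENNReal.ofReal c) μ ^ t := by
  rw [eLpNorm_eq_lintegral_rpow_enorm_toReal (by simpa using hb) (by simp),
    eLpNorm_eq_lintegral_rpow_enorm_toReal (by simpa using ha) (by simp),
    eLpNorm_eq_lintegral_rpow_enorm_toReal (by simpa using hc) (by simp),
    ENNReal.toReal_ofReal ha.le, ENNReal.toReal_ofReal hb.le, ENNReal.toReal_ofReal hc.le]
  have h1 : b * (1 - t) / a + b * t / c = 1 := by
    have : b * ((1 - t) / a + t / c) = 1 := by rw [h]; field_simp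
    rw [mul_add, mul_div_assoc', mul_div_assoc'] at this; exact this
  have hm : AEMeasurable (fun x => ‖f x‖ₑ) μ := hf.enorm
  have key := ENNReal.lintegral_mul_norm_pow_le (μ := μ) (hm.pow_const a) (hm.pow_const c)
    (p := b * (1 - t) / a) (q := b * t / c)
    (div_nonneg (mul_nonneg hb.le (by linarith)) ha.le) (by positivity) h1
  have h2 : ∀ x, (‖f x‖ₑ ^ a) ^ (b * (1 - t) / a) * (‖f x‖ₑ ^ c) ^ (b * t / c) = ‖f x‖ₑ ^ b := by
    intro x
    rw [← ENNReal.rpow_mul, ← ENNReal.rpow_mul, ← ENNReal.rpow_add_of_nonneg]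
    · congr 1; field_simp; ring
    · rw [mul_div_cancel₀ _ ha.ne']; exact mul_nonneg hb.le (by linarith)
    · rw [mul_div_cancel₀ _ hc.ne']; positivity
  simp_rw [h2] at key
  refine (ENNReal.rpow_le_rpow key (by positivity : 0 ≤ 1 / b)).trans (le_of_eq ?_)
  rw [ENNReal.mul_rpow_of_nonneg _ _ (by positivity), ← ENNReal.rpow_mul, ← ENNReal.rpow_mul,
    ← ENNReal.rpow_mul, ← ENNReal.rpow_mul]
  congr 2 <;> field_simp

/-- Existence of the interpolation parameter for `a < b < c`. -/
lemma exists_interpolation_exponent {a b c : ℝ} (ha : 0 < a) (hab : a < b) (hbc : b < c) :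
    ∃ t : ℝ, 0 < t ∧ t < 1 ∧ (1 - t) / a + t / c = 1 / b := by
  have hb := ha.trans hab
  have hc := hb.trans hbc
  have h1 : 1 / b < 1 / a := one_div_lt_one_div_of_lt ha hab
  have h2 : 1 / c < 1 / b := one_div_lt_one_div_of_lt hb hbc
  have h3 : 0 < 1 / a - 1 / c := by linarith
  refine ⟨(1 / a - 1 / b) / (1 / a - 1 / c), div_pos (by linarith) h3,
    (div_lt_one h3).2 (by linarith), ?_⟩
  have : (1 / a - 1 / b) / (1 / a - 1 / c) * (1 / a - 1 / c) = 1 / a - 1 / b :=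
    div_mul_cancel₀ _ h3.ne'
  set t := (1 / a - 1 / b) / (1 / a - 1 / c)
  calc (1 - t) / a + t / c = 1 / a - t * (1 / a - 1 / c) := by ring
    _ = 1 / b := by rw [this]; ring

/-! ### Test functions -/

namespace IsTestFunction

variable {n : ℕ} {φ ψ : Rn n → ℝ}

lemma continuous (h : IsTestFunction φ) : Continuous φ := h.1.continuous

lemma differentiable (h : IsTestFunction φ) : Differentiable ℝ φ := h.1.differentiable (by simp)

lemma add (h : IsTestFunction φ) (h' : IsTestFunction ψ) : IsTestFunction (fun x => φ x + ψ x) :=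
  ⟨h.1.add h'.1, h.2.add h'.2⟩

lemma const_mul (c : ℝ) (h : IsTestFunction φ) : IsTestFunction (fun x => c * φ x) :=
  ⟨contDiff_const.mul h.1, h.2.mul_left⟩

lemma sub (h : IsTestFunction φ) (h' : IsTestFunction ψ) : IsTestFunction (fun x => φ x - ψ x) := by
  convert h.add (h'.const_mul (-1)) using 2; ring

lemma mul (h : IsTestFunction φ) (h' : IsTestFunction ψ) : IsTestFunction (fun x => φ x * ψ x) :=
  ⟨h.1.mul h'.1, h.2.mul_right⟩

/-- Test functions are stable under `x ↦ lam (x - x₀)`. -/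
lemma comp_affine (h : IsTestFunction φ) {lam : ℝ} (hl : lam ≠ 0) (x₀ : Rn n) :
    IsTestFunction (fun x => φ (lam • (x - x₀))) := by
  refine ⟨h.1.comp (by fun_prop), ?_⟩
  have := h.2.comp_homeomorph
    ((Homeomorph.subRight x₀).trans (Homeomorph.smulOfNeZero lam hl))
  exact this

lemma gradient_continuous (h : IsTestFunction φ) : Continuous (gradient φ) :=
  (InnerProductSpace.toDual ℝ (Rn n)).symm.continuous.comp (h.1.continuous_fderiv (by simp))

lemma gradient_hasCompactSupport (h : IsTestFunction φ) : HasCompactSupport (gradient φ) :=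
  (h.2.fderiv ℝ).comp_left (g := (InnerProductSpace.toDual ℝ (Rn n)).symm) (map_zero _)

lemma memLp (h : IsTestFunction φ) (r : ENNReal) : MemLp φ r volume :=
  h.continuous.memLp_of_hasCompactSupport h.2

lemma gradient_memLp (h : IsTestFunction φ) (r : ENNReal) : MemLp (gradient φ) r volume :=
  h.gradient_continuous.memLp_of_hasCompactSupport h.gradient_hasCompactSupport

end IsTestFunction

lemma norm_gradient {n : ℕ} (φ : Rn n → ℝ) (x : Rn n) : ‖gradient φ x‖ = ‖fderiv ℝ φ x‖ := by
  simp [gradient]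

lemma inner_gradient {n : ℕ} (φ : Rn n → ℝ) (x v : Rn n) :
    inner ℝ (gradient φ x) v = fderiv ℝ φ x v := by
  simp [gradient]

lemma gradient_add_fun {n : ℕ} {φ ψ : Rn n → ℝ} {x : Rn n} (h : DifferentiableAt ℝ φ x)
    (h' : DifferentiableAt ℝ ψ x) :
    gradient (fun y => φ y + ψ y) x = gradient φ x + gradient ψ x := by
  simp [gradient, fderiv_fun_add h h']

lemma gradient_sub_fun {n : ℕ} {φ ψ : Rn n → ℝ} {x : Rn n} (h : DifferentiableAt ℝ φ x)
    (h' : DifferentiableAt ℝ ψ x) :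
    gradient (fun y => φ y - ψ y) x = gradient φ x - gradient ψ x := by
  simp [gradient, fderiv_fun_sub h h']

lemma gradient_const_mul_fun {n : ℕ} {φ : Rn n → ℝ} {x : Rn n} (c : ℝ)
    (h : DifferentiableAt ℝ φ x) :
    gradient (fun y => c * φ y) x = c • gradient φ x := by
  simp [gradient, fderiv_const_mul h]

lemma gradient_mul_fun {n : ℕ} {φ ψ : Rn n → ℝ} {x : Rn n} (h : DifferentiableAt ℝ φ x)
    (h' : DifferentiableAt ℝ ψ x) :
    gradient (fun y => φ y * ψ y) x = φ x • gradient ψ x + ψ x • gradient φ x := by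
  simp [gradient, fderiv_fun_mul h h']

lemma gradient_comp_affine {n : ℕ} {φ : Rn n → ℝ} (hφ : Differentiable ℝ φ) (lam : ℝ)
    (x₀ x : Rn n) :
    gradient (fun y => φ (lam • (y - x₀))) x = lam • gradient φ (lam • (x - x₀)) := by
  have h1 : HasFDerivAt (fun y : Rn n => lam • (y - x₀))
      (lam • ContinuousLinearMap.id ℝ (Rn n)) x :=
    ((hasFDerivAt_id x).sub_const x₀).const_smul lam
  have h2 := (hφ (lam • (x - x₀))).hasFDerivAt.comp x h1
  have h3 : fderiv ℝ (fun y => φ (lam • (y - x₀))) x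
      = lam • fderiv ℝ φ (lam • (x - x₀)) := by
    rw [show (fun y => φ (lam • (y - x₀))) = φ ∘ fun y => lam • (y - x₀) from rfl, h2.fderiv]
    ext v; simp
  simp [gradient, h3]

/-! ### Limits of test functions and weak gradients -/

/-- `u ∈ L^s` and `g ∈ L^p` are the limits of `φ_k` in `L^s` and of `∇φ_k` in `L^p` for one
sequence of test functions `φ_k`. -/
def IsTestLimit {n : ℕ} (p s : ℝ) (u : Rn n → ℝ) (g : Rn n → Rn n) : Prop :=
  MemLp u (ENNReal.ofReal s) volume ∧ MemLp g (ENNReal.ofReal p) volume ∧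
    ∃ φ : ℕ → Rn n → ℝ, (∀ k, IsTestFunction (φ k)) ∧
      Tendsto (fun k => eLpNorm (fun x => φ k x - u x) (ENNReal.ofReal s) volume) atTop (𝓝 0) ∧
      Tendsto (fun k => eLpNorm (fun x => gradient (φ k) x - g x) (ENNReal.ofReal p) volume)
        atTop (𝓝 0)

/-- `L^r` convergence can be tested against a continuous compactly supported function. -/
lemma tendsto_integral_smul_of_tendsto_eLpNorm {n : ℕ} {F : Type*} [NormedAddCommGroup F]
    [NormedSpace ℝ F] {r : ENNReal} (hr : 1 ≤ r) {f : ℕ → Rn n → F} {f₀ : Rn n → F}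
    (hf : ∀ k, MemLp (f k) r volume) (hf₀ : MemLp f₀ r volume)
    (h : Tendsto (fun k => eLpNorm (fun x => f k x - f₀ x) r volume) atTop (𝓝 0))
    {χ : Rn n → ℝ} (hχ : Continuous χ) (hχc : HasCompactSupport χ) :
    Tendsto (fun k => ∫ x, χ x • f k x) atTop (𝓝 (∫ x, χ x • f₀ x)) := by
  have hC : ENNReal.HolderConjugate (ENNReal.conjExponent r) r :=
    (ENNReal.HolderConjugate.conjExponent hr).symm
  have hχm : MemLp χ (ENNReal.conjExponent r) volume := hχ.memLp_of_hasCompactSupport hχc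
  refine tendsto_integral_of_L1 _ ?_ (Eventually.of_forall fun k => ?_) ?_
  · exact (hf₀.smul hχm : MemLp _ 1 volume).1
  · exact memLp_one_iff_integrable.1 ((hf k).smul hχm)
  · have hb : ∀ k, ∫⁻ x, ‖χ x • f k x - χ x • f₀ x‖ₑ ≤
        eLpNorm χ (ENNReal.conjExponent r) volume * eLpNorm (fun x => f k x - f₀ x) r volume := by
      intro k
      have h1 := eLpNorm_smul_le_mul_eLpNorm (p := ENNReal.conjExponent r) (q := r) (r := 1)
        ((hf k).sub hf₀).1 hχm.1
      rw [eLpNorm_one_eq_lintegral_enorm] at h1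
      refine le_trans (le_of_eq ?_) h1
      simp [smul_sub]
    have h2 := ENNReal.Tendsto.const_mul (a := eLpNorm χ (ENNReal.conjExponent r) volume) h
      (Or.inr hχm.2.ne)
    rw [mul_zero] at h2
    exact tendsto_of_tendsto_of_tendsto_of_le_of_le tendsto_const_nhds h2 (fun _ => zero_le)
      hb

lemma integral_mul_fderiv_test {n : ℕ} {φ ψ : Rn n → ℝ} (hφ : IsTestFunction φ)
    (hψ : IsTestFunction ψ) (v : Rn n) :
    ∫ x, φ x * fderiv ℝ ψ x v = - ∫ x, ψ x * inner ℝ (gradient φ x) v := by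
  have hc : ∀ {χ : Rn n → ℝ}, IsTestFunction χ → Continuous (fun x => fderiv ℝ χ x v) :=
    fun h => (h.1.continuous_fderiv (by simp)).clm_apply continuous_const
  rw [integral_mul_fderiv_eq_neg_fderiv_mul_of_integrable]
  · congr 1; congr 1; ext x; rw [inner_gradient, mul_comm]
  · exact ((hc hφ).mul hψ.continuous).integrable_of_hasCompactSupport hψ.2.mul_left
  · exact (hφ.continuous.mul (hc hψ)).integrable_of_hasCompactSupport hφ.2.mul_right
  · exact (hφ.continuous.mul hψ.continuous).integrable_of_hasCompactSupport hφ.2.mul_right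
  · exact fun x _ => hφ.differentiable x
  · exact fun x _ => hψ.differentiable x

lemma IsTestLimit.hasWeakGradient {n : ℕ} {p s : ℝ} (hp : 1 ≤ p) (hs : 1 ≤ s) {u : Rn n → ℝ}
    {g : Rn n → Rn n} (h : IsTestLimit p s u g) : HasWeakGradient u g := by
  obtain ⟨hu, hg, φ, hφ, hφu, hφg⟩ := h
  refine ⟨hu.locallyIntegrable (one_le_ofReal hs), hg.locallyIntegrable (one_le_ofReal hp), ?_⟩
  intro ψ hψ v
  have h1 := tendsto_integral_smul_of_tendsto_eLpNorm (one_le_ofReal hs)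
    (fun k => (hφ k).memLp _) hu hφu (χ := fun x => fderiv ℝ ψ x v)
    ((hψ.1.continuous_fderiv (by simp)).clm_apply continuous_const)
    ((hψ.2.fderiv ℝ).comp_left (g := fun L : Rn n →L[ℝ] ℝ => L v) rfl)
  have h2 := tendsto_integral_smul_of_tendsto_eLpNorm (one_le_ofReal hp)
    (fun k => (hφ k).gradient_memLp _) hg hφg hψ.continuous hψ.2
  have h3 : ∀ {G : Rn n → Rn n}, LocallyIntegrable G volume →
      inner ℝ (∫ x, ψ x • G x) v = ∫ x, ψ x * inner ℝ (G x) v := by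
    intro G hG
    have hi : Integrable (fun x => ψ x • G x) volume :=
      hG.integrable_smul_left_of_hasCompactSupport hψ.continuous hψ.2
    have := integral_inner (𝕜 := ℝ) hi v
    rw [real_inner_comm, ← this]
    congr 1; ext x; rw [real_inner_smul_right, real_inner_comm]
  have h4 : Tendsto (fun k => inner ℝ (∫ x, ψ x • gradient (φ k) x) v) atTop
      (𝓝 (inner ℝ (∫ x, ψ x • g x) v)) := h2.inner tendsto_const_nhds
  rw [h3 (hg.locallyIntegrable (one_le_ofReal hp))] at h4
  have h5 : Tendsto (fun k => ∫ x, fderiv ℝ ψ x v • φ k x) atTop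
      (𝓝 (-∫ x, ψ x * inner ℝ (g x) v)) := by
    refine h4.neg.congr fun k => ?_
    rw [h3 (((hφ k).gradient_memLp _).locallyIntegrable (one_le_ofReal hp)),
      ← integral_mul_fderiv_test (hφ k) hψ v]
    congr 1; ext x; rw [smul_eq_mul, mul_comm]
  rw [← tendsto_nhds_unique h1 h5]
  congr 1; ext x; rw [smul_eq_mul, mul_comm]

/-- Weak gradients are unique up to null sets. -/
lemma HasWeakGradient.ae_eq {n : ℕ} {u u' : Rn n → ℝ} {g g' : Rn n → Rn n}
    (h : HasWeakGradient u g) (h' : HasWeakGradient u' g') (huu' : u =ᵐ[volume] u') :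
    g =ᵐ[volume] g' := by
  refine ae_eq_of_integral_contDiff_smul_eq h.2.1 h'.2.1 fun ψ hψ hψc => ?_
  have hi : Integrable (fun x => ψ x • g x) volume :=
    h.2.1.integrable_smul_left_of_hasCompactSupport hψ.continuous hψc
  have hi' : Integrable (fun x => ψ x • g' x) volume :=
    h'.2.1.integrable_smul_left_of_hasCompactSupport hψ.continuous hψc
  refine ext_inner_left ℝ fun v => ?_
  rw [← integral_inner hi, ← integral_inner hi']
  have h1 := h.2.2 ψ ⟨hψ, hψc⟩ v
  have h2 := h'.2.2 ψ ⟨hψ, hψc⟩ v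
  have h3 : ∫ x, u x * fderiv ℝ ψ x v = ∫ x, u' x * fderiv ℝ ψ x v :=
    integral_congr_ae (huu'.mono fun x hx => by simp only [hx])
  have h4 : ∀ G : Rn n → Rn n, ∫ x, inner ℝ v (ψ x • G x) = ∫ x, ψ x * inner ℝ (G x) v :=
    fun G => integral_congr_ae (Eventually.of_forall fun x => by
      simp only [real_inner_smul_right]; rw [real_inner_comm])
  rw [h4, h4]
  linarith

/-- The weak gradient condition in `MemD` is automatic: integration by parts passes to the
limit. -/
lemma memD_iff {n : ℕ} {p s : ℝ} (hp : 1 ≤ p) (hs : 1 ≤ s) {u : Rn n → ℝ} :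
    MemD p s u ↔ ∃ g, IsTestLimit p s u g :=
  ⟨fun ⟨hu, g, _, hg, φ⟩ => ⟨g, hu, hg, φ⟩,
    fun ⟨g, h⟩ => ⟨h.1, g, h.hasWeakGradient hp hs, h.2.1, h.2.2⟩⟩

lemma IsTestLimit.weakGradient_ae {n : ℕ} {p s : ℝ} (hp : 1 ≤ p) (hs : 1 ≤ s) {u : Rn n → ℝ}
    {g : Rn n → Rn n} (h : IsTestLimit p s u g) : weakGradient u =ᵐ[volume] g := by
  have hg := h.hasWeakGradient hp hs
  have hex : ∃ g, HasWeakGradient u g := ⟨g, hg⟩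
  rw [weakGradient, dif_pos hex]
  exact hex.choose_spec.ae_eq hg ae_eq_rfl

lemma IsTestFunction.isTestLimit {n : ℕ} (p s : ℝ) {φ : Rn n → ℝ} (h : IsTestFunction φ) :
    IsTestLimit p s φ (gradient φ) :=
  ⟨h.memLp _, h.gradient_memLp _, fun _ => φ, fun _ => h, by simp, by simp⟩

lemma IsTestLimit.sub_test {n : ℕ} {p s : ℝ} {u : Rn n → ℝ}
    {g : Rn n → Rn n} (h : IsTestLimit p s u g) {ψ : Rn n → ℝ} (hψ : IsTestFunction ψ) :
    IsTestLimit p s (fun x => u x - ψ x) (fun x => g x - gradient ψ x) := by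
  obtain ⟨hu, hg, φ, hφ, hφu, hφg⟩ := h
  refine ⟨hu.sub (hψ.memLp _), hg.sub (hψ.gradient_memLp _), fun k x => φ k x - ψ x,
    fun k => (hφ k).sub hψ, ?_, ?_⟩
  · simpa using hφu
  · refine hφg.congr fun k => ?_
    congr 1; ext1 x
    rw [gradient_sub_fun ((hφ k).differentiable x) (hψ.differentiable x)]
    exact (sub_sub_sub_cancel_right _ _ _).symm

/-! ### Scaling and translation -/

lemma map_affine_volume {n : ℕ} {lam : ℝ} (hl : 0 < lam) (x₀ : Rn n) :
    Measure.map (fun x : Rn n => lam • (x - x₀)) volume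
      = ENNReal.ofReal (lam ^ (-(n : ℝ))) • (volume : Measure (Rn n)) := by
  have h1 : (fun x : Rn n => lam • (x - x₀)) = (fun x => lam • x) ∘ (fun x => x - x₀) := rfl
  rw [h1, ← Measure.map_map (by fun_prop) (by fun_prop),
    (measurePreserving_sub_right volume x₀).map_eq, Measure.map_addHaar_smul _ hl.ne']
  congr 2
  rw [finrank_euclideanSpace_fin, Real.rpow_neg hl.le, Real.rpow_natCast,
    abs_of_pos (by positivity)]

lemma eLpNorm_comp_affine {n : ℕ} {F : Type*} [NormedAddCommGroup F] {lam r : ℝ} (hl : 0 < lam)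
    (hr : 0 < r) (x₀ : Rn n) (f : Rn n → F) :
    eLpNorm (fun x => f (lam • (x - x₀))) (ENNReal.ofReal r) volume
      = ENNReal.ofReal (lam ^ (-(n : ℝ) / r)) * eLpNorm f (ENNReal.ofReal r) volume := by
  have hemb : MeasurableEmbedding (fun x : Rn n => lam • (x - x₀)) :=
    ((Homeomorph.subRight x₀).trans (Homeomorph.smulOfNeZero lam hl.ne')).measurableEmbedding
  have h1 := hemb.eLpNorm_map_measure (g := f) (p := ENNReal.ofReal r) (μ := volume)
  have h0 : 0 < lam ^ (-(n : ℝ)) := by positivity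
  rw [map_affine_volume hl, eLpNorm_smul_measure_of_ne_zero (by simpa using h0)] at h1
  rw [show (fun x => f (lam • (x - x₀))) = f ∘ fun x => lam • (x - x₀) from rfl, ← h1,
    ENNReal.ofReal_rpow_of_pos h0, ← Real.rpow_mul hl.le, smul_eq_mul]
  congr 3
  rw [one_div, ENNReal.toReal_inv, ENNReal.toReal_ofReal hr.le]; ring

lemma aestronglyMeasurable_comp_affine {n : ℕ} {F : Type*} [NormedAddCommGroup F] {lam : ℝ}
    (hl : 0 < lam) (x₀ : Rn n) {f : Rn n → F} (hf : AEStronglyMeasurable f volume) :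
    AEStronglyMeasurable (fun x => f (lam • (x - x₀))) volume := by
  refine AEStronglyMeasurable.comp_quasiMeasurePreserving (g := f)
    (f := fun x : Rn n => lam • (x - x₀)) hf ⟨by fun_prop, ?_⟩
  rw [map_affine_volume hl]
  exact Measure.smul_absolutelyContinuous

lemma eLpNorm_smul_comp_affine {n : ℕ} {F : Type*} [NormedAddCommGroup F] [NormedSpace ℝ F]
    {lam r : ℝ} (hl : 0 < lam) (hr : 0 < r) (x₀ : Rn n) {c : ℝ} (hc : 0 ≤ c) (f : Rn n → F) :
    eLpNorm (fun x => c • f (lam • (x - x₀))) (ENNReal.ofReal r) volume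
      = ENNReal.ofReal (c * lam ^ (-(n : ℝ) / r)) * eLpNorm f (ENNReal.ofReal r) volume := by
  rw [show (fun x => c • f (lam • (x - x₀))) = c • fun x => f (lam • (x - x₀)) from rfl,
    eLpNorm_const_smul, eLpNorm_comp_affine hl hr, ← mul_assoc, ENNReal.ofReal_mul hc,
    Real.enorm_eq_ofReal hc]

lemma memLp_smul_comp_affine {n : ℕ} {F : Type*} [NormedAddCommGroup F] [NormedSpace ℝ F]
    {lam r : ℝ} (hl : 0 < lam) (hr : 0 < r) (x₀ : Rn n) {c : ℝ} (hc : 0 ≤ c) {f : Rn n → F}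
    (hf : MemLp f (ENNReal.ofReal r) volume) :
    MemLp (fun x => c • f (lam • (x - x₀))) (ENNReal.ofReal r) volume :=
  ⟨(aestronglyMeasurable_comp_affine hl x₀ hf.1).const_smul c, by
    rw [eLpNorm_smul_comp_affine hl hr x₀ hc]
    exact ENNReal.mul_lt_top ENNReal.ofReal_lt_top hf.2⟩

lemma norml_smul_comp_affine {n : ℕ} {F : Type*} [NormedAddCommGroup F] [NormedSpace ℝ F]
    {lam r : ℝ} (hl : 0 < lam) (hr : 0 < r) (x₀ : Rn n) {c : ℝ} (hc : 0 ≤ c) {f : Rn n → F}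
    (hf : AEStronglyMeasurable f volume) :
    norml r (fun x => c • f (lam • (x - x₀))) = c * lam ^ (-(n : ℝ) / r) * norml r f := by
  rw [norml_eq_toReal (f := fun x => c • f (lam • (x - x₀)))
      ((aestronglyMeasurable_comp_affine hl x₀ hf).const_smul c),
    norml_eq_toReal hf, eLpNorm_smul_comp_affine hl hr x₀ hc, ENNReal.toReal_mul,
    ENNReal.toReal_ofReal (by positivity)]

lemma norml_rescale {n : ℕ} {q lam r : ℝ} (hl : 0 < lam) (hr : 0 < r) (x₀ : Rn n) {u : Rn n → ℝ}
    (hu : AEStronglyMeasurable u volume) :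
    norml r (rescale q lam x₀ u) = lam ^ ((n : ℝ) / q - n / r) * norml r u := by
  have := norml_smul_comp_affine hl hr x₀ (c := lam ^ ((n : ℝ) / q)) (by positivity) hu
  rw [← Real.rpow_add hl, show (n : ℝ) / q + -n / r = n / q - n / r by ring] at this
  exact this

lemma norml_rescale_self {n : ℕ} {q lam : ℝ} (hl : 0 < lam) (hq : 0 < q) (x₀ : Rn n)
    {u : Rn n → ℝ} (hu : AEStronglyMeasurable u volume) :
    norml q (rescale q lam x₀ u) = norml q u := by
  rw [norml_rescale hl hq x₀ hu]; simp

/-- Multiplication by a constant, dilation and translation of a limit of test functions. -/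
lemma IsTestLimit.comp_affine {n : ℕ} {p s lam c : ℝ} (hp : 0 < p) (hs : 0 < s) (hl : 0 < lam)
    (hc : 0 ≤ c) (x₀ : Rn n) {u : Rn n → ℝ} {g : Rn n → Rn n} (h : IsTestLimit p s u g) :
    IsTestLimit p s (fun x => c * u (lam • (x - x₀)))
      (fun x => (c * lam) • g (lam • (x - x₀))) := by
  obtain ⟨hu, hg, φ, hφ, hφu, hφg⟩ := h
  refine ⟨memLp_smul_comp_affine hl hs x₀ hc hu,
    memLp_smul_comp_affine hl hp x₀ (by positivity) hg,
    fun k x => c * φ k (lam • (x - x₀)), fun k => ((hφ k).comp_affine hl.ne' x₀).const_mul c,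
    ?_, ?_⟩
  · have := ENNReal.Tendsto.const_mul (a := ENNReal.ofReal (c * lam ^ (-(n : ℝ) / s))) hφu
      (Or.inr ENNReal.ofReal_ne_top)
    rw [mul_zero] at this
    refine this.congr fun k => ?_
    rw [← eLpNorm_smul_comp_affine hl hs x₀ hc]
    congr 1; ext1 x; rw [smul_eq_mul]; ring
  · have := ENNReal.Tendsto.const_mul (a := ENNReal.ofReal (c * lam * lam ^ (-(n : ℝ) / p))) hφg
      (Or.inr ENNReal.ofReal_ne_top)
    rw [mul_zero] at this
    refine this.congr fun k => ?_
    rw [← eLpNorm_smul_comp_affine hl hp x₀ (by positivity)]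
    congr 1; ext1 x
    rw [gradient_const_mul_fun c (((hφ k).comp_affine hl.ne' x₀).differentiable x),
      gradient_comp_affine (hφ k).differentiable, smul_smul, smul_sub]

lemma rescale_rescale_inv {n : ℕ} {q lam : ℝ} (hl : 0 < lam) (x₀ : Rn n) (u : Rn n → ℝ) :
    rescale q lam⁻¹ (-(lam • x₀)) (rescale q lam x₀ u) = u := by
  ext x
  have h1 : lam⁻¹ ^ ((n : ℝ) / q) * lam ^ ((n : ℝ) / q) = 1 := by
    rw [← Real.mul_rpow (by positivity) hl.le, inv_mul_cancel₀ hl.ne', Real.one_rpow]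
  have h2 : lam • (lam⁻¹ • (x - -(lam • x₀)) - x₀) = x := by
    rw [smul_sub, smul_smul, mul_inv_cancel₀ hl.ne', one_smul]; simp
  simp only [rescale]
  rw [h2, ← mul_assoc, h1, one_mul]

section Invariance

variable {n : ℕ} {p s q θ : ℝ}

lemma MemD.rescale (hp : 1 ≤ p) (hs : 1 ≤ s) {lam : ℝ} (hl : 0 < lam) (x₀ : Rn n)
    {u : Rn n → ℝ} (hu : MemD p s u) : MemD p s (rescale q lam x₀ u) := by
  obtain ⟨g, hg⟩ := (memD_iff hp hs).1 hu
  exact (memD_iff hp hs).2 ⟨_, hg.comp_affine (by linarith) (by linarith) hl (by positivity) x₀⟩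

lemma norml_weakGradient_rescale (hp : 1 ≤ p) (hs : 1 ≤ s) {lam : ℝ} (hl : 0 < lam) (x₀ : Rn n)
    {u : Rn n → ℝ} (hu : MemD p s u) :
    norml p (weakGradient (rescale q lam x₀ u))
      = lam ^ ((n : ℝ) / q + 1 - n / p) * norml p (weakGradient u) := by
  obtain ⟨g, hg⟩ := (memD_iff hp hs).1 hu
  have h1 : IsTestLimit p s (rescale q lam x₀ u) _ := hg.comp_affine (by linarith) (by linarith) hl
    (by positivity : 0 ≤ lam ^ ((n : ℝ) / q)) x₀
  rw [norml_congr_ae (h1.weakGradient_ae hp hs), norml_congr_ae (hg.weakGradient_ae hp hs),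
    norml_smul_comp_affine hl (by linarith) x₀ (by positivity) hg.2.1.1]
  congr 1
  rw [← Real.rpow_add_one hl.ne', ← Real.rpow_add hl]
  congr 1; ring

lemma sobolev_exponent_pos (hp : 1 < p) (hpn : p < (n : ℝ)) :
    0 < (n : ℝ) * p / ((n : ℝ) - p) :=
  div_pos (mul_pos (by linarith) (by linarith)) (by linarith)

lemma inv_sobolev_exponent (hp : 1 < p) (hpn : p < (n : ℝ)) :
    1 / ((n : ℝ) * p / ((n : ℝ) - p)) = 1 / p - 1 / n := by
  have : (0 : ℝ) < n := by linarith
  have : (0 : ℝ) < n - p := by linarith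
  field_simp

lemma lt_sobolev_exponent (hp : 1 < p) (hpn : p < (n : ℝ)) :
    p < (n : ℝ) * p / ((n : ℝ) - p) := by
  rw [lt_div_iff₀ (by linarith)]
  nlinarith

/-- The scaling identity behind the invariance of the functional: the powers of the dilation
factor in `‖∇u‖_p^θ` and `‖u‖_s^{1-θ}` cancel. -/
lemma scaling_identity (hp : 1 < p) (hpn : p < (n : ℝ))
    (hθ : θ / ((n : ℝ) * p / ((n : ℝ) - p)) + (1 - θ) / s = 1 / q) :
    ((n : ℝ) / q + 1 - n / p) * θ + ((n : ℝ) / q - n / s) * (1 - θ) = 0 := by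
  have hn : (0 : ℝ) < n := by linarith
  rw [div_eq_mul_one_div θ, inv_sobolev_exponent hp hpn] at hθ
  have h1 : (n : ℝ) * (θ * (1 / p - 1 / n) + (1 - θ) / s) = n * (1 / q) := by rw [hθ]
  have h2 : (n : ℝ) * (θ * (1 / n)) = θ := by field_simp
  linear_combination (-1 : ℝ) * h1 - h2

lemma gnsFunctional_rescale (hp : 1 < p) (hpn : p < (n : ℝ)) (hs : 1 ≤ s)
    (hθ : θ / ((n : ℝ) * p / ((n : ℝ) - p)) + (1 - θ) / s = 1 / q) {lam : ℝ} (hl : 0 < lam)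
    (x₀ : Rn n) {u : Rn n → ℝ} (hu : MemD p s u) :
    gnsFunctional p s θ (rescale q lam x₀ u) = gnsFunctional p s θ u := by
  unfold gnsFunctional
  rw [norml_weakGradient_rescale hp.le hs hl x₀ hu, norml_rescale hl (by linarith) x₀ hu.1.1,
    Real.mul_rpow (by positivity) (norml_nonneg _ _),
    Real.mul_rpow (by positivity) (norml_nonneg _ _), mul_mul_mul_comm, ← Real.rpow_mul hl.le,
    ← Real.rpow_mul hl.le, ← Real.rpow_add hl, scaling_identity hp hpn hθ, Real.rpow_zero,
    one_mul]

lemma deficit_rescale (hp : 1 < p) (hpn : p < (n : ℝ)) (hs : 1 ≤ s) (hq : 0 < q)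
    (hθ : θ / ((n : ℝ) * p / ((n : ℝ) - p)) + (1 - θ) / s = 1 / q) {lam : ℝ} (hl : 0 < lam)
    (x₀ : Rn n) {u : Rn n → ℝ} (hu : MemD p s u) :
    deficit p s q θ (rescale q lam x₀ u) = deficit p s q θ u := by
  unfold deficit
  rw [gnsFunctional_rescale hp hpn hs hθ hl x₀ hu, norml_rescale_self hl hq x₀ hu.1.1]

lemma IsNonzero.rescale {lam : ℝ} (hl : 0 < lam) (x₀ : Rn n) {u : Rn n → ℝ}
    (hu : IsNonzero u) : IsNonzero (rescale q lam x₀ u) := by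
  intro h
  apply hu
  have hq : Measure.QuasiMeasurePreserving
      (fun x : Rn n => lam⁻¹ • (x - -(lam • x₀))) volume volume := by
    refine ⟨by fun_prop, ?_⟩
    rw [map_affine_volume (inv_pos.2 hl)]
    exact Measure.smul_absolutelyContinuous
  have h2 := hq.ae h
  filter_upwards [h2] with x hx
  have h3 := congrFun (rescale_rescale_inv (q := q) hl x₀ u) x
  rw [← h3]
  simp only [_root_.rescale] at hx ⊢
  rw [hx]; simp

lemma IsGNSOptimal.rescale (hp : 1 < p) (hpn : p < (n : ℝ)) (hs : 1 ≤ s) (hq : 0 < q)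
    (hθ : θ / ((n : ℝ) * p / ((n : ℝ) - p)) + (1 - θ) / s = 1 / q) {lam : ℝ} (hl : 0 < lam)
    (x₀ : Rn n) {v : Rn n → ℝ} (hv : IsGNSOptimal p s q θ v) :
    IsGNSOptimal p s q θ (rescale q lam x₀ v) :=
  ⟨hv.1.rescale hp.le hs hl x₀, hv.2.1.rescale hl x₀, by
    rw [gnsFunctional_rescale hp hpn hs hθ hl x₀ hv.1, norml_rescale_self hl hq x₀ hv.1.1.1,
      hv.2.2]⟩

/-- The competitors in the asymmetry of `u` are carried to competitors for the rescaled function,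
with the same value. -/
lemma asymmetry_set_subset (hp : 1 < p) (hpn : p < (n : ℝ)) (hs : 1 ≤ s) (hq : 0 < q)
    (hθ : θ / ((n : ℝ) * p / ((n : ℝ) - p)) + (1 - θ) / s = 1 / q) {lam : ℝ} (hl : 0 < lam)
    (x₀ : Rn n) {u : Rn n → ℝ} (hu : MemD p s u) :
    {t : ℝ | ∃ v : Rn n → ℝ, IsGNSOptimal p s q θ v ∧ norml q v = norml q u ∧
      t = norml q (fun x => u x - v x) ^ q / norml q u ^ q} ⊆
    {t : ℝ | ∃ v : Rn n → ℝ, IsGNSOptimal p s q θ v ∧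
      norml q v = norml q (rescale q lam x₀ u) ∧
      t = norml q (fun x => rescale q lam x₀ u x - v x) ^ q /
        norml q (rescale q lam x₀ u) ^ q} := by
  rintro t ⟨v, hv, hvu, rfl⟩
  refine ⟨rescale q lam x₀ v, hv.rescale hp hpn hs hq hθ hl x₀, ?_, ?_⟩
  · rw [norml_rescale_self hl hq x₀ hv.1.1.1, norml_rescale_self hl hq x₀ hu.1.1, hvu]
  · have h1 : (fun x => rescale q lam x₀ u x - rescale q lam x₀ v x)
        = rescale q lam x₀ (fun x => u x - v x) := by
      ext x; simp only [rescale]; ring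
    rw [h1, norml_rescale_self (u := fun x => u x - v x) hl hq x₀ (hu.1.1.sub hv.1.1.1),
      norml_rescale_self hl hq x₀ hu.1.1]

/-- The two sets of values coincide, so the infima agree even if there is no optimal function and
both are the junk value `0`. -/
lemma asymmetry_rescale (hp : 1 < p) (hpn : p < (n : ℝ)) (hs : 1 ≤ s) (hq : 0 < q)
    (hθ : θ / ((n : ℝ) * p / ((n : ℝ) - p)) + (1 - θ) / s = 1 / q) {lam : ℝ} (hl : 0 < lam)
    (x₀ : Rn n) {u : Rn n → ℝ} (hu : MemD p s u) :
    asymmetry p s q θ (rescale q lam x₀ u) = asymmetry p s q θ u := by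
  unfold asymmetry
  congr 1
  refine Set.Subset.antisymm ?_ (asymmetry_set_subset hp hpn hs hq hθ hl x₀ hu)
  have := asymmetry_set_subset hp hpn hs hq hθ (inv_pos.2 hl) (-(lam • x₀))
    (hu.rescale (q := q) hp.le hs hl x₀)
  rwa [rescale_rescale_inv hl] at this

end Invariance

/-! ### The Gagliardo–Nirenberg–Sobolev inequality on `D^{p,s}` -/

lemma exists_subseq_ae_tendsto_of_eLpNorm {α F : Type*} [MeasurableSpace α] {μ : Measure α}
    [NormedAddCommGroup F] {r : ENNReal} (hr : r ≠ 0) {f : ℕ → α → F} {f₀ : α → F}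
    (hf : ∀ k, AEStronglyMeasurable (f k) μ) (hf₀ : AEStronglyMeasurable f₀ μ)
    (h : Tendsto (fun k => eLpNorm (fun x => f k x - f₀ x) r μ) atTop (𝓝 0)) :
    ∃ ns : ℕ → ℕ, StrictMono ns ∧ ∀ᵐ x ∂μ, Tendsto (fun i => f (ns i) x) atTop (𝓝 (f₀ x)) :=
  (tendstoInMeasure_of_tendsto_eLpNorm hr hf hf₀ h).exists_seq_tendsto_ae

lemma tendsto_eLpNorm_of_tendsto_sub {α F : Type*} [MeasurableSpace α] {μ : Measure α}
    [NormedAddCommGroup F] {r : ENNReal} (hr : 1 ≤ r) {f : ℕ → α → F} {f₀ : α → F}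
    (hf : ∀ k, AEStronglyMeasurable (f k) μ) (hf₀ : MemLp f₀ r μ)
    (h : Tendsto (fun k => eLpNorm (fun x => f k x - f₀ x) r μ) atTop (𝓝 0)) :
    Tendsto (fun k => eLpNorm (f k) r μ) atTop (𝓝 (eLpNorm f₀ r μ)) := by
  refine tendsto_of_tendsto_of_tendsto_of_le_of_le (g := fun k => eLpNorm f₀ r μ -
    eLpNorm (fun x => f k x - f₀ x) r μ) (h := fun k => eLpNorm f₀ r μ +
    eLpNorm (fun x => f k x - f₀ x) r μ) ?_ ?_ ?_ ?_
  · simpa using ENNReal.Tendsto.sub (tendsto_const_nhds (x := eLpNorm f₀ r μ)) h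
      (Or.inl hf₀.2.ne)
  · simpa using (tendsto_const_nhds (x := eLpNorm f₀ r μ)).add h
  · intro k
    refine tsub_le_iff_right.2 ?_
    have := eLpNorm_sub_le (hf k) ((hf k).sub hf₀.1) hr
    simpa [Pi.sub_def] using this
  · intro k
    have := eLpNorm_add_le hf₀.1 ((hf k).sub hf₀.1) hr
    simpa [Pi.sub_def, Pi.add_def] using this

section SharpInequality

variable {n : ℕ} {p s q θ : ℝ}

lemma theta_bounds (hs : 1 ≤ s) (hsq : s < q) {P : ℝ} (hq : q < P)
    (hθ : θ / P + (1 - θ) / s = 1 / q) : 0 < θ ∧ θ < 1 := by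
  have h1 : 1 / q < 1 / s := one_div_lt_one_div_of_lt (by linarith) hsq
  have h2 : 1 / P < 1 / q := one_div_lt_one_div_of_lt (by linarith) hq
  have h3 : θ * (1 / s - 1 / P) = 1 / s - 1 / q := by rw [← hθ]; ring
  have h4 : 0 < 1 / s - 1 / P := by linarith
  constructor
  · by_contra h; push Not at h; nlinarith
  · by_contra h; push Not at h; nlinarith

/-- The Sobolev inequality for test functions. -/
lemma exists_sobolev_const (hp : 1 < p) (hpn : p < (n : ℝ)) :
    ∃ C : ℝ, 0 < C ∧ ∀ φ : Rn n → ℝ, IsTestFunction φ →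
      eLpNorm φ (ENNReal.ofReal ((n : ℝ) * p / ((n : ℝ) - p))) volume
        ≤ ENNReal.ofReal C * eLpNorm (gradient φ) (ENNReal.ofReal p) volume := by
  have hP := sobolev_exponent_pos hp hpn
  set P := (n : ℝ) * p / ((n : ℝ) - p) with hPdef
  refine ⟨SNormLESNormFDerivOfEqConst ℝ (volume : Measure (Rn n)) p.toNNReal + 1, by positivity,
    fun φ hφ => ?_⟩
  have h1 := eLpNorm_le_eLpNorm_fderiv_of_eq (volume : Measure (Rn n)) (u := φ)
    (hφ.1.of_le (by simp)) hφ.2 (p := p.toNNReal) (p' := P.toNNReal)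
    (by simpa using Real.toNNReal_le_toNNReal hp.le)
    (by rw [finrank_euclideanSpace_fin]; exact_mod_cast (by linarith : (0 : ℝ) < n))
    (by
      rw [finrank_euclideanSpace_fin, Real.coe_toNNReal _ hP.le, NNReal.coe_inv,
        Real.coe_toNNReal _ (by linarith)]
      have h := inv_sobolev_exponent hp hpn
      rw [← hPdef] at h
      simpa using h)
  have h2 : eLpNorm (fderiv ℝ φ) (p.toNNReal) volume
      = eLpNorm (gradient φ) (ENNReal.ofReal p) volume :=
    eLpNorm_congr_norm_ae (Eventually.of_forall fun x => (norm_gradient φ x).symm)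
  rw [h2] at h1
  refine h1.trans ?_
  gcongr
  rw [ENNReal.ofReal_add (by positivity) zero_le_one, ENNReal.ofReal_coe_nnreal]
  exact le_self_add

/-- Sobolev's inequality passes to limits of test functions, by Fatou's lemma. -/
lemma IsTestLimit.sobolev (hs : 1 ≤ s) (hp : 1 ≤ p) {P C : ℝ}
    (hC : ∀ φ : Rn n → ℝ, IsTestFunction φ → eLpNorm φ (ENNReal.ofReal P) volume
        ≤ ENNReal.ofReal C * eLpNorm (gradient φ) (ENNReal.ofReal p) volume)
    {u : Rn n → ℝ} {g : Rn n → Rn n} (h : IsTestLimit p s u g) :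
    eLpNorm u (ENNReal.ofReal P) volume
      ≤ ENNReal.ofReal C * eLpNorm g (ENNReal.ofReal p) volume := by
  obtain ⟨hu, hg, φ, hφ, hφu, hφg⟩ := h
  obtain ⟨ns, hns, hae⟩ := exists_subseq_ae_tendsto_of_eLpNorm
    (by simpa using by linarith) (fun k => (hφ k).continuous.aestronglyMeasurable) hu.1 hφu
  have h1 := tendsto_eLpNorm_of_tendsto_sub (one_le_ofReal hp)
    (fun k => (hφ k).gradient_continuous.aestronglyMeasurable) hg hφg
  have h2 := (ENNReal.Tendsto.const_mul (a := ENNReal.ofReal C) h1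
    (Or.inr ENNReal.ofReal_ne_top)).comp hns.tendsto_atTop
  calc eLpNorm u (ENNReal.ofReal P) volume
      ≤ liminf (fun k => eLpNorm (φ (ns k)) (ENNReal.ofReal P) volume) atTop :=
        Lp.eLpNorm_lim_le_liminf_eLpNorm (fun k => (hφ _).continuous.aestronglyMeasurable) u hae
    _ ≤ liminf (fun k => ENNReal.ofReal C *
          eLpNorm (gradient (φ (ns k))) (ENNReal.ofReal p) volume) atTop :=
        liminf_le_liminf (Eventually.of_forall fun k => hC _ (hφ _))
    _ = _ := h2.liminf_eq

/-- The (non-sharp) Gagliardo–Nirenberg inequality: Sobolev's inequality and interpolation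
between `L^s` and `L^{p⋆}`. -/
lemma exists_gns_const (hp : 1 < p) (hpn : p < (n : ℝ)) (hs : 1 ≤ s) (hsq : s < q)
    (hq : q < (n : ℝ) * p / ((n : ℝ) - p))
    (hθ : θ / ((n : ℝ) * p / ((n : ℝ) - p)) + (1 - θ) / s = 1 / q) :
    ∃ C : ℝ, 0 < C ∧ ∀ (u : Rn n → ℝ) (g : Rn n → Rn n), IsTestLimit p s u g →
      MemLp u (ENNReal.ofReal ((n : ℝ) * p / ((n : ℝ) - p))) volume ∧
      MemLp u (ENNReal.ofReal q) volume ∧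
      norml q u ≤ C * (norml p g ^ θ * norml s u ^ (1 - θ)) := by
  obtain ⟨C, hC0, hC⟩ := exists_sobolev_const hp hpn
  have hP := sobolev_exponent_pos hp hpn
  obtain ⟨hθ0, hθ1⟩ := theta_bounds hs hsq hq hθ
  refine ⟨C ^ θ, by positivity, fun u g h => ?_⟩
  have h1 := h.sobolev hs hp.le hC
  have h2 := eLpNorm_le_interpolation (a := s) (b := q) (c := (n : ℝ) * p / ((n : ℝ) - p)) (t := θ)
    h.1.1 (by linarith) (by linarith) hP hθ0.le hθ1.le (by rw [← hθ]; ring)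
  have h3 : eLpNorm u (ENNReal.ofReal q) volume ≤
      eLpNorm u (ENNReal.ofReal s) volume ^ (1 - θ) *
        (ENNReal.ofReal C * eLpNorm g (ENNReal.ofReal p) volume) ^ θ :=
    h2.trans (by gcongr)
  have hfin : eLpNorm u (ENNReal.ofReal s) volume ^ (1 - θ) *
        (ENNReal.ofReal C * eLpNorm g (ENNReal.ofReal p) volume) ^ θ < ⊤ :=
    ENNReal.mul_lt_top (ENNReal.rpow_lt_top_of_nonneg (by linarith) h.1.2.ne)
      (ENNReal.rpow_lt_top_of_nonneg hθ0.le
        (ENNReal.mul_lt_top ENNReal.ofReal_lt_top h.2.1.2).ne)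
  refine ⟨⟨h.1.1, h1.trans_lt (ENNReal.mul_lt_top ENNReal.ofReal_lt_top h.2.1.2)⟩,
    ⟨h.1.1, h3.trans_lt hfin⟩, ?_⟩
  rw [norml_eq_toReal h.1.1, norml_eq_toReal h.1.1, norml_eq_toReal h.2.1.1]
  refine (ENNReal.toReal_mono hfin.ne h3).trans (le_of_eq ?_)
  rw [ENNReal.toReal_mul, ← ENNReal.toReal_rpow, ← ENNReal.toReal_rpow, ENNReal.toReal_mul,
    ENNReal.toReal_ofReal hC0.le, Real.mul_rpow hC0.le ENNReal.toReal_nonneg]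
  ring

lemma norml_pos {F : Type*} [NormedAddCommGroup F] {r : ℝ} (hr : 0 < r) {f : Rn n → F}
    (hf : MemLp f (ENNReal.ofReal r) volume) (h : ¬ f =ᵐ[volume] 0) : 0 < norml r f := by
  refine lt_of_le_of_ne (norml_nonneg _ _) fun h0 => h ?_
  exact (lpNorm_eq_zero hf (by simpa using hr)).1 h0.symm

/-- The sharp inequality on `D^{p,s}`, together with the positivity of the sharp constant. -/
lemma gns_sharp (hp : 1 < p) (hpn : p < (n : ℝ)) (hs : 1 ≤ s) (hsq : s < q)
    (hq : q < (n : ℝ) * p / ((n : ℝ) - p))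
    (hθ : θ / ((n : ℝ) * p / ((n : ℝ) - p)) + (1 - θ) / s = 1 / q) {u : Rn n → ℝ}
    (hu : MemD p s u) (hu0 : IsNonzero u) :
    0 < gnsConst n p s q θ ∧ 0 < norml q u ∧ 0 < norml s u ∧ 0 < norml p (weakGradient u) ∧
      gnsConst n p s q θ * norml q u ≤ gnsFunctional p s θ u := by
  obtain ⟨C, hC0, hC⟩ := exists_gns_const hp hpn hs hsq hq hθ
  obtain ⟨hθ0, hθ1⟩ := theta_bounds hs hsq hq hθ
  have key : ∀ v : Rn n → ℝ, MemD p s v → IsNonzero v → 0 < norml q v ∧ 0 < norml s v ∧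
      norml q v ≤ C * gnsFunctional p s θ v := by
    intro v hv hv0
    obtain ⟨g, hg⟩ := (memD_iff hp.le hs).1 hv
    obtain ⟨-, hq', hle⟩ := hC v g hg
    refine ⟨norml_pos (by linarith) hq' hv0, norml_pos (by linarith) hv.1 hv0, ?_⟩
    rwa [gnsFunctional, norml_congr_ae (hg.weakGradient_ae hp.le hs)]
  have hlow : ∀ t ∈ {t : ℝ | ∃ u : Rn n → ℝ, MemD p s u ∧ IsNonzero u ∧
      t = gnsFunctional p s θ u / norml q u}, C⁻¹ ≤ t := by
    rintro t ⟨v, hv, hv0, rfl⟩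
    obtain ⟨h1, -, h2⟩ := key v hv hv0
    rw [le_div_iff₀ h1, inv_mul_le_iff₀ hC0]
    exact h2
  obtain ⟨h1, h2, h3⟩ := key u hu hu0
  have hG : C⁻¹ ≤ gnsConst n p s q θ := le_csInf ⟨_, u, hu, hu0, rfl⟩ hlow
  refine ⟨lt_of_lt_of_le (by positivity) hG, h1, h2, ?_, ?_⟩
  · refine lt_of_le_of_ne (norml_nonneg _ _) fun h0 => ?_
    rw [gnsFunctional, ← h0, Real.zero_rpow hθ0.ne'] at h3
    simp at h3; linarith
  · rw [← le_div_iff₀ h1]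
    exact csInf_le ⟨C⁻¹, hlow⟩ ⟨u, hu, hu0, rfl⟩

lemma gns_sharp_test (hp : 1 < p) (hpn : p < (n : ℝ)) (hs : 1 ≤ s) (hsq : s < q)
    (hq : q < (n : ℝ) * p / ((n : ℝ) - p))
    (hθ : θ / ((n : ℝ) * p / ((n : ℝ) - p)) + (1 - θ) / s = 1 / q) {φ : Rn n → ℝ}
    (hφ : IsTestFunction φ) :
    gnsConst n p s q θ * norml q φ ≤ norml p (gradient φ) ^ θ * norml s φ ^ (1 - θ) := by
  have hl := hφ.isTestLimit p s
  by_cases h0 : φ =ᵐ[volume] 0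
  · have : norml q φ = 0 := (lpNorm_eq_zero (hφ.memLp _) (by simpa using by linarith)).2 h0
    rw [this, mul_zero]
    exact mul_nonneg (Real.rpow_nonneg (norml_nonneg _ _) _)
      (Real.rpow_nonneg (norml_nonneg _ _) _)
  · have h := (gns_sharp hp hpn hs hsq hq hθ ((memD_iff hp.le hs).2 ⟨_, hl⟩) h0).2.2.2.2
    rwa [gnsFunctional, norml_congr_ae (hl.weakGradient_ae hp.le hs)] at h

end SharpInequality

/-! ### Cutoff functions -/

/-- A smooth cutoff at scale `R` around `y`: it is `1` on the ball of radius `R` and vanishes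
outside the ball of radius `2R`. All of them are dilations and translations of one bump function,
so that their gradients are `O(1/R)` with a uniform constant. -/
noncomputable def cutoff {n : ℕ} (R : ℝ) (y : Rn n) : Rn n → ℝ := fun x =>
  (⟨1, 2, one_pos, one_lt_two⟩ : ContDiffBump (0 : Rn n)) (R⁻¹ • (x - y))

section Cutoff

variable {n : ℕ} {R : ℝ} {y : Rn n}

lemma cutoff_isTestFunction (hR : 0 < R) (y : Rn n) : IsTestFunction (cutoff R y) :=
  IsTestFunction.comp_affine (φ := (⟨1, 2, one_pos, one_lt_two⟩ : ContDiffBump (0 : Rn n)))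
    ⟨ContDiffBump.contDiff _, ContDiffBump.hasCompactSupport _⟩ (inv_ne_zero hR.ne') y

lemma cutoff_nonneg (x : Rn n) : 0 ≤ cutoff R y x := ContDiffBump.nonneg _

lemma cutoff_le_one (x : Rn n) : cutoff R y x ≤ 1 := ContDiffBump.le_one _

lemma cutoff_eq_one (hR : 0 < R) {x : Rn n} (hx : x ∈ Metric.closedBall y R) :
    cutoff R y x = 1 := by
  refine ContDiffBump.one_of_mem_closedBall _ ?_
  rw [mem_closedBall_zero_iff, norm_smul, norm_inv, Real.norm_of_nonneg hR.le,
    inv_mul_le_iff₀ hR, mul_one, ← dist_eq_norm]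
  exact hx

lemma cutoff_eq_zero (hR : 0 < R) {x : Rn n} (hx : x ∉ Metric.closedBall y (2 * R)) :
    cutoff R y x = 0 := by
  refine ContDiffBump.zero_of_le_dist _ ?_
  rw [dist_zero_right, norm_smul, norm_inv, Real.norm_of_nonneg hR.le, le_inv_mul_iff₀ hR,
    ← dist_eq_norm]
  simp at hx ⊢
  linarith

lemma gradient_cutoff_eq_zero (hR : 0 < R) {x : Rn n} (hx : x ∉ Metric.closedBall y (2 * R)) :
    gradient (cutoff R y) x = 0 := by
  have h : cutoff R y =ᶠ[𝓝 x] fun _ => 0 :=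
    (Metric.isClosed_closedBall.isOpen_compl.eventually_mem hx).mono
      fun z hz => cutoff_eq_zero hR hz
  rw [← norm_eq_zero, norm_gradient, h.fderiv_eq]
  simp

lemma exists_norm_gradient_cutoff_le (n : ℕ) :
    ∃ L : ℝ, 0 ≤ L ∧ ∀ R : ℝ, 0 < R → ∀ y x : Rn n, ‖gradient (cutoff R y) x‖ ≤ L / R := by
  have h0 := cutoff_isTestFunction (n := n) one_pos 0
  obtain ⟨L, hL⟩ := h0.gradient_continuous.bounded_above_of_compact_support
    h0.gradient_hasCompactSupport
  refine ⟨L, (norm_nonneg _).trans (hL 0), fun R hR y x => ?_⟩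
  have h1 : cutoff R y = fun x => cutoff (n := n) 1 0 (R⁻¹ • (x - y)) := by
    ext x; simp [cutoff]
  rw [h1, gradient_comp_affine h0.differentiable, norm_smul, norm_inv, Real.norm_of_nonneg hR.le,
    div_eq_inv_mul]
  gcongr
  exact hL _

/-- The error term `φ ∇χ` created by a cutoff at scale `R` is small in `L^p` as `R → ∞` for
functions bounded in `L^t`, as soon as `t < p⋆`. -/
lemma exists_cutoff_error (n : ℕ) {p t : ℝ} (hp : 1 ≤ p) (hpt : p ≤ t) :
    ∃ C : ℝ, 0 ≤ C ∧ ∀ R : ℝ, 0 < R → ∀ (y : Rn n) (φ : Rn n → ℝ),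
      AEStronglyMeasurable φ volume →
      eLpNorm (fun x => φ x • gradient (cutoff R y) x) (ENNReal.ofReal p) volume ≤
        ENNReal.ofReal (C * R ^ (-1 + (n : ℝ) * (1 / p - 1 / t))) *
          eLpNorm φ (ENNReal.ofReal t) (volume.restrict (Metric.closedBall y (2 * R))) := by
  obtain ⟨L, hL0, hL⟩ := exists_norm_gradient_cutoff_le n
  set V := volume.real (Metric.ball (0 : Rn n) 1) with hV
  have hexp : 0 ≤ 1 / p - 1 / t := by
    have := one_div_le_one_div_of_le (by linarith) hpt
    linarith
  refine ⟨L * (2 ^ (n : ℝ) * V) ^ (1 / p - 1 / t), by positivity, fun R hR y φ hφ => ?_⟩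
  set B := Metric.closedBall y (2 * R)
  have hB : volume B = ENNReal.ofReal ((2 * R) ^ (n : ℝ) * V) := by
    rw [Measure.addHaar_closedBall volume y (by positivity), finrank_euclideanSpace_fin,
      ENNReal.ofReal_mul (by positivity), hV, ofReal_measureReal, Real.rpow_natCast]
  have h1 : eLpNorm (fun x => φ x • gradient (cutoff R y) x) (ENNReal.ofReal p) volume ≤
      ENNReal.ofReal (L / R) * eLpNorm φ (ENNReal.ofReal p) (volume.restrict B) := by
    rw [← eLpNorm_indicator_eq_eLpNorm_restrict Metric.isClosed_closedBall.measurableSet]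
    refine eLpNorm_le_mul_eLpNorm_of_ae_le_mul (Eventually.of_forall fun x => ?_) _
    by_cases hx : x ∈ B
    · rw [Set.indicator_of_mem hx, norm_smul, mul_comm]
      gcongr
      exact hL R hR y x
    · rw [gradient_cutoff_eq_zero hR hx, smul_zero, norm_zero]
      positivity
  have h2 := eLpNorm_le_eLpNorm_mul_rpow_measure_univ (μ := volume.restrict B)
    (ENNReal.ofReal_le_ofReal hpt) hφ.restrict
  rw [Measure.restrict_apply_univ, ENNReal.toReal_ofReal (by linarith),
    ENNReal.toReal_ofReal (by linarith), hB,
    ENNReal.ofReal_rpow_of_nonneg (by positivity) hexp] at h2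
  refine h1.trans ((mul_le_mul_right h2 _).trans (le_of_eq ?_))
  rw [mul_comm (eLpNorm _ _ _), ← mul_assoc, ← ENNReal.ofReal_mul (by positivity)]
  congr 2
  rw [Real.mul_rpow (by positivity) hR.le, Real.rpow_add hR, Real.rpow_neg_one, mul_right_comm,
    Real.mul_rpow (by positivity) (by positivity), ← Real.rpow_mul hR.le]
  ring

lemma gradient_cutoff_mul (hR : 0 < R) {φ : Rn n → ℝ} (hφ : IsTestFunction φ) (x : Rn n) :
    gradient (fun z => cutoff R y z * φ z) x
      = cutoff R y x • gradient φ x + φ x • gradient (cutoff R y) x :=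
  gradient_mul_fun ((cutoff_isTestFunction hR y).differentiable x) (hφ.differentiable x)

end Cutoff

/-! ### Local compactness -/

section LocalCompactness

variable {n : ℕ} {p s q : ℝ}

lemma eLpNorm_gradient_comp_add {r : ENNReal} {φ : Rn n → ℝ} (z : Rn n)
    (hφ : IsTestFunction φ) :
    eLpNorm (fun x => gradient φ (x + z)) r volume = eLpNorm (gradient φ) r volume :=
  eLpNorm_comp_measurePreserving (g := gradient φ) (f := fun x => x + z)
    hφ.gradient_continuous.aestronglyMeasurable (measurePreserving_add_right volume z)

lemma enorm_sub_le_lintegral_gradient {φ : Rn n → ℝ} (hφ : IsTestFunction φ) (x z : Rn n) :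
    ‖φ (x + z) - φ x‖ₑ ≤
      ∫⁻ t in Set.Ioc (0 : ℝ) 1, ‖z‖ₑ * ‖gradient φ (x + t • z)‖ₑ := by
  have hd : ∀ t : ℝ, HasDerivAt (fun t : ℝ => φ (x + t • z)) (fderiv ℝ φ (x + t • z) z) t := by
    intro t
    have h1 : HasDerivAt (fun t : ℝ => x + t • z) z t := by
      simpa using ((hasDerivAt_id t).smul_const z).const_add x
    exact (hφ.differentiable _).hasFDerivAt.comp_hasDerivAt t h1
  have hc : Continuous fun t : ℝ => fderiv ℝ φ (x + t • z) z :=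
    ((hφ.1.continuous_fderiv (by simp)).comp (by fun_prop)).clm_apply continuous_const
  have h2 := intervalIntegral.integral_eq_sub_of_hasDerivAt (fun t _ => hd t)
    (hc.intervalIntegrable 0 1)
  simp only [one_smul, zero_smul, add_zero] at h2
  rw [← h2, intervalIntegral.integral_of_le zero_le_one]
  refine (enorm_integral_le_lintegral_enorm _).trans (lintegral_mono fun t => ?_)
  have h3 : ‖fderiv ℝ φ (x + t • z) z‖ ≤ ‖z‖ * ‖gradient φ (x + t • z)‖ := by
    rw [norm_gradient, mul_comm]; exact ContinuousLinearMap.le_opNorm _ _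
  rw [← ofReal_norm, ← ofReal_norm, ← ofReal_norm, ← ENNReal.ofReal_mul (norm_nonneg _)]
  exact ENNReal.ofReal_le_ofReal h3

/-- Translations are Lipschitz from `W^{1,p}` to `L^1` on a set of finite measure. -/
lemma lintegral_translate_sub_le (hp : 1 ≤ p) {φ : Rn n → ℝ} (hφ : IsTestFunction φ) (z : Rn n)
    (B : Set (Rn n)) :
    ∫⁻ x in B, ‖φ (x + z) - φ x‖ₑ ≤
      ‖z‖ₑ * (eLpNorm (gradient φ) (ENNReal.ofReal p) volume * volume B ^ (1 - 1 / p)) := by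
  have hm : Measurable (Function.uncurry fun (x : Rn n) (t : ℝ) =>
      ‖z‖ₑ * ‖gradient φ (x + t • z)‖ₑ) := by
    have : Continuous (fun xt : Rn n × ℝ => gradient φ (xt.1 + xt.2 • z)) :=
      hφ.gradient_continuous.comp (by fun_prop)
    exact (this.enorm.measurable).const_mul _
  calc ∫⁻ x in B, ‖φ (x + z) - φ x‖ₑ
      ≤ ∫⁻ x in B, ∫⁻ t in Set.Ioc (0 : ℝ) 1, ‖z‖ₑ * ‖gradient φ (x + t • z)‖ₑ :=
        lintegral_mono fun x => enorm_sub_le_lintegral_gradient hφ x z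
    _ = ∫⁻ t in Set.Ioc (0 : ℝ) 1, ∫⁻ x in B, ‖z‖ₑ * ‖gradient φ (x + t • z)‖ₑ :=
        lintegral_lintegral_swap hm.aemeasurable
    _ ≤ ∫⁻ _ in Set.Ioc (0 : ℝ) 1,
          ‖z‖ₑ * (eLpNorm (gradient φ) (ENNReal.ofReal p) volume * volume B ^ (1 - 1 / p)) := by
        refine lintegral_mono fun t => ?_
        have hc : Continuous fun x => gradient φ (x + t • z) :=
          hφ.gradient_continuous.comp (by fun_prop)
        rw [lintegral_const_mul _ hc.enorm.measurable]
        gcongr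
        have h := eLpNorm_le_eLpNorm_mul_rpow_measure_univ (μ := volume.restrict B)
          (one_le_ofReal hp) (f := fun x => gradient φ (x + t • z)) hc.aestronglyMeasurable
        rw [eLpNorm_one_eq_lintegral_enorm, Measure.restrict_apply_univ,
          ENNReal.toReal_ofReal (by linarith), ENNReal.toReal_one, one_div_one] at h
        refine h.trans ?_
        rw [← eLpNorm_gradient_comp_add (t • z) hφ]
        gcongr
        exact Measure.restrict_le_self
    _ = _ := by simp

/-- The integral of `φ` over the ball of radius `ε` around `x`. -/
noncomputable def ballIntegral (ε : ℝ) (φ : Rn n → ℝ) (x : Rn n) : ℝ :=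
  ∫ z in Metric.ball (0 : Rn n) ε, φ (x + z)

lemma integrableOn_ball_translate {φ : Rn n → ℝ} (hφ : IsTestFunction φ) (x : Rn n) (ε : ℝ) :
    IntegrableOn (fun z => φ (x + z)) (Metric.ball (0 : Rn n) ε) volume := by
  have hc : Continuous fun z => φ (x + z) := hφ.continuous.comp (by fun_prop)
  exact (hc.continuousOn.integrableOn_compact (isCompact_closedBall 0 ε)).mono_set
    Metric.ball_subset_closedBall

lemma enorm_ballIntegral_le (hs : 1 ≤ s) {φ : Rn n → ℝ} (hφ : IsTestFunction φ) (ε : ℝ)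
    (x : Rn n) :
    ‖ballIntegral ε φ x‖ₑ ≤ eLpNorm φ (ENNReal.ofReal s) volume *
      volume (Metric.ball (0 : Rn n) ε) ^ (1 - 1 / s) := by
  refine (enorm_integral_le_lintegral_enorm _).trans ?_
  have hc : Continuous fun z => φ (x + z) := hφ.continuous.comp (by fun_prop)
  have h := eLpNorm_le_eLpNorm_mul_rpow_measure_univ
    (μ := volume.restrict (Metric.ball (0 : Rn n) ε))
    (one_le_ofReal hs) (f := fun z => φ (x + z)) hc.aestronglyMeasurable
  rw [eLpNorm_one_eq_lintegral_enorm, Measure.restrict_apply_univ,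
    ENNReal.toReal_ofReal (by linarith), ENNReal.toReal_one, one_div_one] at h
  refine h.trans ?_
  have h2 : eLpNorm (fun z => φ (x + z)) (ENNReal.ofReal s) volume
      = eLpNorm φ (ENNReal.ofReal s) volume := by
    have h3 := eLpNorm_comp_measurePreserving (g := φ) (f := fun z => x + z)
      (p := ENNReal.ofReal s) hφ.continuous.aestronglyMeasurable
      (measurePreserving_add_left volume x)
    exact h3
  rw [← h2]
  gcongr
  exact Measure.restrict_le_self

lemma enorm_ballIntegral_sub_le (hp : 1 ≤ p) {φ : Rn n → ℝ} (hφ : IsTestFunction φ) (ε : ℝ)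
    (x y : Rn n) :
    ‖ballIntegral ε φ x - ballIntegral ε φ y‖ₑ ≤ ‖x - y‖ₑ *
      (eLpNorm (gradient φ) (ENNReal.ofReal p) volume *
        volume (Metric.ball (0 : Rn n) ε) ^ (1 - 1 / p)) := by
  unfold ballIntegral
  rw [← integral_sub (integrableOn_ball_translate hφ x ε) (integrableOn_ball_translate hφ y ε)]
  refine (enorm_integral_le_lintegral_enorm _).trans ?_
  have hφ' : IsTestFunction (fun z => φ (z + y)) := by
    simpa using hφ.comp_affine one_ne_zero (-y)
  have hg : gradient (fun z => φ (z + y)) = fun z => gradient φ (z + y) := by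
    ext1 z
    simpa using gradient_comp_affine hφ.differentiable 1 (-y) z
  have h := lintegral_translate_sub_le hp hφ' (x - y) (Metric.ball (0 : Rn n) ε)
  rw [hg, eLpNorm_gradient_comp_add y hφ] at h
  refine le_trans (le_of_eq ?_) h
  congr 1; ext z; congr 2
  · congr 1; abel
  · congr 1; abel

lemma continuous_ballIntegral {φ : Rn n → ℝ} (hφ : IsTestFunction φ) (ε : ℝ) :
    Continuous (ballIntegral ε φ) := by
  have hfin : eLpNorm (gradient φ) (ENNReal.ofReal 1) volume *
        volume (Metric.ball (0 : Rn n) ε) ^ (1 - 1 / (1 : ℝ)) ≠ ⊤ := by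
    simpa using (hφ.gradient_memLp 1).2.ne
  refine LipschitzWith.continuous (K := (eLpNorm (gradient φ) (ENNReal.ofReal 1) volume *
        volume (Metric.ball (0 : Rn n) ε) ^ (1 - 1 / (1 : ℝ))).toNNReal) fun x y => ?_
  rw [ENNReal.coe_toNNReal hfin, edist_eq_enorm_sub, edist_eq_enorm_sub, mul_comm]
  exact enorm_ballIntegral_sub_le le_rfl hφ ε x y

/-- Ball averages approximate `φ` in `L^1_loc`, at a rate controlled by `‖∇φ‖_p`. -/
lemma lintegral_ballIntegral_sub_le (hp : 1 ≤ p) {φ : Rn n → ℝ} (hφ : IsTestFunction φ)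
    (ε : ℝ) (B : Set (Rn n)) :
    ∫⁻ x in B, ‖ballIntegral ε φ x - volume.real (Metric.ball (0 : Rn n) ε) * φ x‖ₑ ≤
      volume (Metric.ball (0 : Rn n) ε) * (ENNReal.ofReal ε *
        (eLpNorm (gradient φ) (ENNReal.ofReal p) volume * volume B ^ (1 - 1 / p))) := by
  have h1 : ∀ x, ‖ballIntegral ε φ x - volume.real (Metric.ball (0 : Rn n) ε) * φ x‖ₑ ≤
      ∫⁻ z in Metric.ball (0 : Rn n) ε, ‖φ (x + z) - φ x‖ₑ := by
    intro x
    have h2 : volume.real (Metric.ball (0 : Rn n) ε) * φ x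
        = ∫ _ in Metric.ball (0 : Rn n) ε, φ x := by
      rw [setIntegral_const, smul_eq_mul]
    have hi : IntegrableOn (fun _ => φ x) (Metric.ball (0 : Rn n) ε) volume :=
      integrableOn_const measure_ball_lt_top.ne
    rw [h2, ballIntegral, ← integral_sub (integrableOn_ball_translate hφ x ε) hi]
    exact enorm_integral_le_lintegral_enorm _
  have hm : Measurable (Function.uncurry fun (x z : Rn n) => ‖φ (x + z) - φ x‖ₑ) := by
    have : Continuous (fun xz : Rn n × Rn n => φ (xz.1 + xz.2) - φ xz.1) :=
      (hφ.continuous.comp (by fun_prop)).sub (hφ.continuous.comp (by fun_prop))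
    exact this.enorm.measurable
  calc _ ≤ ∫⁻ x in B, ∫⁻ z in Metric.ball (0 : Rn n) ε, ‖φ (x + z) - φ x‖ₑ := lintegral_mono h1
    _ = ∫⁻ z in Metric.ball (0 : Rn n) ε, ∫⁻ x in B, ‖φ (x + z) - φ x‖ₑ :=
        lintegral_lintegral_swap hm.aemeasurable
    _ ≤ ∫⁻ _ in Metric.ball (0 : Rn n) ε, ENNReal.ofReal ε *
        (eLpNorm (gradient φ) (ENNReal.ofReal p) volume * volume B ^ (1 - 1 / p)) := by
        refine setLIntegral_mono measurable_const fun z hz => ?_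
        refine (lintegral_translate_sub_le hp hφ z B).trans ?_
        gcongr
        rw [← ofReal_norm]
        exact ENNReal.ofReal_le_ofReal (mem_ball_zero_iff.1 hz).le
    _ = _ := by rw [setLIntegral_const, mul_comm]

/-- A bounded sequence of equi-Lipschitz families indexed by `m` converges pointwise along one
common subsequence. -/
lemma exists_subseq_tendsto_of_lipschitz {X : Type*} [PseudoMetricSpace X]
    [TopologicalSpace.SeparableSpace X] [Nonempty X] (f : ℕ → ℕ → X → ℝ) (b L : ℕ → ℝ)
    (hb : ∀ h m x, |f h m x| ≤ b m) (hL : ∀ h m x y, |f h m x - f h m y| ≤ dist x y * L m) :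
    ∃ k : ℕ → ℕ, StrictMono k ∧
      ∀ m x, ∃ a, Tendsto (fun j => f (k j) m x) atTop (𝓝 a) := by
  set d := TopologicalSpace.denseSeq X
  have hK : IsCompact (Set.pi Set.univ fun mi : ℕ × ℕ => Set.Icc (-b mi.1) (b mi.1)) :=
    isCompact_univ_pi fun _ => isCompact_Icc
  obtain ⟨a, -, k, hk, hka⟩ := hK.tendsto_subseq (x := fun h (mi : ℕ × ℕ) => f h mi.1 (d mi.2))
    (fun h mi _ => abs_le.1 (hb h mi.1 _))
  refine ⟨k, hk, fun m x => ?_⟩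
  have hL0 : 0 ≤ |L m| := abs_nonneg _
  refine cauchySeq_tendsto_of_complete (Metric.cauchySeq_iff'.2 fun ε hε => ?_)
  obtain ⟨i, hy⟩ := (TopologicalSpace.denseRange_denseSeq X).exists_dist_lt x
    (show 0 < ε / (3 * (|L m| + 1)) by positivity)
  have hxy : ∀ h, |f h m x - f h m (d i)| ≤ ε / 3 := fun h =>
    calc |f h m x - f h m (d i)| ≤ dist x (d i) * L m := hL h m x _
      _ ≤ dist x (d i) * (|L m| + 1) := by
        gcongr; linarith [le_abs_self (L m)]
      _ ≤ ε / (3 * (|L m| + 1)) * (|L m| + 1) := by gcongr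
      _ = ε / 3 := by field_simp
  have hc : CauchySeq fun j => f (k j) m (d i) := (tendsto_pi_nhds.1 hka (m, i)).cauchySeq
  obtain ⟨N, hN⟩ := Metric.cauchySeq_iff'.1 hc (ε / 3) (by positivity)
  refine ⟨N, fun j hj => ?_⟩
  have h1 := hN j hj
  rw [Real.dist_eq] at h1 ⊢
  have h2 := abs_le.1 (hxy (k j))
  have h3 := abs_le.1 (hxy (k N))
  have h4 := abs_lt.1 h1
  exact abs_lt.2 ⟨by linarith, by linarith⟩

/-- Rellich's theorem for test functions: a sequence bounded in `L^s` with gradients bounded in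
`L^p` has a subsequence that is Cauchy in `L^1` of every ball. For each radius `e m` the ball
integrals are bounded and equi-Lipschitz, so they converge pointwise along a subsequence that does
not depend on `m`, and divided by the volume of the ball they approximate the functions uniformly
in the sequence as `m → ∞`. -/
lemma exists_subseq_cauchy_L1_loc (hp : 1 ≤ p) (hs : 1 ≤ s) {φ : ℕ → Rn n → ℝ}
    (hφ : ∀ h, IsTestFunction (φ h)) {K : ENNReal} (hK : K ≠ ⊤)
    (hg : ∀ h, eLpNorm (gradient (φ h)) (ENNReal.ofReal p) volume ≤ K)
    (hu : ∀ h, eLpNorm (φ h) (ENNReal.ofReal s) volume ≤ K) :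
    ∃ k : ℕ → ℕ, StrictMono k ∧ ∀ R : ℝ, Tendsto (fun jl : ℕ × ℕ =>
      eLpNorm (fun x => φ (k jl.1) x - φ (k jl.2) x) 1
        (volume.restrict (Metric.closedBall 0 R))) atTop (𝓝 0) := by
  set e : ℕ → ℝ := fun m => 1 / ((m : ℝ) + 1) with he
  have he0 : ∀ m, 0 < e m := fun m => by positivity
  set V : ℕ → ENNReal := fun m => volume (Metric.ball (0 : Rn n) (e m)) with hV
  have hVtop : ∀ m, V m ≠ ⊤ := fun m => measure_ball_lt_top.ne
  have hV0 : ∀ m, V m ≠ 0 := fun m => (Metric.measure_ball_pos volume _ (he0 m)).ne'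
  have hexp : ∀ {r : ℝ}, 1 ≤ r → 0 ≤ 1 - 1 / r := fun {r} hr => by
    rw [sub_nonneg, div_le_one (by linarith)]; exact hr
  have hbtop : ∀ m, K * V m ^ (1 - 1 / s) ≠ ⊤ := fun m =>
    ENNReal.mul_ne_top hK (ENNReal.rpow_ne_top_of_nonneg (hexp hs) (hVtop m))
  have hLtop : ∀ m, K * V m ^ (1 - 1 / p) ≠ ⊤ := fun m =>
    ENNReal.mul_ne_top hK (ENNReal.rpow_ne_top_of_nonneg (hexp hp) (hVtop m))
  have hbound : ∀ h m x, ‖ballIntegral (e m) (φ h) x‖ₑ ≤ K * V m ^ (1 - 1 / s) := fun h m x =>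
    (enorm_ballIntegral_le hs (hφ h) (e m) x).trans (mul_le_mul_left (hu h) _)
  have hbR : ∀ h m x, |ballIntegral (e m) (φ h) x| ≤ (K * V m ^ (1 - 1 / s)).toReal := by
    intro h m x
    have := ENNReal.toReal_mono (hbtop m) (hbound h m x)
    simpa using this
  have hLR : ∀ h m x y, |ballIntegral (e m) (φ h) x - ballIntegral (e m) (φ h) y| ≤
      dist x y * (K * V m ^ (1 - 1 / p)).toReal := by
    intro h m x y
    have h1 : ‖ballIntegral (e m) (φ h) x - ballIntegral (e m) (φ h) y‖ₑ ≤
        ‖x - y‖ₑ * (K * V m ^ (1 - 1 / p)) :=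
      (enorm_ballIntegral_sub_le hp (hφ h) (e m) x y).trans
        (mul_le_mul_right (mul_le_mul_left (hg h) _) _)
    have := ENNReal.toReal_mono (ENNReal.mul_ne_top enorm_ne_top (hLtop m)) h1
    rw [ENNReal.toReal_mul, toReal_enorm, toReal_enorm, Real.norm_eq_abs, ← dist_eq_norm] at this
    exact this
  obtain ⟨k, hk, hlim⟩ := exists_subseq_tendsto_of_lipschitz
    (fun h m x => ballIntegral (e m) (φ h) x) _ _ hbR hLR
  choose A hA using hlim
  refine ⟨k, hk, fun R => ?_⟩
  set B := Metric.closedBall (0 : Rn n) R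
  have hBtop : volume B ≠ ⊤ := measure_closedBall_lt_top.ne
  set J : ℕ → ℕ → ENNReal := fun m j => ∫⁻ x in B, ‖ballIntegral (e m) (φ (k j)) x - A m x‖ₑ
    with hJ
  have hmeasA : ∀ m, Measurable (A m) := fun m =>
    measurable_of_tendsto_metrizable
      (fun j => (continuous_ballIntegral (hφ (k j)) (e m)).measurable)
      (tendsto_pi_nhds.2 (hA m))
  have hJ0 : ∀ m, Tendsto (J m) atTop (𝓝 0) := by
    intro m
    have h1 := tendsto_lintegral_of_dominated_convergence (μ := volume.restrict B)
      (F := fun j x => ‖ballIntegral (e m) (φ (k j)) x - A m x‖ₑ) (f := fun _ => 0)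
      (bound := fun _ => K * V m ^ (1 - 1 / s) + K * V m ^ (1 - 1 / s))
      (fun j => ((continuous_ballIntegral (hφ (k j)) (e m)).measurable.sub (hmeasA m)).enorm)
      (fun j => Eventually.of_forall fun x => ?_) ?_ (Eventually.of_forall fun x => ?_)
    · simpa using h1
    · refine enorm_sub_le.trans (add_le_add (hbound _ _ _) ?_)
      exact le_of_tendsto (hA m x).enorm (Eventually.of_forall fun j => hbound _ _ _)
    · rw [lintegral_const, Measure.restrict_apply_univ]
      exact ENNReal.mul_ne_top (ENNReal.add_ne_top.2 ⟨hbtop m, hbtop m⟩) hBtop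
    · have h2 : Tendsto (fun j => ballIntegral (e m) (φ (k j)) x - A m x) atTop (𝓝 0) := by
        simpa using (hA m x).sub_const (A m x)
      simpa using h2.enorm
  set C : ENNReal := K * volume B ^ (1 - 1 / p) with hC
  have hCtop : C ≠ ⊤ := ENNReal.mul_ne_top hK (ENNReal.rpow_ne_top_of_nonneg (hexp hp) hBtop)
  have hI : ∀ (m : ℕ) (jl : ℕ × ℕ), eLpNorm (fun x => φ (k jl.1) x - φ (k jl.2) x) 1
      (volume.restrict B) ≤ 2 * (ENNReal.ofReal (e m) * C) + (V m)⁻¹ * (J m jl.1 + J m jl.2) := by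
    rintro m ⟨j, l⟩
    have hE : ∀ j, ∫⁻ x in B, ‖ballIntegral (e m) (φ (k j)) x - (V m).toReal * φ (k j) x‖ₑ ≤
        V m * (ENNReal.ofReal (e m) * C) := fun j =>
      (lintegral_ballIntegral_sub_le hp (hφ (k j)) (e m) B).trans
        (mul_le_mul_right (mul_le_mul_right (mul_le_mul_left (hg _) _) _) _)
    have hmE : ∀ j, Measurable fun x =>
        ‖ballIntegral (e m) (φ (k j)) x - (V m).toReal * φ (k j) x‖ₑ := fun j =>
      ((continuous_ballIntegral (hφ (k j)) (e m)).sub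
        (continuous_const.mul (hφ (k j)).continuous)).enorm.measurable
    have hmJ : ∀ j, Measurable fun x => ‖ballIntegral (e m) (φ (k j)) x - A m x‖ₑ := fun j =>
      ((continuous_ballIntegral (hφ (k j)) (e m)).measurable.sub (hmeasA m)).enorm
    have hpt : ∀ x, V m * ‖φ (k j) x - φ (k l) x‖ₑ ≤
        (‖ballIntegral (e m) (φ (k j)) x - (V m).toReal * φ (k j) x‖ₑ +
          ‖ballIntegral (e m) (φ (k l)) x - (V m).toReal * φ (k l) x‖ₑ) +
        (‖ballIntegral (e m) (φ (k j)) x - A m x‖ₑ +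
          ‖ballIntegral (e m) (φ (k l)) x - A m x‖ₑ) := by
      intro x
      have h1 : V m * ‖φ (k j) x - φ (k l) x‖ₑ
          = ‖(V m).toReal * φ (k j) x - (V m).toReal * φ (k l) x‖ₑ := by
        rw [← mul_sub, enorm_mul, Real.enorm_eq_ofReal ENNReal.toReal_nonneg,
          ENNReal.ofReal_toReal (hVtop m)]
      rw [h1]
      set a := ballIntegral (e m) (φ (k j)) x
      set b := ballIntegral (e m) (φ (k l)) x
      set c := (V m).toReal * φ (k j) x
      set d := (V m).toReal * φ (k l) x
      have h2 : c - d = (b - d) - (a - c) + ((a - A m x) - (b - A m x)) := by ring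
      rw [h2]
      refine (enorm_add_le _ _).trans (add_le_add ?_ enorm_sub_le)
      rw [add_comm]
      exact enorm_sub_le
    have h3 : V m * eLpNorm (fun x => φ (k j) x - φ (k l) x) 1 (volume.restrict B) ≤
        V m * (2 * (ENNReal.ofReal (e m) * C)) + (J m j + J m l) := by
      rw [eLpNorm_one_eq_lintegral_enorm, ← lintegral_const_mul' _ _ (hVtop m)]
      refine (lintegral_mono hpt).trans ?_
      rw [lintegral_add_left (by simpa [Pi.add_def] using (hmE j).add (hmE l)),
        lintegral_add_left (hmE j), lintegral_add_left (hmJ j)]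
      refine add_le_add ((add_le_add (hE j) (hE l)).trans (le_of_eq ?_)) le_rfl
      ring
    calc eLpNorm (fun x => φ (k j) x - φ (k l) x) 1 (volume.restrict B)
        = (V m)⁻¹ * (V m * eLpNorm (fun x => φ (k j) x - φ (k l) x) 1 (volume.restrict B)) := by
          rw [← mul_assoc, ENNReal.inv_mul_cancel (hV0 m) (hVtop m), one_mul]
      _ ≤ (V m)⁻¹ * (V m * (2 * (ENNReal.ofReal (e m) * C)) + (J m j + J m l)) := by gcongr
      _ = _ := by
          rw [mul_add, ← mul_assoc, ENNReal.inv_mul_cancel (hV0 m) (hVtop m), one_mul]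
  rw [ENNReal.tendsto_nhds_zero]
  intro δ hδ
  have h1 : Tendsto (fun m => 2 * (ENNReal.ofReal (e m) * C)) atTop (𝓝 0) := by
    have h2 : Tendsto (fun m => ENNReal.ofReal (e m)) atTop (𝓝 0) := by
      have := ENNReal.tendsto_ofReal tendsto_one_div_add_atTop_nhds_zero_nat
      rwa [ENNReal.ofReal_zero] at this
    have h3 := ENNReal.Tendsto.const_mul (a := 2)
      (ENNReal.Tendsto.mul_const (b := C) h2 (Or.inr hCtop)) (Or.inr (by simp))
    simpa using h3
  obtain ⟨m, hm⟩ := (h1.eventually_lt_const hδ).exists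
  have h4 : Tendsto (fun jl : ℕ × ℕ =>
      2 * (ENNReal.ofReal (e m) * C) + (V m)⁻¹ * (J m jl.1 + J m jl.2)) atTop
      (𝓝 (2 * (ENNReal.ofReal (e m) * C) + (V m)⁻¹ * (0 + 0))) := by
    refine tendsto_const_nhds.add (ENNReal.Tendsto.const_mul ?_
      (Or.inr (ENNReal.inv_ne_top.2 (hV0 m))))
    rw [← prod_atTop_atTop_eq]
    exact ((hJ0 m).comp tendsto_fst).add ((hJ0 m).comp tendsto_snd)
  rw [add_zero, mul_zero, add_zero] at h4
  filter_upwards [h4.eventually_lt_const hm] with jl hjl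
  exact (hI m jl).trans hjl.le

/-- By interpolation with `L^{p⋆}`, the subsequence of Rellich's theorem is Cauchy in `L^q` of
every ball for `1 < q < p⋆`. -/
lemma tendsto_eLpNorm_loc_of_L1_loc {P : ℝ} (hq1 : 1 < q) (hqP : q < P) {φ : ℕ → Rn n → ℝ}
    (hφ : ∀ h, IsTestFunction (φ h)) {K : ENNReal} (hK : K ≠ ⊤)
    (hP : ∀ h, eLpNorm (φ h) (ENNReal.ofReal P) volume ≤ K) {R : ℝ}
    (h1 : Tendsto (fun jl : ℕ × ℕ => eLpNorm (fun x => φ jl.1 x - φ jl.2 x) 1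
        (volume.restrict (Metric.closedBall 0 R))) atTop (𝓝 0)) :
    Tendsto (fun jl : ℕ × ℕ => eLpNorm (fun x => φ jl.1 x - φ jl.2 x) (ENNReal.ofReal q)
        (volume.restrict (Metric.closedBall 0 R))) atTop (𝓝 0) := by
  obtain ⟨t, ht0, ht1, ht⟩ := exists_interpolation_exponent one_pos hq1 hqP
  have hP1 : 1 ≤ P := by linarith
  have hm : ∀ h, AEStronglyMeasurable (φ h) volume := fun h =>
    (hφ h).continuous.aestronglyMeasurable
  have hb : ∀ jl : ℕ × ℕ, eLpNorm (fun x => φ jl.1 x - φ jl.2 x) (ENNReal.ofReal q)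
        (volume.restrict (Metric.closedBall 0 R)) ≤
      eLpNorm (fun x => φ jl.1 x - φ jl.2 x) 1
        (volume.restrict (Metric.closedBall 0 R)) ^ (1 - t) * (K + K) ^ t := by
    intro jl
    have h2 := eLpNorm_le_interpolation (μ := volume.restrict (Metric.closedBall 0 R))
      (((hm jl.1).sub (hm jl.2)).restrict) one_pos (by linarith) (by linarith) ht0.le ht1.le ht
    rw [ENNReal.ofReal_one] at h2
    refine h2.trans ?_
    gcongr
    · exact le_rfl
    · refine (eLpNorm_mono_measure _ Measure.restrict_le_self).trans ?_
      exact (eLpNorm_sub_le (hm jl.1) (hm jl.2) (one_le_ofReal hP1)).trans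
        (add_le_add (hP _) (hP _))
  have hlim : Tendsto (fun jl : ℕ × ℕ => eLpNorm (fun x => φ jl.1 x - φ jl.2 x) 1
        (volume.restrict (Metric.closedBall 0 R)) ^ (1 - t) * (K + K) ^ t) atTop (𝓝 0) := by
    have h3 := (ENNReal.continuous_rpow_const (y := 1 - t)).tendsto 0 |>.comp h1
    rw [ENNReal.zero_rpow_of_pos (by linarith)] at h3
    have h4 := ENNReal.Tendsto.mul_const (b := (K + K) ^ t) h3
      (Or.inr (ENNReal.rpow_ne_top_of_nonneg ht0.le (ENNReal.add_ne_top.2 ⟨hK, hK⟩)))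
    simpa using h4
  exact tendsto_of_tendsto_of_tendsto_of_le_of_le tendsto_const_nhds hlim (fun _ => zero_le) hb

end LocalCompactness

/-! ### Nonvanishing -/

section Nonvanishing

variable {n : ℕ} {p s q : ℝ}

/-- Averaging the local integrals over all centres. -/
lemma lintegral_setLIntegral_closedBall (ρ : ℝ) {f : Rn n → ENNReal} (hf : Measurable f) :
    ∫⁻ y, ∫⁻ x in Metric.closedBall y ρ, f x
      = volume (Metric.closedBall (0 : Rn n) ρ) * ∫⁻ x, f x := by
  have hS : MeasurableSet {yx : Rn n × Rn n | dist yx.2 yx.1 ≤ ρ} :=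
    (isClosed_le (by fun_prop) continuous_const).measurableSet
  have hm : Measurable (Function.uncurry fun (y x : Rn n) =>
      (Metric.closedBall y ρ).indicator f x) := by
    have := (hf.comp measurable_snd).indicator hS
    convert this using 1
    ext ⟨y, x⟩
    simp [Function.uncurry, Set.indicator]
  calc ∫⁻ y, ∫⁻ x in Metric.closedBall y ρ, f x
      = ∫⁻ y, ∫⁻ x, (Metric.closedBall y ρ).indicator f x := by
        congr 1; ext1 y
        rw [lintegral_indicator Metric.isClosed_closedBall.measurableSet]
    _ = ∫⁻ x, ∫⁻ y, (Metric.closedBall y ρ).indicator f x :=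
        lintegral_lintegral_swap hm.aemeasurable
    _ = ∫⁻ x, volume (Metric.closedBall (0 : Rn n) ρ) * f x := by
        congr 1; ext1 x
        have h1 : (fun y => (Metric.closedBall y ρ).indicator f x)
            = (Metric.closedBall x ρ).indicator fun _ => f x := by
          ext1 y
          simp only [Set.indicator, Metric.mem_closedBall, dist_comm]
        rw [h1, lintegral_indicator Metric.isClosed_closedBall.measurableSet, setLIntegral_const,
          mul_comm, Measure.addHaar_closedBall_center]
    _ = _ := lintegral_const_mul _ hf

lemma eLpNorm_rpow_eq_lintegral {α F : Type*} [MeasurableSpace α] {μ : Measure α}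
    [NormedAddCommGroup F] {r : ℝ} (hr : 0 < r) (f : α → F) :
    eLpNorm f (ENNReal.ofReal r) μ ^ r = ∫⁻ x, ‖f x‖ₑ ^ r ∂μ := by
  rw [eLpNorm_eq_lintegral_rpow_enorm_toReal (by simpa using hr) (by simp),
    ENNReal.toReal_ofReal hr.le, ← ENNReal.rpow_mul, one_div, inv_mul_cancel₀ hr.ne',
    ENNReal.rpow_one]

lemma norm_cutoff_mul_le {R : ℝ} (y : Rn n) (φ : Rn n → ℝ) (x : Rn n) :
    ‖cutoff R y x * φ x‖ ≤ ‖φ x‖ := by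
  rw [norm_mul, Real.norm_of_nonneg (cutoff_nonneg x)]
  exact mul_le_of_le_one_left (norm_nonneg _) (cutoff_le_one x)

lemma eLpNorm_cutoff_smul_le {F : Type*} [NormedAddCommGroup F] [NormedSpace ℝ F] {R : ℝ}
    (hR : 0 < R) (r : ENNReal) (y : Rn n) (f : Rn n → F) :
    eLpNorm (fun x => cutoff R y x • f x) r volume
      ≤ eLpNorm f r (volume.restrict (Metric.closedBall y (2 * R))) := by
  rw [← eLpNorm_indicator_eq_eLpNorm_restrict Metric.isClosed_closedBall.measurableSet]
  refine eLpNorm_mono fun x => ?_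
  by_cases hx : x ∈ Metric.closedBall y (2 * R)
  · rw [Set.indicator_of_mem hx, norm_smul, Real.norm_of_nonneg (cutoff_nonneg x)]
    exact mul_le_of_le_one_left (norm_nonneg _) (cutoff_le_one x)
  · rw [cutoff_eq_zero hR hx, zero_smul, norm_zero]
    exact norm_nonneg _

/-- Local Sobolev estimate: the `L^r` norm of a localized function is controlled by local `L^p`
and `L^t` quantities. The right side is additive in the domain, which allows it to be summed over
all balls. -/
lemma exists_local_sobolev {P C : ℝ} (hp : 1 ≤ p) {t r : ℝ} (hpt : p < t) (htr : t < r)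
    (hrP : r < P)
    (hC : ∀ φ : Rn n → ℝ, IsTestFunction φ → eLpNorm φ (ENNReal.ofReal P) volume
        ≤ ENNReal.ofReal C * eLpNorm (gradient φ) (ENNReal.ofReal p) volume)
    {K : ENNReal} (hK : K ≠ ⊤) :
    ∃ A : ENNReal, A ≠ ⊤ ∧ ∀ φ : Rn n → ℝ, IsTestFunction φ →
      eLpNorm (gradient φ) (ENNReal.ofReal p) volume ≤ K → ∀ y : Rn n,
      eLpNorm (fun x => cutoff 1 y x * φ x) (ENNReal.ofReal r) volume ^ t ≤
        A * (∫⁻ x in Metric.closedBall y 2, (‖gradient φ x‖ₑ ^ p + ‖φ x‖ₑ ^ t)) := by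
  obtain ⟨C', hC'0, hC'⟩ := exists_cutoff_error n hp hpt.le
  have ht0 : 0 < t := by linarith
  obtain ⟨a, ha0, ha1, ha⟩ := exists_interpolation_exponent ht0 htr hrP
  set c₁ : ENNReal := ENNReal.ofReal C with hc₁
  set c₂ : ENNReal := 1 + ENNReal.ofReal C' with hc₂
  refine ⟨(c₁ ^ a * c₂) ^ t * (2 ^ (t - 1) * (K ^ (t - p) + 1)), ?_, fun φ hφ hφK y => ?_⟩
  · have h1 : c₁ ≠ ⊤ := ENNReal.ofReal_ne_top
    have h2 : c₂ ≠ ⊤ := by simp [hc₂]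
    refine ENNReal.mul_ne_top (ENNReal.rpow_ne_top_of_nonneg ht0.le
      (ENNReal.mul_ne_top (ENNReal.rpow_ne_top_of_nonneg ha0.le h1) h2))
      (ENNReal.mul_ne_top (ENNReal.rpow_ne_top_of_nonneg (by linarith) (by simp))
        (ENNReal.add_ne_top.2 ⟨ENNReal.rpow_ne_top_of_nonneg (by linarith) hK, by simp⟩))
  have hχ := cutoff_isTestFunction one_pos y
  set B := Metric.closedBall y 2 with hB
  set D := eLpNorm (gradient φ) (ENNReal.ofReal p) (volume.restrict B) with hD
  set Y := eLpNorm φ (ENNReal.ofReal t) (volume.restrict B) with hY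
  have h1 : eLpNorm (fun x => cutoff 1 y x * φ x) (ENNReal.ofReal t) volume ≤ Y := by
    have := eLpNorm_cutoff_smul_le one_pos (ENNReal.ofReal t) y φ
    rw [mul_one] at this
    exact this
  have h2 : eLpNorm (gradient fun x => cutoff 1 y x * φ x) (ENNReal.ofReal p) volume ≤
      D + ENNReal.ofReal C' * Y := by
    have e1 : (gradient fun x => cutoff 1 y x * φ x) =
        (fun x => cutoff 1 y x • gradient φ x) + fun x => φ x • gradient (cutoff 1 y) x := by
      ext1 x; exact gradient_cutoff_mul one_pos hφ x
    rw [e1]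
    refine (eLpNorm_add_le
      (hχ.continuous.smul hφ.gradient_continuous).aestronglyMeasurable
      (hφ.continuous.smul hχ.gradient_continuous).aestronglyMeasurable
      (one_le_ofReal hp)).trans (add_le_add ?_ ?_)
    · have := eLpNorm_cutoff_smul_le one_pos (ENNReal.ofReal p) y (gradient φ)
      rwa [mul_one] at this
    · have := hC' 1 one_pos y φ hφ.continuous.aestronglyMeasurable
      rwa [Real.one_rpow, mul_one, mul_one] at this
  have h3 := eLpNorm_le_interpolation (μ := volume) (f := fun x => cutoff 1 y x * φ x)
    (hχ.mul hφ).continuous.aestronglyMeasurable ht0 (by linarith) (by linarith) ha0.le ha1.le ha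
  have h4 : eLpNorm (fun x => cutoff 1 y x * φ x) (ENNReal.ofReal r) volume ≤
      c₁ ^ a * c₂ * (D + Y) := by
    have hE1 : Y ≤ c₂ * (D + Y) := by
      rw [hc₂, add_mul, one_mul]
      exact le_add_right le_add_self
    have hE2 : D + ENNReal.ofReal C' * Y ≤ c₂ * (D + Y) := by
      rw [hc₂, add_mul, one_mul]
      gcongr
      · exact le_self_add
      · exact le_add_self
    calc _ ≤ (c₂ * (D + Y)) ^ (1 - a) * (c₁ * (c₂ * (D + Y))) ^ a := by
          refine h3.trans ?_
          gcongr
          · exact h1.trans hE1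
          · exact (hC _ (hχ.mul hφ)).trans (by gcongr; exact h2.trans hE2)
      _ = c₁ ^ a * ((c₂ * (D + Y)) ^ (1 - a) * (c₂ * (D + Y)) ^ a) := by
          rw [ENNReal.mul_rpow_of_nonneg _ _ ha0.le]; ring
      _ = c₁ ^ a * c₂ * (D + Y) := by
          rw [← ENNReal.rpow_add_of_nonneg _ _ (by linarith) ha0.le, sub_add_cancel,
            ENNReal.rpow_one]
          ring
  have hDK : D ≤ K := (eLpNorm_mono_measure _ Measure.restrict_le_self).trans hφK
  have h5 : D ^ t ≤ K ^ (t - p) * D ^ p := by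
    calc D ^ t = D ^ (t - p) * D ^ p := by
          rw [← ENNReal.rpow_add_of_nonneg _ _ (by linarith) (by linarith), sub_add_cancel]
      _ ≤ _ := by gcongr
  have h6 : ∫⁻ x in B, (‖gradient φ x‖ₑ ^ p + ‖φ x‖ₑ ^ t) = D ^ p + Y ^ t := by
    rw [hD, hY, eLpNorm_rpow_eq_lintegral (by linarith), eLpNorm_rpow_eq_lintegral ht0,
      lintegral_add_left (hφ.gradient_continuous.enorm.measurable.pow_const p)]
  rw [h6]
  calc _ ≤ (c₁ ^ a * c₂ * (D + Y)) ^ t := by gcongr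
    _ = (c₁ ^ a * c₂) ^ t * (D + Y) ^ t := ENNReal.mul_rpow_of_nonneg _ _ ht0.le
    _ ≤ (c₁ ^ a * c₂) ^ t * (2 ^ (t - 1) * (D ^ t + Y ^ t)) := by
        gcongr
        exact ENNReal.rpow_add_le_mul_rpow_add_rpow D Y (by linarith)
    _ ≤ (c₁ ^ a * c₂) ^ t * (2 ^ (t - 1) * ((K ^ (t - p) + 1) * (D ^ p + Y ^ t))) := by
        gcongr
        calc D ^ t + Y ^ t ≤ K ^ (t - p) * D ^ p + 1 * Y ^ t := by rw [one_mul]; gcongr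
          _ ≤ (K ^ (t - p) + 1) * D ^ p + (K ^ (t - p) + 1) * Y ^ t := by
              gcongr
              · exact le_self_add
              · exact le_add_self
          _ = _ := by ring
    _ = _ := by ring

/-- Nonvanishing: a function bounded in `D^{p,s}` with `L^q` norm bounded from below carries a
definite amount of `L^q` mass in some ball of radius `2`. Otherwise the localized functions would
be uniformly small, and integrating the superlinear local Sobolev estimate over all centres would
make the `L^r` norm small for some `r > q`, hence also the `L^q` norm. -/
lemma exists_nonvanishing_const {P C : ℝ} (hp : 1 ≤ p) (hpP : p < P) (hs : 1 ≤ s) (hsq : s < q)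
    (hqP : q < P)
    (hC : ∀ φ : Rn n → ℝ, IsTestFunction φ → eLpNorm φ (ENNReal.ofReal P) volume
        ≤ ENNReal.ofReal C * eLpNorm (gradient φ) (ENNReal.ofReal p) volume)
    {K c₀ : ENNReal} (hK : K ≠ ⊤) (hc₀ : c₀ ≠ 0) :
    ∃ c : ENNReal, 0 < c ∧ ∀ φ : Rn n → ℝ, IsTestFunction φ →
      eLpNorm (gradient φ) (ENNReal.ofReal p) volume ≤ K →
      eLpNorm φ (ENNReal.ofReal s) volume ≤ K →
      c₀ ≤ eLpNorm φ (ENNReal.ofReal q) volume →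
      ∃ y : Rn n, c ≤ eLpNorm φ (ENNReal.ofReal q) (volume.restrict (Metric.closedBall y 2)) := by
  -- exponents `max p s < t < r < p⋆` with `q < r`
  obtain ⟨t, htm, htP⟩ := exists_between (max_lt hpP (hsq.trans hqP))
  obtain ⟨hpt, hst⟩ := max_lt_iff.1 htm
  obtain ⟨r, hrm, hrP⟩ := exists_between (max_lt htP hqP)
  obtain ⟨htr, hqr⟩ := max_lt_iff.1 hrm
  have ht0 : 0 < t := by linarith
  have hr0 : 0 < r := by linarith
  obtain ⟨A, hA, hloc⟩ := exists_local_sobolev hp hpt htr hrP hC hK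
  obtain ⟨a, ha0, ha1, ha⟩ := exists_interpolation_exponent (by linarith : 0 < s) hst htP
  obtain ⟨b, hb0, hb1, hb⟩ := exists_interpolation_exponent (by linarith : 0 < s) hsq hqr
  obtain ⟨d, hd0, hd1, hd⟩ := exists_interpolation_exponent (by linarith : 0 < q) hqr hrP
  set KP : ENNReal := ENNReal.ofReal C * K with hKP
  have hKPtop : KP ≠ ⊤ := ENNReal.mul_ne_top ENNReal.ofReal_ne_top hK
  set Kt : ENNReal := K ^ (1 - a) * KP ^ a with hKt
  have hKttop : Kt ≠ ⊤ := ENNReal.mul_ne_top (ENNReal.rpow_ne_top_of_nonneg (by linarith) hK)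
    (ENNReal.rpow_ne_top_of_nonneg ha0.le hKPtop)
  set v₁ := volume (Metric.closedBall (0 : Rn n) 1) with hv₁
  set v₂ := volume (Metric.closedBall (0 : Rn n) 2) with hv₂
  have hv₁0 : v₁ ≠ 0 := (Metric.measure_closedBall_pos volume _ one_pos).ne'
  have hv₂top : v₂ ≠ ⊤ := measure_closedBall_lt_top.ne
  -- a lower bound for the `L^r` norm, by interpolating `q` between `s` and `r`
  set c₁ : ENNReal := (c₀ / (K + 1) ^ (1 - b)) ^ (1 / b) with hc₁
  have hK1 : (K + 1) ^ (1 - b) ≠ ⊤ :=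
    ENNReal.rpow_ne_top_of_nonneg (by linarith) (ENNReal.add_ne_top.2 ⟨hK, by simp⟩)
  have hK1' : (K + 1) ^ (1 - b) ≠ 0 := by
    simp only [ne_eq, ENNReal.rpow_eq_zero_iff, not_or, not_and]
    exact ⟨fun h => by simp at h, fun _ => by linarith⟩
  have hc₁0 : c₁ ≠ 0 := by
    simp only [hc₁, ne_eq, ENNReal.rpow_eq_zero_iff, not_or, not_and, not_lt]
    exact ⟨fun h => absurd h (ENNReal.div_ne_zero.2 ⟨hc₀, hK1⟩), fun _ => by positivity⟩
  set S : ENNReal := A * (v₂ * (K ^ p + Kt ^ t)) with hS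
  have hStop : S ≠ ⊤ := ENNReal.mul_ne_top hA (ENNReal.mul_ne_top hv₂top
    (ENNReal.add_ne_top.2 ⟨ENNReal.rpow_ne_top_of_nonneg (by linarith) hK,
      ENNReal.rpow_ne_top_of_nonneg ht0.le hKttop⟩))
  have hlow : 0 < v₁ * c₁ ^ r := by
    refine ENNReal.mul_pos hv₁0 ?_
    simp only [ne_eq, ENNReal.rpow_eq_zero_iff, not_or, not_and, not_lt]
    exact ⟨fun h => absurd h hc₁0, fun _ => hr0.le⟩
  have hlim : Tendsto (fun c : ENNReal => (c ^ (1 - d) * KP ^ d) ^ (r - t) * S) (𝓝 0) (𝓝 0) := by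
    have e1 := (ENNReal.continuous_rpow_const (y := 1 - d)).tendsto 0
    rw [ENNReal.zero_rpow_of_pos (by linarith)] at e1
    have e2 := ENNReal.Tendsto.mul_const (b := KP ^ d) e1
      (Or.inr (ENNReal.rpow_ne_top_of_nonneg hd0.le hKPtop))
    rw [zero_mul] at e2
    have e3 := ((ENNReal.continuous_rpow_const (y := r - t)).tendsto 0).comp e2
    rw [ENNReal.zero_rpow_of_pos (by linarith)] at e3
    have e4 := ENNReal.Tendsto.mul_const (b := S) e3 (Or.inr hStop)
    rwa [zero_mul] at e4
  -- `c` is so small that vanishing below `c` contradicts the lower bound for the `L^r` norm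
  obtain ⟨c, ⟨hc, hc1⟩, hcpos⟩ : ∃ c : ENNReal,
      ((c ^ (1 - d) * KP ^ d) ^ (r - t) * S < v₁ * c₁ ^ r ∧ c < 1) ∧ 0 < c :=
    ((((hlim.eventually_lt_const hlow).and (eventually_lt_nhds zero_lt_one)).filter_mono
      nhdsWithin_le_nhds).and
      (self_mem_nhdsWithin (s := Set.Ioi 0))).exists
  refine ⟨c, hcpos, fun φ hφ hg hu hq => ?_⟩
  by_contra! hvan
  have hφm : AEStronglyMeasurable φ volume := hφ.continuous.aestronglyMeasurable
  have hP : eLpNorm φ (ENNReal.ofReal P) volume ≤ KP := (hC φ hφ).trans (by rw [hKP]; gcongr)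
  have ht : eLpNorm φ (ENNReal.ofReal t) volume ≤ Kt :=
    (eLpNorm_le_interpolation hφm (by linarith) ht0 (by linarith) ha0.le ha1.le ha).trans
      (by rw [hKt]; gcongr)
  have hr : c₁ ≤ eLpNorm φ (ENNReal.ofReal r) volume := by
    have h1 := eLpNorm_le_interpolation hφm (by linarith) (by linarith) hr0 hb0.le hb1.le hb
    have h2 : c₀ ≤ (K + 1) ^ (1 - b) * eLpNorm φ (ENNReal.ofReal r) volume ^ b := by
      refine hq.trans (h1.trans ?_)
      gcongr
      exact hu.trans le_self_add
    have h3 : c₀ / (K + 1) ^ (1 - b) ≤ eLpNorm φ (ENNReal.ofReal r) volume ^ b := by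
      refine ENNReal.div_le_of_le_mul' h2
    rw [hc₁, one_div, ENNReal.rpow_inv_le_iff hb0]
    exact h3
  have hpt : ∀ y : Rn n, ∫⁻ x in Metric.closedBall y 1, ‖φ x‖ₑ ^ r ≤
      (c ^ (1 - d) * KP ^ d) ^ (r - t) *
        (A * ∫⁻ x in Metric.closedBall y 2, (‖gradient φ x‖ₑ ^ p + ‖φ x‖ₑ ^ t)) := by
    intro y
    have hχ := cutoff_isTestFunction one_pos y
    set N := eLpNorm (fun x => cutoff 1 y x * φ x) (ENNReal.ofReal r) volume with hN
    have h1 : ∫⁻ x in Metric.closedBall y 1, ‖φ x‖ₑ ^ r ≤ N ^ r := by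
      rw [hN, eLpNorm_rpow_eq_lintegral hr0]
      refine le_trans (le_of_eq ?_) (setLIntegral_le_lintegral (Metric.closedBall y 1) _)
      refine setLIntegral_congr_fun Metric.isClosed_closedBall.measurableSet fun x hx => ?_
      simp only [cutoff_eq_one one_pos hx, one_mul]
    have h2 : N ≤ c ^ (1 - d) * KP ^ d := by
      refine (eLpNorm_le_interpolation (hχ.mul hφ).continuous.aestronglyMeasurable
        (by linarith) hr0 (by linarith) hd0.le hd1.le hd).trans ?_
      gcongr
      · have := eLpNorm_cutoff_smul_le one_pos (ENNReal.ofReal q) y φ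
        rw [mul_one] at this
        exact this.trans (hvan y).le
      · exact (eLpNorm_mono fun x => norm_cutoff_mul_le y φ x).trans hP
    calc _ ≤ N ^ r := h1
      _ = N ^ (r - t) * N ^ t := by
        rw [← ENNReal.rpow_add_of_nonneg _ _ (by linarith) ht0.le, sub_add_cancel]
      _ ≤ _ := by
        gcongr
        exact hloc φ hφ hg y
  have hfm : Measurable fun x => ‖gradient φ x‖ₑ ^ p + ‖φ x‖ₑ ^ t :=
    (hφ.gradient_continuous.enorm.measurable.pow_const p).add
      (hφ.continuous.enorm.measurable.pow_const t)
  -- integration over all centres `y`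
  have hint := lintegral_mono (μ := volume) hpt
  rw [lintegral_setLIntegral_closedBall 1 (hφ.continuous.enorm.measurable.pow_const r),
    lintegral_const_mul', lintegral_const_mul' _ _ hA, lintegral_setLIntegral_closedBall 2 hfm,
    lintegral_add_left (hφ.gradient_continuous.enorm.measurable.pow_const p),
    ← eLpNorm_rpow_eq_lintegral hr0, ← eLpNorm_rpow_eq_lintegral ht0,
    ← eLpNorm_rpow_eq_lintegral (by linarith : 0 < p)] at hint
  · have hfin : v₁ * c₁ ^ r ≤ (c ^ (1 - d) * KP ^ d) ^ (r - t) * S := by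
      refine le_trans (by gcongr) (hint.trans ?_)
      rw [hS]
      gcongr
    exact absurd hc (not_lt.2 hfin)
  · refine ENNReal.rpow_ne_top_of_nonneg (by linarith) (ENNReal.mul_ne_top ?_
      (ENNReal.rpow_ne_top_of_nonneg hd0.le hKPtop))
    exact ENNReal.rpow_ne_top_of_nonneg (by linarith) (hc1.trans ENNReal.one_lt_top).ne

end Nonvanishing

/-! ### Exclusion of dichotomy -/

lemma lpNorm_rpow_add_compl {α F : Type*} [MeasurableSpace α] {μ : Measure α}
    [NormedAddCommGroup F] {r : ℝ} (hr : 0 < r) {f : α → F} (hf : MemLp f (ENNReal.ofReal r) μ)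
    {B : Set α} (hB : MeasurableSet B) :
    lpNorm f (ENNReal.ofReal r) (μ.restrict B) ^ r + lpNorm f (ENNReal.ofReal r) (μ.restrict Bᶜ) ^ r
      = lpNorm f (ENNReal.ofReal r) μ ^ r := by
  rw [lpNorm_rpow hr hf.1, lpNorm_rpow hr hf.1.restrict, lpNorm_rpow hr hf.1.restrict]
  exact integral_add_compl hB (integrable_norm_rpow_of_memLp hr hf)

lemma lpNorm_restrict_mono {α F : Type*} [MeasurableSpace α] {μ : Measure α}
    [NormedAddCommGroup F] {r : ENNReal} {f : α → F} (hf : MemLp f r μ) {A B : Set α}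
    (h : A ⊆ B) : lpNorm f r (μ.restrict A) ≤ lpNorm f r (μ.restrict B) := by
  rw [← toReal_eLpNorm hf.1.restrict, ← toReal_eLpNorm hf.1.restrict]
  exact ENNReal.toReal_mono (hf.restrict B).2.ne
    (eLpNorm_mono_measure _ (Measure.restrict_mono h le_rfl))

/-- The homogeneous inequality `G a ≤ X^θ Y^{1-θ}`, made additive by the weighted arithmetic and
geometric means. -/
lemma rpow_le_of_gns {p s θ κ G a X Y : ℝ} (hp : 0 < p) (hs : 0 < s) (hθ0 : 0 < θ) (hθ1 : θ < 1)
    (hκ : κ * (θ / p + (1 - θ) / s) = 1) (hκ0 : 0 < κ) (hG : 0 < G) (ha : 0 ≤ a) (hX : 0 ≤ X)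
    (hY : 0 ≤ Y) (h : G * a ≤ X ^ θ * Y ^ (1 - θ)) :
    a ^ κ ≤ κ * θ / p * (X / G) ^ p + κ * (1 - θ) / s * (Y / G) ^ s := by
  have h1 : a ≤ (X / G) ^ θ * (Y / G) ^ (1 - θ) := by
    rw [Real.div_rpow hX hG.le, Real.div_rpow hY hG.le, div_mul_div_comm, ← Real.rpow_add hG,
      add_sub_cancel, Real.rpow_one, le_div_iff₀ hG, mul_comm]
    exact h
  have hx : 0 ≤ X / G := by positivity
  have hy : 0 ≤ Y / G := by positivity
  have h1θ : 0 < 1 - θ := by linarith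
  calc a ^ κ ≤ ((X / G) ^ θ * (Y / G) ^ (1 - θ)) ^ κ := by gcongr
    _ = ((X / G) ^ p) ^ (κ * θ / p) * ((Y / G) ^ s) ^ (κ * (1 - θ) / s) := by
        rw [Real.mul_rpow (by positivity) (by positivity), ← Real.rpow_mul hx, ← Real.rpow_mul hy,
          ← Real.rpow_mul hx, ← Real.rpow_mul hy]
        congr 2 <;> field_simp
    _ ≤ _ := Real.geom_mean_le_arith_mean2_weighted (by positivity) (by positivity)
        (by positivity) (by positivity) (by linear_combination hκ)

/-- Minkowski's inequality in the plane. -/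
lemma add_rpow_add_rpow_le {p x y e η : ℝ} (hp : 1 ≤ p) (hx : 0 ≤ x) (hy : 0 ≤ y) (he : 0 ≤ e)
    (hη : 0 ≤ η) (h : x ^ p + y ^ p ≤ e ^ p) : (x + η) ^ p + (y + η) ^ p ≤ (e + 2 * η) ^ p := by
  have hp0 : 0 < p := by linarith
  have h1 := Real.Lp_add_le_of_nonneg (s := (Finset.univ : Finset (Fin 2))) (f := ![x, y])
    (g := fun _ => η) hp (by intro i _; fin_cases i <;> simpa) (fun _ _ => hη)
  simp only [Fin.sum_univ_two, Matrix.cons_val_zero, Matrix.cons_val_one] at h1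
  have h2 : (x ^ p + y ^ p) ^ (1 / p) ≤ e := by
    calc _ ≤ (e ^ p) ^ (1 / p) := by gcongr
      _ = e := by rw [← Real.rpow_mul he, mul_one_div_cancel hp0.ne', Real.rpow_one]
  have h3 : (η ^ p + η ^ p) ^ (1 / p) ≤ 2 * η := by
    rw [← two_mul, Real.mul_rpow (by norm_num) (by positivity), ← Real.rpow_mul hη,
      mul_one_div_cancel hp0.ne', Real.rpow_one]
    gcongr
    calc (2 : ℝ) ^ (1 / p) ≤ 2 ^ (1 : ℝ) := by
          gcongr
          · norm_num
          · rw [div_le_one hp0]; exact hp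
      _ = 2 := by norm_num
  have h4 : ((x + η) ^ p + (y + η) ^ p) ^ (1 / p) ≤ e + 2 * η := by linarith
  calc (x + η) ^ p + (y + η) ^ p = (((x + η) ^ p + (y + η) ^ p) ^ (1 / p)) ^ p := by
        rw [← Real.rpow_mul (by positivity), one_div_mul_cancel hp0.ne', Real.rpow_one]
    _ ≤ _ := by gcongr

/-- The contribution of two complementary weights to the `r`-th power of a norm is at most the
whole. -/
lemma norml_rpow_split {n : ℕ} {F : Type*} [NormedAddCommGroup F] [NormedSpace ℝ F] {r : ℝ}
    (hr : 1 ≤ r) {χ : Rn n → ℝ} (hχ : Continuous χ) (h0 : ∀ x, 0 ≤ χ x) (h1 : ∀ x, χ x ≤ 1)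
    {f : Rn n → F} (hf : MemLp f (ENNReal.ofReal r) volume) :
    norml r (fun x => χ x • f x) ^ r + norml r (fun x => (1 - χ x) • f x) ^ r ≤ norml r f ^ r := by
  have hr0 : 0 < r := by linarith
  have hm1 : AEStronglyMeasurable (fun x => χ x • f x) volume :=
    hχ.aestronglyMeasurable.smul hf.1
  have hm2 : AEStronglyMeasurable (fun x => (1 - χ x) • f x) volume :=
    (continuous_const.sub hχ).aestronglyMeasurable.smul hf.1
  have hle1 : ∀ x, ‖χ x • f x‖ ≤ ‖f x‖ := fun x => by
    rw [norm_smul, Real.norm_of_nonneg (h0 x)]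
    exact mul_le_of_le_one_left (norm_nonneg _) (h1 x)
  have hle2 : ∀ x, ‖(1 - χ x) • f x‖ ≤ ‖f x‖ := fun x => by
    rw [norm_smul, Real.norm_of_nonneg (by linarith [h1 x])]
    exact mul_le_of_le_one_left (norm_nonneg _) (by linarith [h0 x])
  have hi1 := integrable_norm_rpow_of_memLp hr0 (hf.mono hm1 (Eventually.of_forall hle1))
  have hi2 := integrable_norm_rpow_of_memLp hr0 (hf.mono hm2 (Eventually.of_forall hle2))
  rw [norml_rpow hr0 hm1, norml_rpow hr0 hm2, norml_rpow hr0 hf.1, ← integral_add hi1 hi2]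
  refine integral_mono (hi1.add hi2) (integrable_norm_rpow_of_memLp hr0 hf) fun x => ?_
  have hc0 := h0 x
  have hc1 : 0 ≤ 1 - χ x := by linarith [h1 x]
  simp only [norm_smul, Real.norm_of_nonneg hc0, Real.norm_of_nonneg hc1]
  rw [Real.mul_rpow hc0 (norm_nonneg _), Real.mul_rpow hc1 (norm_nonneg _), ← add_mul]
  refine mul_le_of_le_one_left (by positivity) ?_
  have e1 : χ x ^ r ≤ χ x := Real.rpow_le_self_of_le_one hc0 (h1 x) hr
  have e2 : (1 - χ x) ^ r ≤ 1 - χ x := Real.rpow_le_self_of_le_one hc1 (by linarith) hr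
  linarith

section Dichotomy

variable {n : ℕ} {p s q θ : ℝ}

/-- Splitting a test function by a cutoff and applying the sharp inequality to both parts. When
`κ < q`, the sum of the `κ`-th powers exceeds the `κ`-th power of the total `L^q` norm as soon as
both parts carry mass, which is what excludes dichotomy. -/
lemma gns_split {G κ : ℝ} (hp : 1 < p) (hs : 1 ≤ s) (hq1 : 1 ≤ q) (hθ0 : 0 < θ) (hθ1 : θ < 1)
    (hκ : κ * (θ / p + (1 - θ) / s) = 1) (hκ0 : 0 < κ) (hG : 0 < G)
    (hsharp : ∀ φ : Rn n → ℝ, IsTestFunction φ →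
      G * norml q φ ≤ norml p (gradient φ) ^ θ * norml s φ ^ (1 - θ))
    {φ : Rn n → ℝ} (hφ : IsTestFunction φ) {R : ℝ} (hR : 0 < R) {η : ℝ}
    (hη : norml p (fun x => φ x • gradient (cutoff R 0) x) ≤ η) :
    lpNorm φ (ENNReal.ofReal q) (volume.restrict (Metric.closedBall 0 R)) ^ κ
      + lpNorm φ (ENNReal.ofReal q) (volume.restrict (Metric.closedBall 0 (2 * R))ᶜ) ^ κ ≤
    κ * θ / p * ((norml p (gradient φ) + 2 * η) / G) ^ p
      + κ * (1 - θ) / s * (norml s φ / G) ^ s := by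
  have hq0 : 0 < q := by linarith
  have hp0 : 0 < p := by linarith
  have hs0 : 0 < s := by linarith
  have hη0 : 0 ≤ η := (norml_nonneg _ _).trans hη
  have hχ := cutoff_isTestFunction hR (0 : Rn n)
  set χ := cutoff R (0 : Rn n) with hχdef
  have ha := hχ.mul hφ
  have hb := hφ.sub ha
  have hbeq : (fun x => φ x - χ x * φ x) = fun x => (1 - χ x) • φ x := by
    ext x; simp only [smul_eq_mul]; ring
  -- the gradients of the two parts
  have hmg : ∀ {c : Rn n → ℝ}, Continuous c → MemLp (fun x => c x • gradient φ x)
      (ENNReal.ofReal p) volume := fun {c} hc =>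
    (hc.smul hφ.gradient_continuous).memLp_of_hasCompactSupport
      hφ.gradient_hasCompactSupport.smul_left
  have hme : MemLp (fun x => φ x • gradient χ x) (ENNReal.ofReal p) volume :=
    (hφ.continuous.smul hχ.gradient_continuous).memLp_of_hasCompactSupport
      hχ.gradient_hasCompactSupport.smul_left
  have hga : norml p (gradient fun x => χ x * φ x) ≤ norml p (fun x => χ x • gradient φ x) + η := by
    have e1 : (gradient fun x => χ x * φ x) =
        (fun x => χ x • gradient φ x) + fun x => φ x • gradient χ x := by
      ext1 x; exact gradient_cutoff_mul hR hφ x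
    rw [e1]
    exact (lpNorm_add_le (hmg hχ.continuous) (one_le_ofReal hp.le)).trans (by
      gcongr <;> first | exact le_rfl | exact hη)
  have hgb : norml p (gradient fun x => φ x - χ x * φ x) ≤
      norml p (fun x => (1 - χ x) • gradient φ x) + η := by
    have e1 : (gradient fun x => φ x - χ x * φ x) =
        (fun x => (1 - χ x) • gradient φ x) - fun x => φ x • gradient χ x := by
      ext1 x
      rw [gradient_sub_fun (hφ.differentiable x) (ha.differentiable x),
        gradient_cutoff_mul hR hφ x]
      simp only [Pi.sub_apply, sub_smul, one_smul]
      exact sub_add_eq_sub_sub _ _ _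
    rw [e1]
    exact (lpNorm_sub_le (hmg (continuous_const.sub hχ.continuous)) (one_le_ofReal hp.le)).trans (by
      gcongr <;> first | exact le_rfl | exact hη)
  have hsplitg := norml_rpow_split hp.le hχ.continuous cutoff_nonneg cutoff_le_one
    (hφ.gradient_memLp (ENNReal.ofReal p))
  have hsplits := norml_rpow_split hs hχ.continuous cutoff_nonneg cutoff_le_one
    (hφ.memLp (ENNReal.ofReal s))
  simp only [smul_eq_mul] at hsplits
  have hA := rpow_le_of_gns hp0 hs0 hθ0 hθ1 hκ hκ0 hG (norml_nonneg q _)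
    (add_nonneg (norml_nonneg p _) hη0) (norml_nonneg s _)
    ((hsharp _ ha).trans (by
      have := norml_nonneg s (fun x => χ x * φ x)
      have := norml_nonneg p (gradient fun x => χ x * φ x)
      gcongr))
  have hB := rpow_le_of_gns hp0 hs0 hθ0 hθ1 hκ hκ0 hG (norml_nonneg q _)
    (add_nonneg (norml_nonneg p _) hη0) (norml_nonneg s _)
    ((hsharp _ hb).trans (by
      have := norml_nonneg s (fun x => φ x - χ x * φ x)
      have := norml_nonneg p (gradient fun x => φ x - χ x * φ x)
      gcongr))
  -- the two parts carry the mass inside and outside of the transition region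
  have hla : lpNorm φ (ENNReal.ofReal q) (volume.restrict (Metric.closedBall 0 R)) ≤
      norml q (fun x => χ x * φ x) := by
    rw [norml_eq_toReal ha.continuous.aestronglyMeasurable,
      ← toReal_eLpNorm hφ.continuous.aestronglyMeasurable]
    refine ENNReal.toReal_mono (ha.memLp _).2.ne ?_
    rw [← eLpNorm_indicator_eq_eLpNorm_restrict Metric.isClosed_closedBall.measurableSet]
    refine eLpNorm_mono fun x => ?_
    by_cases hx : x ∈ Metric.closedBall (0 : Rn n) R
    · rw [Set.indicator_of_mem hx, hχdef, cutoff_eq_one hR hx, one_mul]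
    · rw [Set.indicator_of_notMem hx, norm_zero]; exact norm_nonneg _
  have hlb : lpNorm φ (ENNReal.ofReal q) (volume.restrict (Metric.closedBall 0 (2 * R))ᶜ) ≤
      norml q (fun x => φ x - χ x * φ x) := by
    rw [norml_eq_toReal hb.continuous.aestronglyMeasurable,
      ← toReal_eLpNorm hφ.continuous.aestronglyMeasurable]
    refine ENNReal.toReal_mono (hb.memLp _).2.ne ?_
    rw [← eLpNorm_indicator_eq_eLpNorm_restrict Metric.isClosed_closedBall.measurableSet.compl]
    refine eLpNorm_mono fun x => ?_
    by_cases hx : x ∈ (Metric.closedBall (0 : Rn n) (2 * R))ᶜ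
    · rw [Set.indicator_of_mem hx, hχdef, cutoff_eq_zero hR hx, zero_mul, sub_zero]
    · rw [Set.indicator_of_notMem hx, norm_zero]; exact norm_nonneg _
  have hla' := Real.rpow_le_rpow lpNorm_nonneg hla hκ0.le
  have hlb' := Real.rpow_le_rpow lpNorm_nonneg hlb hκ0.le
  have hmink := add_rpow_add_rpow_le hp.le (norml_nonneg _ _) (norml_nonneg _ _)
    (norml_nonneg _ _) hη0 hsplitg
  have hα : 0 ≤ κ * θ / p := by positivity
  have hβ : 0 ≤ κ * (1 - θ) / s := div_nonneg (mul_nonneg hκ0.le (by linarith)) hs0.le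
  have hbs : norml s (fun x => φ x - χ x * φ x) = norml s (fun x => (1 - χ x) * φ x) := by
    rw [hbeq]; rfl
  rw [hbs] at hB
  have hgrad : ((norml p (fun x => χ x • gradient φ x) + η) / G) ^ p +
      ((norml p (fun x => (1 - χ x) • gradient φ x) + η) / G) ^ p ≤
      ((norml p (gradient φ) + 2 * η) / G) ^ p := by
    rw [Real.div_rpow (add_nonneg (norml_nonneg _ _) hη0) hG.le,
      Real.div_rpow (add_nonneg (norml_nonneg _ _) hη0) hG.le,
      Real.div_rpow (add_nonneg (norml_nonneg _ _) (by linarith)) hG.le, ← add_div]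
    gcongr
  have hfun : (norml s (fun x => χ x * φ x) / G) ^ s +
      (norml s (fun x => (1 - χ x) * φ x) / G) ^ s ≤ (norml s φ / G) ^ s := by
    rw [Real.div_rpow (norml_nonneg _ _) hG.le, Real.div_rpow (norml_nonneg _ _) hG.le,
      Real.div_rpow (norml_nonneg _ _) hG.le, ← add_div]
    gcongr
  have h1 := mul_le_mul_of_nonneg_left hgrad hα
  have h2 := mul_le_mul_of_nonneg_left hfun hβ
  rw [mul_add] at h1 h2
  linarith

/-- For bounded sequences in `D^{p,s}` the cutoff error `φ ∇χ_R` tends to zero in `L^p` as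
`R → ∞`, uniformly in the sequence. -/
lemma exists_cutoff_error_seq (hp : 1 < p) (hpn : p < (n : ℝ)) (hs : 1 ≤ s)
    (hsP : s < (n : ℝ) * p / ((n : ℝ) - p)) {K : ENNReal} (hK : K ≠ ⊤) :
    ∃ η : ℕ → ℝ, Tendsto η atTop (𝓝 0) ∧ ∀ R : ℕ, 0 < R → ∀ φ : Rn n → ℝ, IsTestFunction φ →
      eLpNorm (gradient φ) (ENNReal.ofReal p) volume ≤ K →
      eLpNorm φ (ENNReal.ofReal s) volume ≤ K →
      norml p (fun x => φ x • gradient (cutoff (R : ℝ) 0) x) ≤ η R := by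
  obtain ⟨CS, hCS0, hCS⟩ := exists_sobolev_const hp hpn
  have hinv := inv_sobolev_exponent hp hpn
  have hP := sobolev_exponent_pos hp hpn
  set P := (n : ℝ) * p / ((n : ℝ) - p) with hPdef
  have hn : (0 : ℝ) < n := by linarith
  have hpP : p < P := lt_sobolev_exponent hp hpn
  obtain ⟨t, htm, htP⟩ := exists_between (max_lt hpP hsP)
  obtain ⟨hpt, hst⟩ := max_lt_iff.1 htm
  have ht0 : 0 < t := by linarith
  obtain ⟨a, ha0, ha1, ha⟩ := exists_interpolation_exponent (by linarith : 0 < s) hst htP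
  obtain ⟨C, hC0, hC⟩ := exists_cutoff_error n hp.le hpt.le
  set T : ENNReal := K ^ (1 - a) * (ENNReal.ofReal CS * K) ^ a with hT
  have hTtop : T ≠ ⊤ := ENNReal.mul_ne_top (ENNReal.rpow_ne_top_of_nonneg (by linarith) hK)
    (ENNReal.rpow_ne_top_of_nonneg ha0.le (ENNReal.mul_ne_top ENNReal.ofReal_ne_top hK))
  have hexp : -1 + (n : ℝ) * (1 / p - 1 / t) < 0 := by
    have h1 : 1 / P < 1 / t := one_div_lt_one_div_of_lt ht0 htP
    rw [hinv] at h1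
    have h2 : (n : ℝ) * (1 / p - 1 / t) < n * (1 / n) := by gcongr; linarith
    rw [mul_one_div_cancel hn.ne'] at h2
    linarith
  refine ⟨fun R => C * (R : ℝ) ^ (-1 + (n : ℝ) * (1 / p - 1 / t)) * T.toReal, ?_, ?_⟩
  · have h1 : Tendsto (fun x : ℝ => x ^ (-1 + (n : ℝ) * (1 / p - 1 / t))) atTop (𝓝 0) := by
      have := tendsto_rpow_neg_atTop (neg_pos.2 hexp)
      rwa [neg_neg] at this
    have h2 := ((h1.comp tendsto_natCast_atTop_atTop).const_mul C).mul_const T.toReal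
    rw [mul_zero, zero_mul] at h2
    exact h2
  · intro R hR φ hφ hg hu
    have hR' : (0 : ℝ) < R := by exact_mod_cast hR
    have hT' : eLpNorm φ (ENNReal.ofReal t) volume ≤ T :=
      (eLpNorm_le_interpolation hφ.continuous.aestronglyMeasurable (by linarith) ht0 hP
        ha0.le ha1.le ha).trans (by
          rw [hT]
          gcongr
          exact (hCS φ hφ).trans (by gcongr))
    have h1 := hC R hR' 0 φ hφ.continuous.aestronglyMeasurable
    have h2 : eLpNorm (fun x => φ x • gradient (cutoff (R : ℝ) 0) x) (ENNReal.ofReal p) volume ≤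
        ENNReal.ofReal (C * (R : ℝ) ^ (-1 + (n : ℝ) * (1 / p - 1 / t))) * T :=
      h1.trans (by
        gcongr
        exact (eLpNorm_mono_measure _ Measure.restrict_le_self).trans hT')
    rw [norml_eq_toReal (f := fun x => φ x • gradient (cutoff (R : ℝ) 0) x) (hφ.continuous.smul
      (cutoff_isTestFunction hR' 0).gradient_continuous).aestronglyMeasurable]
    refine (ENNReal.toReal_mono (ENNReal.mul_ne_top ENNReal.ofReal_ne_top hTtop) h2).trans
      (le_of_eq ?_)
    rw [ENNReal.toReal_mul, ENNReal.toReal_ofReal (by positivity)]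

lemma eq_one_of_rpow_add_rpow_le {m τ : ℝ} (hm0 : 0 < m) (hm1 : m ≤ 1) (hτ : τ < 1)
    (h : m ^ τ + (1 - m) ^ τ ≤ 1) : m = 1 := by
  by_contra hne
  have hlt : m < 1 := lt_of_le_of_ne hm1 hne
  have h1 : m < m ^ τ := Real.self_lt_rpow_of_lt_one hm0 hlt hτ
  have h2 : 1 - m < (1 - m) ^ τ := Real.self_lt_rpow_of_lt_one (by linarith) (by linarith) hτ
  linarith

/-- An almost optimal sequence that converges locally in `L^q` and does not vanish is Cauchy in
`L^q(ℝⁿ)`: a loss of mass at infinity would contradict the superadditivity in `gns_split`. -/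
lemma tendsto_norml_sub_of_nonvanishing {G : ℝ} (hp : 1 < p) (hpn : p < (n : ℝ))
    (hs : 1 ≤ s) (hsq : s < q) (hq : q < (n : ℝ) * p / ((n : ℝ) - p))
    (hθ : θ / ((n : ℝ) * p / ((n : ℝ) - p)) + (1 - θ) / s = 1 / q) (hG : 0 < G)
    (hsharp : ∀ φ : Rn n → ℝ, IsTestFunction φ →
      G * norml q φ ≤ norml p (gradient φ) ^ θ * norml s φ ^ (1 - θ))
    {φ : ℕ → Rn n → ℝ} (hφ : ∀ h, IsTestFunction (φ h)) {K : ENNReal} (hK : K ≠ ⊤)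
    (hgK : ∀ h, eLpNorm (gradient (φ h)) (ENNReal.ofReal p) volume ≤ K)
    (huK : ∀ h, eLpNorm (φ h) (ENNReal.ofReal s) volume ≤ K)
    (hE : Tendsto (fun h => norml p (gradient (φ h))) atTop (𝓝 G))
    (hS : Tendsto (fun h => norml s (φ h)) atTop (𝓝 G))
    (hN : Tendsto (fun h => norml q (φ h)) atTop (𝓝 1))
    (hloc : ∀ R : ℝ, Tendsto (fun jl : ℕ × ℕ => eLpNorm (fun x => φ jl.1 x - φ jl.2 x)
      (ENNReal.ofReal q) (volume.restrict (Metric.closedBall 0 R))) atTop (𝓝 0))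
    {c : ℝ} (hc : 0 < c) {ρ : ℕ}
    (hnv : ∀ᶠ h in atTop, c ≤ lpNorm (φ h) (ENNReal.ofReal q)
      (volume.restrict (Metric.closedBall 0 (ρ : ℝ)))) :
    Tendsto (fun jl : ℕ × ℕ => norml q (fun x => φ jl.1 x - φ jl.2 x)) atTop (𝓝 0) := by
  have hq1 : 1 ≤ q := by linarith
  have hq0 : 0 < q := by linarith
  have hp0 : 0 < p := by linarith
  have hs0 : 0 < s := by linarith
  have hP := sobolev_exponent_pos hp hpn
  have hinv := inv_sobolev_exponent hp hpn
  obtain ⟨hθ0, hθ1⟩ := theta_bounds hs hsq hq hθ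
  have hn : (0 : ℝ) < n := by linarith
  -- `1/κ` exceeds `1/q = θ/p⋆ + (1-θ)/s` because `p < p⋆`
  set κ : ℝ := (θ / p + (1 - θ) / s)⁻¹ with hκdef
  have h1θ : 0 < 1 - θ := by linarith
  have hsum : 0 < θ / p + (1 - θ) / s := by positivity
  have hκ0 : 0 < κ := inv_pos.2 hsum
  have hκ : κ * (θ / p + (1 - θ) / s) = 1 := inv_mul_cancel₀ hsum.ne'
  have hκq : κ / q < 1 := by
    rw [div_lt_one hq0, hκdef, inv_lt_comm₀ hsum hq0, ← one_div, ← hθ, div_eq_mul_one_div θ,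
      hinv, div_eq_mul_one_div θ p]
    have : 0 < θ * (1 / n) := by positivity
    linarith
  set τ := κ / q with hτ
  have hτ0 : 0 < τ := by positivity
  obtain ⟨η, hη0, hη⟩ := exists_cutoff_error_seq hp hpn hs (hsq.trans hq) hK
  have hmem : ∀ h, MemLp (φ h) (ENNReal.ofReal q) volume := fun h => (hφ h).memLp _
  set B : ℕ → Set (Rn n) := fun R => Metric.closedBall 0 (R : ℝ) with hB
  have hBm : ∀ R, MeasurableSet (B R) := fun R => Metric.isClosed_closedBall.measurableSet
  set ν : ℕ → ℕ → ℝ := fun h R => lpNorm (φ h) (ENNReal.ofReal q) (volume.restrict (B R)) with hν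
  set σ : ℕ → ℕ → ℝ := fun h R => lpNorm (φ h) (ENNReal.ofReal q) (volume.restrict (B R)ᶜ)
    with hσ
  have hν0 : ∀ h R, 0 ≤ ν h R := fun _ _ => lpNorm_nonneg
  have hσ0 : ∀ h R, 0 ≤ σ h R := fun _ _ => lpNorm_nonneg
  have hνσ : ∀ h R, ν h R ^ q + σ h R ^ q = norml q (φ h) ^ q := fun h R =>
    lpNorm_rpow_add_compl hq0 (hmem h) (hBm R)
  -- the local masses converge
  have hlocR : ∀ R : ℕ, Tendsto (fun jl : ℕ × ℕ => lpNorm (fun x => φ jl.1 x - φ jl.2 x)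
      (ENNReal.ofReal q) (volume.restrict (B R))) atTop (𝓝 0) := by
    intro R
    have h1 := (ENNReal.tendsto_toReal ENNReal.zero_ne_top).comp (hloc R)
    rw [ENNReal.toReal_zero] at h1
    refine h1.congr fun jl => ?_
    exact toReal_eLpNorm ((hφ _).sub (hφ _)).continuous.aestronglyMeasurable
  have hνlim : ∀ R, ∃ a, Tendsto (fun h => ν h R) atTop (𝓝 a) := by
    intro R
    refine cauchySeq_tendsto_of_complete (cauchySeq_iff_tendsto_dist_atTop_0.2 ?_)
    refine squeeze_zero (fun _ => dist_nonneg) (fun jl => ?_) (hlocR R)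
    rw [Real.dist_eq, abs_le]
    have h1 := lpNorm_le_lpNorm_add_lpNorm_sub' (f := φ jl.1) ((hmem jl.2).restrict (B R))
      (one_le_ofReal hq1)
    have h2 := lpNorm_le_lpNorm_add_lpNorm_sub (f := φ jl.2) ((hmem jl.1).restrict (B R))
      (one_le_ofReal hq1)
    simp only [Pi.sub_def] at h1 h2
    exact ⟨by linarith, by linarith⟩
  choose ν' hν' using hνlim
  have hν'0 : ∀ R, 0 ≤ ν' R := fun R => ge_of_tendsto' (hν' R) fun h => hν0 h R
  set m : ℕ → ℝ := fun R => ν' R ^ q with hm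
  have hmlim : ∀ R, Tendsto (fun h => ν h R ^ q) atTop (𝓝 (m R)) := fun R =>
    (hν' R).rpow_const (Or.inr hq0.le)
  have hNlim : Tendsto (fun h => norml q (φ h) ^ q) atTop (𝓝 1) := by
    simpa using hN.rpow_const (p := q) (Or.inr hq0.le)
  have hσlim : ∀ R, Tendsto (fun h => σ h R ^ q) atTop (𝓝 (1 - m R)) := fun R =>
    (hNlim.sub (hmlim R)).congr fun h => by rw [← hνσ h R]; ring
  have hm1 : ∀ R, m R ≤ 1 := fun R => by
    have := ge_of_tendsto' (hσlim R) fun h => Real.rpow_nonneg (hσ0 h R) q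
    linarith
  have hmono : Monotone m := by
    intro R R' hRR'
    refine le_of_tendsto_of_tendsto' (hmlim R) (hmlim R') fun h => ?_
    refine Real.rpow_le_rpow (hν0 h R) ?_ hq0.le
    exact lpNorm_restrict_mono (hmem h)
      (Metric.closedBall_subset_closedBall (by exact_mod_cast hRR'))
  obtain ⟨m', hm'⟩ : ∃ m', Tendsto m atTop (𝓝 m') :=
    ⟨_, tendsto_atTop_ciSup hmono ⟨1, by rintro _ ⟨R, rfl⟩; exact hm1 R⟩⟩
  have hm'1 : m' ≤ 1 := le_of_tendsto' hm' hm1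
  have hm'0 : 0 < m' := by
    have h1 : c ^ q ≤ m ρ := ge_of_tendsto (hmlim ρ)
      (hnv.mono fun h hh => Real.rpow_le_rpow hc.le hh hq0.le)
    exact (Real.rpow_pos_of_pos hc q).trans_le (h1.trans (hmono.ge_of_tendsto hm' ρ))
  -- the split inequality, first for `h → ∞`, then for `R → ∞`
  have hineq : ∀ R : ℕ, 0 < R → m R ^ τ + (1 - m (2 * R)) ^ τ ≤
      κ * θ / p * ((G + 2 * η R) / G) ^ p + κ * (1 - θ) / s := by
    intro R hR
    have hR' : (0 : ℝ) < R := by exact_mod_cast hR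
    have hleft : Tendsto (fun h => (ν h R ^ q) ^ τ + (σ h (2 * R) ^ q) ^ τ) atTop
        (𝓝 (m R ^ τ + (1 - m (2 * R)) ^ τ)) :=
      ((hmlim R).rpow_const (Or.inr hτ0.le)).add ((hσlim (2 * R)).rpow_const (Or.inr hτ0.le))
    have hright : Tendsto (fun h => κ * θ / p * ((norml p (gradient (φ h)) + 2 * η R) / G) ^ p
        + κ * (1 - θ) / s * (norml s (φ h) / G) ^ s) atTop
        (𝓝 (κ * θ / p * ((G + 2 * η R) / G) ^ p + κ * (1 - θ) / s * (G / G) ^ s)) :=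
      ((((hE.add_const _).div_const G).rpow_const (Or.inr hp0.le)).const_mul _).add
        (((hS.div_const G).rpow_const (Or.inr hs0.le)).const_mul _)
    rw [div_self hG.ne', Real.one_rpow, mul_one] at hright
    refine le_of_tendsto_of_tendsto' hleft hright fun h => ?_
    have h1 := gns_split hp hs hq1 hθ0 hθ1 hκ hκ0 hG hsharp (hφ h) hR'
      (hη R hR (φ h) (hφ h) (hgK h) (huK h))
    have h2 : ∀ x : ℝ, 0 ≤ x → (x ^ q) ^ τ = x ^ κ := fun x hx => by
      rw [← Real.rpow_mul hx, hτ, mul_div_cancel₀ _ hq0.ne']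
    rw [h2 _ (hν0 _ _), h2 _ (hσ0 _ _)]
    refine le_trans (le_of_eq ?_) h1
    simp only [hν, hσ, hB]
    push_cast
    rfl
  have hlim : m' ^ τ + (1 - m') ^ τ ≤ 1 := by
    have h2R : Tendsto (fun R : ℕ => 2 * R) atTop atTop :=
      tendsto_id.const_mul_atTop' two_pos
    have hleft : Tendsto (fun R => m R ^ τ + (1 - m (2 * R)) ^ τ) atTop
        (𝓝 (m' ^ τ + (1 - m') ^ τ)) :=
      (hm'.rpow_const (Or.inr hτ0.le)).add
        (((hm'.comp h2R).const_sub 1).rpow_const (Or.inr hτ0.le))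
    have hright : Tendsto (fun R => κ * θ / p * ((G + 2 * η R) / G) ^ p + κ * (1 - θ) / s) atTop
        (𝓝 (κ * θ / p * ((G + 2 * 0) / G) ^ p + κ * (1 - θ) / s)) :=
      ((((hη0.const_mul 2).const_add G).div_const G).rpow_const
        (Or.inr hp0.le)).const_mul _ |>.add_const _
    rw [mul_zero, add_zero, div_self hG.ne', Real.one_rpow, mul_one] at hright
    have := le_of_tendsto_of_tendsto hleft hright
      ((eventually_gt_atTop 0).mono fun R hR => hineq R hR)
    refine this.trans (le_of_eq ?_)
    linear_combination hκ
  have hm'eq : m' = 1 := eq_one_of_rpow_add_rpow_le hm'0 hm'1 hκq hlim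
  -- tightness gives the Cauchy property on the whole space
  have hqinv : ∀ x : ℝ, 0 ≤ x → (x ^ q) ^ (1 / q) = x := fun x hx => by
    rw [← Real.rpow_mul hx, mul_one_div_cancel hq0.ne', Real.rpow_one]
  have hσR : ∀ R, Tendsto (fun h => σ h R) atTop (𝓝 ((1 - m R) ^ (1 / q))) := fun R =>
    ((hσlim R).rpow_const (Or.inr (by positivity))).congr fun h => hqinv _ (hσ0 h R)
  have hbd : ∀ (R : ℕ) (jl : ℕ × ℕ), norml q (fun x => φ jl.1 x - φ jl.2 x) ≤
      lpNorm (fun x => φ jl.1 x - φ jl.2 x) (ENNReal.ofReal q) (volume.restrict (B R)) +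
        (σ jl.1 R + σ jl.2 R) := by
    intro R jl
    have hd := (hφ jl.1).sub (hφ jl.2)
    have h1 := lpNorm_rpow_add_compl hq0 (hd.memLp (ENNReal.ofReal q)) (hBm R)
    have h2 : lpNorm (fun x => φ jl.1 x - φ jl.2 x) (ENNReal.ofReal q) (volume.restrict (B R)ᶜ) ≤
        σ jl.1 R + σ jl.2 R :=
      lpNorm_sub_le ((hmem jl.1).restrict (B R)ᶜ) (one_le_ofReal hq1)
    set x := lpNorm (fun x => φ jl.1 x - φ jl.2 x) (ENNReal.ofReal q) (volume.restrict (B R))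
    set y := lpNorm (fun x => φ jl.1 x - φ jl.2 x) (ENNReal.ofReal q) (volume.restrict (B R)ᶜ)
    have hx : 0 ≤ x := lpNorm_nonneg
    have hy : 0 ≤ y := lpNorm_nonneg
    have h3 : norml q (fun x => φ jl.1 x - φ jl.2 x) ≤ x + y := by
      refine (Real.rpow_le_rpow_iff (norml_nonneg _ _) (by positivity) hq0).1 ?_
      refine le_trans (le_of_eq h1.symm) ?_
      exact Real.add_rpow_le_rpow_add hx hy hq1
    linarith
  rw [Metric.tendsto_nhds]
  intro ε hε
  have hR0 : Tendsto (fun R => 0 + ((1 - m R) ^ (1 / q) + (1 - m R) ^ (1 / q))) atTop (𝓝 0) := by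
    have h1 : Tendsto (fun R => (1 - m R) ^ (1 / q)) atTop (𝓝 ((1 - m') ^ (1 / q))) :=
      (hm'.const_sub 1).rpow_const (Or.inr (by positivity))
    rw [hm'eq, sub_self, Real.zero_rpow (by positivity)] at h1
    simpa using h1.add h1
  obtain ⟨R, hR⟩ := (hR0.eventually_lt_const hε).exists
  have h2 : Tendsto (fun jl : ℕ × ℕ =>
      lpNorm (fun x => φ jl.1 x - φ jl.2 x) (ENNReal.ofReal q) (volume.restrict (B R)) +
        (σ jl.1 R + σ jl.2 R)) atTop (𝓝 (0 + ((1 - m R) ^ (1 / q) + (1 - m R) ^ (1 / q)))) := by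
    refine (hlocR R).add ?_
    rw [← prod_atTop_atTop_eq]
    exact ((hσR R).comp tendsto_fst).add ((hσR R).comp tendsto_snd)
  filter_upwards [h2.eventually_lt_const hR] with jl hjl
  rw [Real.dist_0_eq_abs, abs_of_nonneg (norml_nonneg _ _)]
  exact (hbd R jl).trans_lt hjl

end Dichotomy

/-! ### Uniform convexity and convergence of the gradients -/

section UniformConvexity

variable {n : ℕ} {p s q θ : ℝ} {E : Type*} [NormedAddCommGroup E] [NormedSpace ℝ E]
  [StrictConvexSpace ℝ E]

lemma norm_midpoint_rpow_lt {p : ℝ} (hp : 1 < p) {a b : E} (hab : a ≠ b) :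
    ‖(1 / 2 : ℝ) • (a + b)‖ ^ p < (‖a‖ ^ p + ‖b‖ ^ p) / 2 := by
  have hp0 : 0 < p := by linarith
  by_cases h : ‖a‖ = ‖b‖
  · have h1 := (norm_midpoint_lt_iff h).2 hab
    have h2 := Real.rpow_lt_rpow (norm_nonneg _) h1 hp0
    rw [← h]; linarith
  · have h1 := (strictConvexOn_rpow hp).2 (norm_nonneg a) (norm_nonneg b) h
      (by norm_num : (0 : ℝ) < 1 / 2) (by norm_num : (0 : ℝ) < 1 / 2) (by norm_num)
    simp only [smul_eq_mul] at h1
    have h2 : ‖(1 / 2 : ℝ) • (a + b)‖ ≤ 1 / 2 * ‖a‖ + 1 / 2 * ‖b‖ := by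
      rw [norm_smul, Real.norm_of_nonneg (by norm_num)]
      linarith [norm_add_le a b]
    have h3 := Real.rpow_le_rpow (norm_nonneg _) h2 hp0.le
    linarith

lemma norm_midpoint_rpow_le {p : ℝ} (hp : 1 < p) (a b : E) :
    0 ≤ (‖a‖ ^ p + ‖b‖ ^ p) / 2 - ‖(1 / 2 : ℝ) • (a + b)‖ ^ p := by
  by_cases hab : a = b
  · subst hab
    rw [← two_smul ℝ a, smul_smul]; norm_num
  · linarith [norm_midpoint_rpow_lt hp hab]

lemma norm_le_one_of_rpow_add_rpow {F : Type*} [NormedAddCommGroup F] {p : ℝ} (hp : 0 < p)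
    {a b : F} (h : ‖a‖ ^ p + ‖b‖ ^ p = 1) :
    ‖a‖ ≤ 1 ∧ ‖b‖ ≤ 1 := by
  have ha := Real.rpow_nonneg (norm_nonneg a) p
  have hb := Real.rpow_nonneg (norm_nonneg b) p
  constructor
  · by_contra! hc
    linarith [Real.one_lt_rpow hc hp]
  · by_contra! hc
    linarith [Real.one_lt_rpow hc hp]

/-- Uniform convexity on the unit sphere of `|a|^p + |b|^p`, by compactness. -/
lemma exists_uniform_convexity_const_sphere (E : Type*) [NormedAddCommGroup E] [NormedSpace ℝ E]
    [StrictConvexSpace ℝ E] [ProperSpace E] {p ε : ℝ} (hp : 1 < p) (hε : 0 < ε) :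
    ∃ C : ℝ, 0 ≤ C ∧ ∀ a b : E, ‖a‖ ^ p + ‖b‖ ^ p = 1 →
      ‖a - b‖ ^ p ≤ ε + C * ((‖a‖ ^ p + ‖b‖ ^ p) / 2 - ‖(1 / 2 : ℝ) • (a + b)‖ ^ p) := by
  have hp0 : 0 < p := by linarith
  set S : Set (E × E) := {ab | ‖ab.1‖ ^ p + ‖ab.2‖ ^ p = 1 ∧ ε ≤ ‖ab.1 - ab.2‖ ^ p} with hS
  have hcont : ∀ f : E × E → E, Continuous f → Continuous fun ab => ‖f ab‖ ^ p :=
    fun f hf => hf.norm.rpow_const fun _ => Or.inr hp0.le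
  have hc1 := hcont (fun ab => ab.1) continuous_fst
  have hc2 := hcont (fun ab => ab.2) continuous_snd
  have hScomp : IsCompact S := by
    refine Metric.isCompact_of_isClosed_isBounded ?_ ?_
    · have h3 := hcont (fun ab => ab.1 - ab.2) (by fun_prop)
      exact (isClosed_eq (hc1.add hc2) continuous_const).inter (isClosed_le continuous_const h3)
    · refine (Metric.isBounded_closedBall (x := (0 : E × E)) (r := 1)).subset fun ab hab => ?_
      rw [mem_closedBall_zero_iff]
      have h := norm_le_one_of_rpow_add_rpow hp0 hab.1
      exact max_le h.1 h.2
  have hDc : Continuous fun ab : E × E =>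
      (‖ab.1‖ ^ p + ‖ab.2‖ ^ p) / 2 - ‖(1 / 2 : ℝ) • (ab.1 + ab.2)‖ ^ p := by
    have h3 := hcont (fun ab => (1 / 2 : ℝ) • (ab.1 + ab.2)) (by fun_prop)
    exact ((hc1.add hc2).div_const 2).sub h3
  rcases S.eq_empty_or_nonempty with hemp | hne
  · refine ⟨0, le_rfl, fun a b hab => ?_⟩
    by_contra! hcon
    have : (a, b) ∈ S := ⟨hab, by rw [zero_mul, add_zero] at hcon; exact hcon.le⟩
    rw [hemp] at this
    exact this
  · obtain ⟨⟨a₀, b₀⟩, h₀, hmin⟩ := hScomp.exists_isMinOn hne hDc.continuousOn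
    have hne₀ : a₀ ≠ b₀ := by
      rintro rfl
      have := h₀.2
      simp only [sub_self, norm_zero, Real.zero_rpow hp0.ne'] at this
      linarith
    obtain ⟨d, hd⟩ : ∃ d, d = (‖a₀‖ ^ p + ‖b₀‖ ^ p) / 2 - ‖(1 / 2 : ℝ) • (a₀ + b₀)‖ ^ p :=
      ⟨_, rfl⟩
    have hd0 : 0 < d := by linarith [norm_midpoint_rpow_lt hp hne₀]
    refine ⟨2 ^ p / d, by positivity, fun a b hab => ?_⟩
    by_cases hc : ε ≤ ‖a - b‖ ^ p
    · have h1 : d ≤ (‖a‖ ^ p + ‖b‖ ^ p) / 2 - ‖(1 / 2 : ℝ) • (a + b)‖ ^ p := by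
        rw [hd]; exact hmin (show (a, b) ∈ S from ⟨hab, hc⟩)
      have h2 : ‖a - b‖ ≤ 2 := by
        obtain ⟨ha, hb⟩ := norm_le_one_of_rpow_add_rpow hp0 hab
        linarith [norm_sub_le a b]
      have h3 : ‖a - b‖ ^ p ≤ 2 ^ p := Real.rpow_le_rpow (norm_nonneg _) h2 hp0.le
      have h4 : (2 : ℝ) ^ p / d * d = 2 ^ p := div_mul_cancel₀ _ hd0.ne'
      have h5 := mul_le_mul_of_nonneg_left h1 (by positivity : 0 ≤ (2 : ℝ) ^ p / d)
      linarith
    · push Not at hc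
      have := mul_nonneg (by positivity : 0 ≤ 2 ^ p / d) (norm_midpoint_rpow_le hp a b)
      linarith

/-- A pointwise form of uniform convexity, by homogeneity: `|a - b|^p` is controlled by the
convexity defect of `|·|^p` up to a small multiple of `|a|^p + |b|^p`. -/
lemma exists_uniform_convexity_const (E : Type*) [NormedAddCommGroup E] [NormedSpace ℝ E]
    [StrictConvexSpace ℝ E] [ProperSpace E] {p ε : ℝ} (hp : 1 < p) (hε : 0 < ε) :
    ∃ C : ℝ, 0 ≤ C ∧ ∀ a b : E, ‖a - b‖ ^ p ≤ ε * (‖a‖ ^ p + ‖b‖ ^ p) +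
      C * ((‖a‖ ^ p + ‖b‖ ^ p) / 2 - ‖(1 / 2 : ℝ) • (a + b)‖ ^ p) := by
  have hp0 : 0 < p := by linarith
  obtain ⟨C, hC0, hC⟩ := exists_uniform_convexity_const_sphere E hp hε
  refine ⟨C, hC0, fun a b => ?_⟩
  have ha := Real.rpow_nonneg (norm_nonneg a) p
  have hb := Real.rpow_nonneg (norm_nonneg b) p
  obtain ⟨N, hN⟩ : ∃ N, N = ‖a‖ ^ p + ‖b‖ ^ p := ⟨_, rfl⟩
  have hN0 : 0 ≤ N := by rw [hN]; exact add_nonneg ha hb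
  rcases hN0.eq_or_lt with h0 | hpos
  · have ha0 : a = 0 := by
      have : ‖a‖ ^ p = 0 := by linarith
      exact norm_eq_zero.1 ((Real.rpow_eq_zero (norm_nonneg a) hp0.ne').1 this)
    have hb0 : b = 0 := by
      have : ‖b‖ ^ p = 0 := by linarith
      exact norm_eq_zero.1 ((Real.rpow_eq_zero (norm_nonneg b) hp0.ne').1 this)
    rw [ha0, hb0]; simp [Real.zero_rpow hp0.ne']
  · have hscale : ∀ v : E, ‖(N ^ (-(1 / p))) • v‖ ^ p = N⁻¹ * ‖v‖ ^ p := by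
      intro v
      rw [norm_smul, Real.norm_of_nonneg (by positivity), Real.mul_rpow (by positivity)
        (norm_nonneg _), ← Real.rpow_mul hN0, show -(1 / p) * p = -1 by field_simp,
        Real.rpow_neg_one]
    have h1 := hC ((N ^ (-(1 / p))) • a) ((N ^ (-(1 / p))) • b) (by
      rw [hscale, hscale, ← mul_add, ← hN]; exact inv_mul_cancel₀ hpos.ne')
    rw [← smul_sub, ← smul_add, smul_comm, hscale, hscale, hscale, hscale, ← mul_add, ← hN,
      inv_mul_cancel₀ hpos.ne'] at h1
    have h2 := mul_le_mul_of_nonneg_left h1 hN0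
    rw [mul_inv_cancel_left₀ hpos.ne'] at h2
    have e2 : N * (ε + C * (1 / 2 - N⁻¹ * ‖(1 / 2 : ℝ) • (a + b)‖ ^ p)) =
        ε * N + C * (N / 2 - (N * N⁻¹) * ‖(1 / 2 : ℝ) • (a + b)‖ ^ p) := by ring
    rw [e2, mul_inv_cancel₀ hpos.ne', one_mul] at h2
    rw [← hN]
    exact h2

/-- The integrated form of the pointwise uniform convexity inequality. -/
lemma norml_sub_rpow_le {p ε C : ℝ} (hp : 1 < p)
    (hC : ∀ a b : Rn n, ‖a - b‖ ^ p ≤ ε * (‖a‖ ^ p + ‖b‖ ^ p) +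
      C * ((‖a‖ ^ p + ‖b‖ ^ p) / 2 - ‖(1 / 2 : ℝ) • (a + b)‖ ^ p)) {f g : Rn n → Rn n}
    (hf : MemLp f (ENNReal.ofReal p) volume) (hg : MemLp g (ENNReal.ofReal p) volume) :
    norml p (fun x => f x - g x) ^ p ≤ ε * (norml p f ^ p + norml p g ^ p) +
      C * ((norml p f ^ p + norml p g ^ p) / 2
        - norml p (fun x => (1 / 2 : ℝ) • (f x + g x)) ^ p) := by
  have hp0 : 0 < p := by linarith
  have hd : MemLp (fun x => f x - g x) (ENNReal.ofReal p) volume := hf.sub hg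
  have hm : MemLp (fun x => (1 / 2 : ℝ) • (f x + g x)) (ENNReal.ofReal p) volume :=
    (hf.add hg).const_smul (1 / 2 : ℝ)
  have i1 := integrable_norm_rpow_of_memLp hp0 hf
  have i2 := integrable_norm_rpow_of_memLp hp0 hg
  have i3 := integrable_norm_rpow_of_memLp hp0 hd
  have i4 := integrable_norm_rpow_of_memLp hp0 hm
  have i5 : Integrable (fun x => ‖f x‖ ^ p + ‖g x‖ ^ p) volume := i1.add i2
  have i6 : Integrable (fun x => (‖f x‖ ^ p + ‖g x‖ ^ p) / 2 -
      ‖(1 / 2 : ℝ) • (f x + g x)‖ ^ p) volume := (i5.div_const 2).sub i4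
  rw [norml_rpow hp0 hf.1, norml_rpow hp0 hg.1, norml_rpow hp0 hd.1, norml_rpow hp0 hm.1,
    ← integral_add i1 i2, ← integral_const_mul, ← integral_div,
    ← integral_sub (i5.div_const 2) i4, ← integral_const_mul,
    ← integral_add (i5.const_mul ε) (i6.const_mul C)]
  exact integral_mono i3 ((i5.const_mul ε).add (i6.const_mul C)) fun x => hC (f x) (g x)

/-- An almost optimal sequence that is Cauchy in `L^q` has gradients that are Cauchy in `L^p`:
the sharp inequality applied to the midpoints shows that the convexity defect of the gradient
norms vanishes. -/
lemma tendsto_norml_gradient_sub {G : ℝ} (hp : 1 < p) (hs : 1 ≤ s) (hq1 : 1 ≤ q)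
    (hθ0 : 0 < θ) (hG : 0 < G) (hθ1 : θ < 1)
    (hsharp : ∀ φ : Rn n → ℝ, IsTestFunction φ →
      G * norml q φ ≤ norml p (gradient φ) ^ θ * norml s φ ^ (1 - θ))
    {φ : ℕ → Rn n → ℝ} (hφ : ∀ h, IsTestFunction (φ h))
    (hE : Tendsto (fun h => norml p (gradient (φ h))) atTop (𝓝 G))
    (hS : Tendsto (fun h => norml s (φ h)) atTop (𝓝 G))
    (hN : Tendsto (fun h => norml q (φ h)) atTop (𝓝 1))
    (hc : Tendsto (fun jl : ℕ × ℕ => norml q (fun x => φ jl.1 x - φ jl.2 x)) atTop (𝓝 0)) :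
    Tendsto (fun jl : ℕ × ℕ => norml p (fun x => gradient (φ jl.1) x - gradient (φ jl.2) x))
      atTop (𝓝 0) := by
  have hp0 : 0 < p := by linarith
  have hfst : ∀ {f : ℕ → ℝ} {a : ℝ}, Tendsto f atTop (𝓝 a) →
      Tendsto (fun jl : ℕ × ℕ => f jl.1) atTop (𝓝 a) := fun h => by
    rw [← prod_atTop_atTop_eq]; exact h.comp tendsto_fst
  have hsnd : ∀ {f : ℕ → ℝ} {a : ℝ}, Tendsto f atTop (𝓝 a) →
      Tendsto (fun jl : ℕ × ℕ => f jl.2) atTop (𝓝 a) := fun h => by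
    rw [← prod_atTop_atTop_eq]; exact h.comp tendsto_snd
  have hmid : ∀ jl : ℕ × ℕ, IsTestFunction fun x => 1 / 2 * (φ jl.1 x + φ jl.2 x) :=
    fun jl => ((hφ _).add (hφ _)).const_mul _
  set e : ℕ × ℕ → ℝ := fun jl =>
    norml p (fun x => (1 / 2 : ℝ) • (gradient (φ jl.1) x + gradient (φ jl.2) x)) with he
  have he' : ∀ jl, norml p (gradient fun x => 1 / 2 * (φ jl.1 x + φ jl.2 x)) = e jl := by
    intro jl
    congr 1; ext1 x
    rw [gradient_const_mul_fun _ (((hφ _).add (hφ _)).differentiable x),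
      gradient_add_fun ((hφ _).differentiable x) ((hφ _).differentiable x)]
  set ms : ℕ × ℕ → ℝ := fun jl => 1 / 2 * (norml s (φ jl.1) + norml s (φ jl.2)) with hms
  set mq : ℕ × ℕ → ℝ := fun jl =>
    norml q (φ jl.1) - 1 / 2 * norml q (fun x => φ jl.1 x - φ jl.2 x) with hmq
  have hhalf : ∀ (r : ℝ) (f : Rn n → ℝ),
      norml r (fun x => 1 / 2 * f x) = 1 / 2 * norml r f := by
    intro r f
    have := lpNorm_const_smul (1 / 2 : ℝ) f (volume : Measure (Rn n)) (p := ENNReal.ofReal r)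
    simp only [Pi.smul_def, smul_eq_mul] at this
    unfold norml
    rw [this]; simp
  have hms_le : ∀ jl, norml s (fun x => 1 / 2 * (φ jl.1 x + φ jl.2 x)) ≤ ms jl := by
    intro jl
    rw [hhalf]
    have := lpNorm_add_le (g := φ jl.2) ((hφ jl.1).memLp (ENNReal.ofReal s)) (one_le_ofReal hs)
    simp only [hms]
    gcongr
    exact this
  have hmq_le : ∀ jl, mq jl ≤ norml q (fun x => 1 / 2 * (φ jl.1 x + φ jl.2 x)) := by
    intro jl
    have h1 := lpNorm_add_le (g := fun x => 1 / 2 * (φ jl.1 x - φ jl.2 x))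
      ((hmid jl).memLp (ENNReal.ofReal q)) (one_le_ofReal hq1)
    have h2 : ((fun x => 1 / 2 * (φ jl.1 x + φ jl.2 x)) +
        fun x => 1 / 2 * (φ jl.1 x - φ jl.2 x)) = φ jl.1 := by
      ext x; simp only [Pi.add_apply]; ring
    rw [h2] at h1
    have h3 := hhalf q (fun x => φ jl.1 x - φ jl.2 x)
    simp only [hmq]
    unfold norml at h3 ⊢
    linarith
  have hms_lim : Tendsto ms atTop (𝓝 G) := by
    have := ((hfst hS).add (hsnd hS)).const_mul (1 / 2)
    rwa [show 1 / 2 * (G + G) = G by ring] at this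
  have hmq_lim : Tendsto mq atTop (𝓝 1) := by
    have := (hfst hN).sub (hc.const_mul (1 / 2))
    rwa [mul_zero, sub_zero] at this
  -- the lower bound for the gradient norm of the midpoint given by the sharp inequality
  set f : ℕ × ℕ → ℝ := fun jl => (G * mq jl / ms jl ^ (1 - θ)) ^ (1 / θ) with hf
  have hf_lim : Tendsto f atTop (𝓝 G) := by
    have h1 : Tendsto (fun jl => G * mq jl / ms jl ^ (1 - θ)) atTop
        (𝓝 (G * 1 / G ^ (1 - θ))) :=
      (hmq_lim.const_mul G).div (hms_lim.rpow_const (Or.inl hG.ne')) (by positivity)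
    have h2 := h1.rpow_const (p := 1 / θ) (Or.inr (by positivity))
    have h3 : (G * 1 / G ^ (1 - θ)) ^ (1 / θ) = G := by
      have : G * 1 / G ^ (1 - θ) = G ^ θ := by
        rw [mul_one, div_eq_iff (by positivity), ← Real.rpow_add hG, add_sub_cancel, Real.rpow_one]
      rw [this, ← Real.rpow_mul hG.le, mul_one_div_cancel hθ0.ne', Real.rpow_one]
    rwa [h3] at h2
  have hfe : ∀ᶠ jl in atTop, 0 ≤ f jl ∧ f jl ≤ e jl := by
    filter_upwards [hms_lim.eventually_const_lt hG, hmq_lim.eventually_const_lt one_pos]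
      with jl h1 h2
    have h4 : 0 ≤ G * mq jl / ms jl ^ (1 - θ) := by positivity
    refine ⟨by positivity, ?_⟩
    have h0 : 0 ≤ e jl := norml_nonneg _ _
    have hs0 := norml_nonneg s (fun x => 1 / 2 * (φ jl.1 x + φ jl.2 x))
    have h3 : G * mq jl ≤ e jl ^ θ * ms jl ^ (1 - θ) := by
      calc G * mq jl ≤ G * norml q (fun x => 1 / 2 * (φ jl.1 x + φ jl.2 x)) := by
            gcongr; exact hmq_le jl
        _ ≤ _ := hsharp _ (hmid jl)
        _ ≤ _ := by
            rw [he']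
            have := hms_le jl
            gcongr
    have h5 : G * mq jl / ms jl ^ (1 - θ) ≤ e jl ^ θ := by
      rwa [div_le_iff₀ (by positivity)]
    calc f jl ≤ (e jl ^ θ) ^ (1 / θ) := by
          simp only [hf]; gcongr
      _ = e jl := by rw [← Real.rpow_mul h0, mul_one_div_cancel hθ0.ne', Real.rpow_one]
  -- the `p`-th powers tend to zero
  have hpow : Tendsto (fun jl : ℕ × ℕ =>
      norml p (fun x => gradient (φ jl.1) x - gradient (φ jl.2) x) ^ p) atTop (𝓝 0) := by
    rw [Metric.tendsto_nhds]
    intro δ hδ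
    obtain ⟨C, hC0, hC⟩ := exists_uniform_convexity_const (Rn n) hp
      (show 0 < δ / (4 * G ^ p) by positivity)
    have hb : Tendsto (fun jl : ℕ × ℕ => δ / (4 * G ^ p) *
        (norml p (gradient (φ jl.1)) ^ p + norml p (gradient (φ jl.2)) ^ p) +
        C * ((norml p (gradient (φ jl.1)) ^ p + norml p (gradient (φ jl.2)) ^ p) / 2 - f jl ^ p))
        atTop (𝓝 (δ / (4 * G ^ p) * (G ^ p + G ^ p) + C * ((G ^ p + G ^ p) / 2 - G ^ p))) := by
      have h1 := ((hfst hE).rpow_const (p := p) (Or.inr hp0.le)).add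
        ((hsnd hE).rpow_const (p := p) (Or.inr hp0.le))
      exact (h1.const_mul _).add
        (((h1.div_const 2).sub (hf_lim.rpow_const (Or.inr hp0.le))).const_mul C)
    have hGp : 0 < G ^ p := by positivity
    have hlim : δ / (4 * G ^ p) * (G ^ p + G ^ p) + C * ((G ^ p + G ^ p) / 2 - G ^ p) < δ := by
      have : δ / (4 * G ^ p) * (G ^ p + G ^ p) + C * ((G ^ p + G ^ p) / 2 - G ^ p) = δ / 2 := by
        field_simp; ring
      rw [this]; linarith
    filter_upwards [hb.eventually_lt_const hlim, hfe] with jl h1 h2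
    rw [Real.dist_0_eq_abs, abs_of_nonneg (Real.rpow_nonneg (norml_nonneg _ _) _)]
    refine lt_of_le_of_lt ((norml_sub_rpow_le hp hC ((hφ jl.1).gradient_memLp _)
      ((hφ jl.2).gradient_memLp _)).trans ?_) h1
    have h3 : f jl ^ p ≤ e jl ^ p := Real.rpow_le_rpow h2.1 h2.2 hp0.le
    simp only [he] at h3
    gcongr
  have h1 := hpow.rpow_const (p := 1 / p) (Or.inr (by positivity))
  rw [Real.zero_rpow (by positivity)] at h1
  refine h1.congr fun jl => ?_
  rw [← Real.rpow_mul (norml_nonneg _ _), mul_one_div_cancel hp0.ne', Real.rpow_one]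

end UniformConvexity

/-! ### Limits in `D^{p,s}` and compactness of almost optimal sequences -/

section Compactness

variable {n : ℕ} {p s q θ : ℝ}

lemma exists_limit_of_tendsto_norml_sub {F : Type*} [NormedAddCommGroup F] [CompleteSpace F]
    {r : ℝ} (hr : 1 ≤ r) {f : ℕ → Rn n → F} (hf : ∀ k, MemLp (f k) (ENNReal.ofReal r) volume)
    (h : Tendsto (fun jl : ℕ × ℕ => norml r (fun x => f jl.1 x - f jl.2 x)) atTop (𝓝 0)) :
    ∃ f₀ : Rn n → F, MemLp f₀ (ENNReal.ofReal r) volume ∧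
      Tendsto (fun k => eLpNorm (fun x => f k x - f₀ x) (ENNReal.ofReal r) volume) atTop (𝓝 0) := by
  have : Fact (1 ≤ ENNReal.ofReal r) := ⟨one_le_ofReal hr⟩
  have hc : CauchySeq fun k => (hf k).toLp (f k) := by
    rw [cauchySeq_iff_tendsto_dist_atTop_0]
    refine h.congr fun jl => ?_
    rw [dist_eq_norm, ← MemLp.toLp_sub, Lp.norm_toLp]
    exact norml_eq_toReal ((hf _).sub (hf _)).1
  obtain ⟨f₀, hf₀⟩ := cauchySeq_tendsto_of_complete hc
  refine ⟨f₀, Lp.memLp f₀, ?_⟩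
  have h1 := (Lp.tendsto_Lp_iff_tendsto_eLpNorm' _ f₀).1 hf₀
  refine h1.congr fun k => eLpNorm_congr_ae ?_
  filter_upwards [(hf k).coeFn_toLp] with x hx
  rw [Pi.sub_apply, hx]

/-- The part of an `L^r` function outside of large balls is small. -/
lemma tendsto_eLpNorm_one_sub_cutoff {F : Type*} [NormedAddCommGroup F] [NormedSpace ℝ F]
    {r : ℝ} (hr : 0 < r) {f : Rn n → F} (hf : MemLp f (ENNReal.ofReal r) volume) :
    Tendsto (fun k : ℕ => eLpNorm (fun x => (1 - cutoff ((k : ℝ) + 1) 0 x) • f x)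
      (ENNReal.ofReal r) volume) atTop (𝓝 0) := by
  have hpow : Tendsto (fun k : ℕ => ∫⁻ x, ‖(1 - cutoff ((k : ℝ) + 1) 0 x) • f x‖ₑ ^ r) atTop
      (𝓝 (∫⁻ _ : Rn n, 0)) := by
    refine tendsto_lintegral_of_dominated_convergence' (fun x => ‖f x‖ₑ ^ r) (fun k => ?_)
      (fun k => Eventually.of_forall fun x => ?_) ?_ (Eventually.of_forall fun x => ?_)
    · exact (((continuous_const.sub (cutoff_isTestFunction
        (by positivity : (0 : ℝ) < (k : ℝ) + 1) 0).continuous).aestronglyMeasurable.smul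
        hf.1).enorm).pow_const r
    · refine ENNReal.rpow_le_rpow (enorm_le_iff_norm_le.2 ?_) hr.le
      have h0 := cutoff_nonneg (R := (k : ℝ) + 1) (y := 0) x
      have h1 := cutoff_le_one (R := (k : ℝ) + 1) (y := 0) x
      rw [norm_smul, Real.norm_of_nonneg (by linarith)]
      exact mul_le_of_le_one_left (norm_nonneg _) (by linarith)
    · rw [← eLpNorm_rpow_eq_lintegral hr]
      exact ENNReal.rpow_ne_top_of_nonneg hr.le hf.2.ne
    · refine tendsto_const_nhds.congr' ?_
      obtain ⟨N, hN⟩ := exists_nat_ge ‖x‖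
      filter_upwards [eventually_ge_atTop N] with k hk
      have : (N : ℝ) ≤ k := by exact_mod_cast hk
      rw [cutoff_eq_one (by positivity) (by rw [mem_closedBall_zero_iff]; linarith), sub_self,
        zero_smul, enorm_zero, ENNReal.zero_rpow_of_pos hr]
  rw [lintegral_zero] at hpow
  have h1 := ((ENNReal.continuous_rpow_const (y := 1 / r)).tendsto 0).comp hpow
  rw [ENNReal.zero_rpow_of_pos (by positivity)] at h1
  refine h1.congr fun k => ?_
  rw [Function.comp_apply, ← eLpNorm_rpow_eq_lintegral hr, ← ENNReal.rpow_mul,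
    mul_one_div_cancel hr.ne', ENNReal.rpow_one]

/-- An `L^q` limit of test functions bounded in `L^s`, `s < q`, whose gradients converge in
`L^p`, is a limit of test functions in `D^{p,s}`. The sequence itself need not converge in `L^s`;
cutting it off at slowly increasing radii produces one that does. -/
lemma isTestLimit_of_tendsto (hp : 1 ≤ p) (hs : 1 ≤ s) (hsq : s < q) {φ : ℕ → Rn n → ℝ}
    (hφ : ∀ h, IsTestFunction (φ h)) {K : ENNReal} (hK : K ≠ ⊤)
    (huK : ∀ h, eLpNorm (φ h) (ENNReal.ofReal s) volume ≤ K) {η : ℕ → ℝ}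
    (hη0 : Tendsto η atTop (𝓝 0)) (hη : ∀ R : ℕ, 0 < R → ∀ h,
      norml p (fun x => φ h x • gradient (cutoff (R : ℝ) 0) x) ≤ η R)
    {w : Rn n → ℝ} (hw : MemLp w (ENNReal.ofReal q) volume)
    (hφw : Tendsto (fun k => eLpNorm (fun x => φ k x - w x) (ENNReal.ofReal q) volume)
      atTop (𝓝 0))
    {g : Rn n → Rn n} (hg : MemLp g (ENNReal.ofReal p) volume)
    (hφg : Tendsto (fun k => eLpNorm (fun x => gradient (φ k) x - g x) (ENNReal.ofReal p) volume)
      atTop (𝓝 0)) :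
    IsTestLimit p s w g := by
  have hs0 : 0 < s := by linarith
  have hq0 : 0 < q := by linarith
  have hφm : ∀ h, AEStronglyMeasurable (φ h) volume := fun h =>
    (hφ h).continuous.aestronglyMeasurable
  obtain ⟨ns, -, hae⟩ := exists_subseq_ae_tendsto_of_eLpNorm
    (by simpa using hq0) hφm hw.1 hφw
  -- Fatou's lemma along an almost everywhere convergent subsequence
  have hws : MemLp w (ENNReal.ofReal s) volume :=
    ⟨hw.1, (Lp.eLpNorm_le_of_ae_tendsto (Eventually.of_forall fun i => huK (ns i))
      (fun i => hφm _) hae).trans_lt hK.lt_top⟩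
  have hpos : ∀ k : ℕ, (0 : ℝ) < (k : ℝ) + 1 := fun k => by positivity
  have hχ : ∀ k : ℕ, IsTestFunction (cutoff ((k : ℝ) + 1) (0 : Rn n)) := fun k =>
    cutoff_isTestFunction (hpos k) 0
  -- for a fixed radius, Hölder's inequality gives convergence in `L^s`
  have hfix : ∀ k : ℕ, Tendsto (fun j => eLpNorm
      (fun x => cutoff ((k : ℝ) + 1) 0 x • (φ j x - w x)) (ENNReal.ofReal s) volume)
      atTop (𝓝 0) := by
    intro k
    set B := Metric.closedBall (0 : Rn n) (2 * ((k : ℝ) + 1))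
    have hb : ∀ j, eLpNorm (fun x => cutoff ((k : ℝ) + 1) 0 x • (φ j x - w x))
        (ENNReal.ofReal s) volume ≤ eLpNorm (fun x => φ j x - w x) (ENNReal.ofReal q) volume *
          volume B ^ (1 / s - 1 / q) := by
      intro j
      refine (eLpNorm_cutoff_smul_le (hpos k) _ 0 _).trans ?_
      have h1 := eLpNorm_le_eLpNorm_mul_rpow_measure_univ (μ := volume.restrict B)
        (ENNReal.ofReal_le_ofReal hsq.le) ((hφm j).sub hw.1).restrict
      rw [Measure.restrict_apply_univ, ENNReal.toReal_ofReal hs0.le,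
        ENNReal.toReal_ofReal hq0.le] at h1
      refine h1.trans ?_
      gcongr
      exact eLpNorm_mono_measure _ Measure.restrict_le_self
    have h2 := ENNReal.Tendsto.mul_const (b := volume B ^ (1 / s - 1 / q)) hφw
      (Or.inr (ENNReal.rpow_ne_top_of_nonneg
        (by have := one_div_le_one_div_of_le hs0 hsq.le; linarith)
        measure_closedBall_lt_top.ne))
    rw [zero_mul] at h2
    exact tendsto_of_tendsto_of_tendsto_of_le_of_le tendsto_const_nhds h2 (fun _ => zero_le) hb
  have hsel : ∀ k : ℕ, ∃ j, k ≤ j ∧ eLpNorm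
      (fun x => cutoff ((k : ℝ) + 1) 0 x • (φ j x - w x)) (ENNReal.ofReal s) volume
      < ENNReal.ofReal (1 / ((k : ℝ) + 1)) := fun k =>
    ((eventually_ge_atTop k).and ((hfix k).eventually_lt_const (by simp; positivity))).exists
  choose j hj hjs using hsel
  have hjt : Tendsto j atTop atTop := tendsto_atTop_mono hj tendsto_id
  refine ⟨hws, hg, fun k x => cutoff ((k : ℝ) + 1) 0 x * φ (j k) x, fun k => (hχ k).mul (hφ _),
    ?_, ?_⟩
  · have h1 : Tendsto (fun k : ℕ => ENNReal.ofReal (1 / ((k : ℝ) + 1)) +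
        eLpNorm (fun x => (1 - cutoff ((k : ℝ) + 1) 0 x) • w x) (ENNReal.ofReal s) volume)
        atTop (𝓝 0) := by
      have h2 := ENNReal.tendsto_ofReal tendsto_one_div_add_atTop_nhds_zero_nat
      rw [ENNReal.ofReal_zero] at h2
      simpa using h2.add (tendsto_eLpNorm_one_sub_cutoff hs0 hws)
    refine tendsto_of_tendsto_of_tendsto_of_le_of_le tendsto_const_nhds h1 (fun _ => zero_le)
      fun k => ?_
    have e1 : (fun x => cutoff ((k : ℝ) + 1) 0 x * φ (j k) x - w x) =
        (fun x => cutoff ((k : ℝ) + 1) 0 x • (φ (j k) x - w x)) -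
          fun x => (1 - cutoff ((k : ℝ) + 1) 0 x) • w x := by
      ext x; simp only [Pi.sub_apply, smul_eq_mul]; ring
    rw [e1]
    refine (eLpNorm_sub_le
      ((hχ k).continuous.aestronglyMeasurable.smul ((hφm _).sub hw.1))
      ((continuous_const.sub (hχ k).continuous).aestronglyMeasurable.smul hw.1)
      (one_le_ofReal hs)).trans ?_
    exact add_le_add (hjs k).le le_rfl
  · have h1 : Tendsto (fun k : ℕ =>
        (eLpNorm (fun x => gradient (φ (j k)) x - g x) (ENNReal.ofReal p) volume +
        eLpNorm (fun x => (1 - cutoff ((k : ℝ) + 1) 0 x) • g x) (ENNReal.ofReal p) volume) +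
        ENNReal.ofReal (η (k + 1))) atTop (𝓝 0) := by
      have h2 := ENNReal.tendsto_ofReal (hη0.comp (tendsto_add_atTop_nat 1))
      rw [ENNReal.ofReal_zero] at h2
      simpa using ((hφg.comp hjt).add
        (tendsto_eLpNorm_one_sub_cutoff (by linarith : 0 < p) hg)).add h2
    refine tendsto_of_tendsto_of_tendsto_of_le_of_le tendsto_const_nhds h1 (fun _ => zero_le)
      fun k => ?_
    have e1 : (fun x => gradient (fun x => cutoff ((k : ℝ) + 1) 0 x * φ (j k) x) x - g x) =
        ((fun x => cutoff ((k : ℝ) + 1) 0 x • (gradient (φ (j k)) x - g x)) -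
          fun x => (1 - cutoff ((k : ℝ) + 1) 0 x) • g x) +
          fun x => φ (j k) x • gradient (cutoff ((k : ℝ) + 1) 0) x := by
      ext1 x
      rw [gradient_cutoff_mul (hpos k) (hφ _)]
      simp only [Pi.add_apply, Pi.sub_apply]
      module
    rw [e1]
    have m1 : AEStronglyMeasurable
        (fun x => cutoff ((k : ℝ) + 1) 0 x • (gradient (φ (j k)) x - g x)) volume :=
      (hχ k).continuous.aestronglyMeasurable.smul
        ((hφ _).gradient_continuous.aestronglyMeasurable.sub hg.1)
    have m2 : AEStronglyMeasurable (fun x => (1 - cutoff ((k : ℝ) + 1) 0 x) • g x) volume :=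
      (continuous_const.sub (hχ k).continuous).aestronglyMeasurable.smul hg.1
    have m3 : MemLp (fun x => φ (j k) x • gradient (cutoff ((k : ℝ) + 1) 0) x)
        (ENNReal.ofReal p) volume :=
      ((hφ _).continuous.smul (hχ k).gradient_continuous).memLp_of_hasCompactSupport
        (hχ k).gradient_hasCompactSupport.smul_left
    refine (eLpNorm_add_le (m1.sub m2) m3.1 (one_le_ofReal hp)).trans (add_le_add
      ((eLpNorm_sub_le m1 m2 (one_le_ofReal hp)).trans (add_le_add ?_ le_rfl)) ?_)
    · exact (eLpNorm_cutoff_smul_le (hpos k) _ 0 _).trans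
        (eLpNorm_mono_measure _ Measure.restrict_le_self)
    · rw [← ofReal_lpNorm m3]
      refine ENNReal.ofReal_le_ofReal ?_
      have := hη (k + 1) (by omega) (j k)
      push_cast at this
      exact this

lemma IsTestFunction.translate {φ : Rn n → ℝ} (hφ : IsTestFunction φ) (y : Rn n) :
    IsTestFunction fun x => φ (x + y) := by
  simpa using hφ.comp_affine one_ne_zero (-y)

lemma gradient_translate {φ : Rn n → ℝ} (hφ : IsTestFunction φ) (y : Rn n) :
    gradient (fun x => φ (x + y)) = fun x => gradient φ (x + y) := by
  ext1 x
  simpa using gradient_comp_affine hφ.differentiable 1 (-y) x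

lemma IsTestFunction.eLpNorm_translate {φ : Rn n → ℝ} (hφ : IsTestFunction φ) (y : Rn n)
    (r : ENNReal) : eLpNorm (fun x => φ (x + y)) r volume = eLpNorm φ r volume :=
  eLpNorm_comp_measurePreserving (g := φ) (f := fun x => x + y)
    hφ.continuous.aestronglyMeasurable (measurePreserving_add_right volume y)

lemma IsTestFunction.eLpNorm_gradient_translate {φ : Rn n → ℝ} (hφ : IsTestFunction φ) (y : Rn n)
    (r : ENNReal) :
    eLpNorm (gradient fun x => φ (x + y)) r volume = eLpNorm (gradient φ) r volume := by
  rw [gradient_translate hφ]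
  exact eLpNorm_gradient_comp_add y hφ

lemma IsTestFunction.norml_translate {φ : Rn n → ℝ} (hφ : IsTestFunction φ) (y : Rn n) (r : ℝ) :
    norml r (fun x => φ (x + y)) = norml r φ := by
  rw [norml_eq_toReal (hφ.translate y).continuous.aestronglyMeasurable, hφ.eLpNorm_translate,
    norml_eq_toReal hφ.continuous.aestronglyMeasurable]

lemma IsTestFunction.norml_gradient_translate {φ : Rn n → ℝ} (hφ : IsTestFunction φ) (y : Rn n)
    (r : ℝ) : norml r (gradient fun x => φ (x + y)) = norml r (gradient φ) := by
  rw [norml_eq_toReal (hφ.translate y).gradient_continuous.aestronglyMeasurable,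
    hφ.eLpNorm_gradient_translate, norml_eq_toReal hφ.gradient_continuous.aestronglyMeasurable]

lemma IsTestFunction.eLpNorm_translate_restrict {φ : Rn n → ℝ} (hφ : IsTestFunction φ) (y : Rn n)
    (R : ℝ) (r : ENNReal) :
    eLpNorm (fun x => φ (x + y)) r (volume.restrict (Metric.closedBall 0 R)) =
      eLpNorm φ r (volume.restrict (Metric.closedBall y R)) := by
  have hmp : MeasurePreserving (fun x => x + y) (volume.restrict (Metric.closedBall 0 R))
      (volume.restrict (Metric.closedBall y R)) := by
    have := (measurePreserving_add_right volume y).restrict_preimage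
      (s := Metric.closedBall y R) Metric.isClosed_closedBall.measurableSet
    convert this using 2
    ext x; simp [dist_eq_norm]
  exact eLpNorm_comp_measurePreserving hφ.continuous.aestronglyMeasurable hmp

/-- Compactness of almost optimal sequences of test functions that keep a fixed amount of
`L^q` mass in a ball. -/
lemma exists_subseq_tendsto_of_nonvanishing {G : ℝ} (hp : 1 < p) (hpn : p < (n : ℝ))
    (hs : 1 ≤ s) (hsq : s < q) (hq : q < (n : ℝ) * p / ((n : ℝ) - p))
    (hθ : θ / ((n : ℝ) * p / ((n : ℝ) - p)) + (1 - θ) / s = 1 / q) (hG : 0 < G)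
    (hsharp : ∀ φ : Rn n → ℝ, IsTestFunction φ →
      G * norml q φ ≤ norml p (gradient φ) ^ θ * norml s φ ^ (1 - θ))
    {ψ : ℕ → Rn n → ℝ} (hψ : ∀ h, IsTestFunction (ψ h)) {K : ENNReal} (hK : K ≠ ⊤)
    (hgK : ∀ h, eLpNorm (gradient (ψ h)) (ENNReal.ofReal p) volume ≤ K)
    (huK : ∀ h, eLpNorm (ψ h) (ENNReal.ofReal s) volume ≤ K)
    (hE : Tendsto (fun h => norml p (gradient (ψ h))) atTop (𝓝 G))
    (hS : Tendsto (fun h => norml s (ψ h)) atTop (𝓝 G))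
    (hN : Tendsto (fun h => norml q (ψ h)) atTop (𝓝 1)) {c : ENNReal} (hc : 0 < c)
    (hnv : ∀ᶠ h in atTop, c ≤ eLpNorm (ψ h) (ENNReal.ofReal q)
      (volume.restrict (Metric.closedBall 0 2))) :
    ∃ (k : ℕ → ℕ) (w : Rn n → ℝ), StrictMono k ∧ MemD p s w ∧
      MemLp w (ENNReal.ofReal q) volume ∧
      Tendsto (fun j => eLpNorm (fun x => ψ (k j) x - w x) (ENNReal.ofReal q) volume)
        atTop (𝓝 0) := by
  have hq1 : 1 < q := by linarith
  obtain ⟨hθ0, hθ1⟩ := theta_bounds hs hsq hq hθ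
  obtain ⟨C, hC0, hC⟩ := exists_sobolev_const hp hpn
  obtain ⟨k, hk, hL1⟩ := exists_subseq_cauchy_L1_loc hp.le hs hψ hK hgK huK
  have hkt := hk.tendsto_atTop
  have hψk : ∀ j, IsTestFunction (ψ (k j)) := fun j => hψ (k j)
  have hloc : ∀ R : ℝ, Tendsto (fun jl : ℕ × ℕ => eLpNorm (fun x => ψ (k jl.1) x - ψ (k jl.2) x)
      (ENNReal.ofReal q) (volume.restrict (Metric.closedBall 0 R))) atTop (𝓝 0) := fun R =>
    tendsto_eLpNorm_loc_of_L1_loc (φ := fun j => ψ (k j)) hq1 hq hψk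
      (K := ENNReal.ofReal C * K) (ENNReal.mul_ne_top ENNReal.ofReal_ne_top hK)
      (fun j => (hC _ (hψ _)).trans (mul_le_mul_right (hgK _) _)) (hL1 R)
  have hE' : Tendsto (fun j => norml p (gradient (ψ (k j)))) atTop (𝓝 G) := hE.comp hkt
  have hS' : Tendsto (fun j => norml s (ψ (k j))) atTop (𝓝 G) := hS.comp hkt
  have hN' : Tendsto (fun j => norml q (ψ (k j))) atTop (𝓝 1) := hN.comp hkt
  have hgK' : ∀ j, eLpNorm (gradient (ψ (k j))) (ENNReal.ofReal p) volume ≤ K := fun j => hgK _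
  have huK' : ∀ j, eLpNorm (ψ (k j)) (ENNReal.ofReal s) volume ≤ K := fun j => huK _
  have hnv' : ∀ᶠ j in atTop, min c 1 ≤ eLpNorm (ψ (k j)) (ENNReal.ofReal q)
      (volume.restrict (Metric.closedBall 0 2)) := by
    filter_upwards [hkt.eventually hnv] with j hj using (min_le_left _ _).trans hj
  have hcq : Tendsto (fun jl : ℕ × ℕ => norml q (fun x => ψ (k jl.1) x - ψ (k jl.2) x))
      atTop (𝓝 0) := by
    have hc1 : min c 1 ≠ ⊤ := (min_le_right c 1).trans_lt ENNReal.one_lt_top |>.ne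
    refine tendsto_norml_sub_of_nonvanishing (φ := fun j => ψ (k j)) hp hpn hs hsq hq hθ hG
      hsharp hψk hK hgK' huK' hE' hS' hN' hloc (c := (min c 1).toReal)
      (ENNReal.toReal_pos (lt_min hc zero_lt_one).ne' hc1) (ρ := 2) ?_
    filter_upwards [hnv'] with j hj
    rw [← toReal_eLpNorm (hψk j).continuous.aestronglyMeasurable]
    exact ENNReal.toReal_mono (((hψk j).memLp _).restrict _).2.ne (mod_cast hj)
  have hcg := tendsto_norml_gradient_sub hp hs hq1.le hθ0 hG hθ1 hsharp hψk hE' hS' hN' hcq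
  obtain ⟨w, hw, hφw⟩ := exists_limit_of_tendsto_norml_sub hq1.le
    (fun j => (hψk j).memLp _) hcq
  obtain ⟨g, hg, hφg⟩ := exists_limit_of_tendsto_norml_sub hp.le
    (fun j => (hψk j).gradient_memLp _) hcg
  obtain ⟨η, hη0, hη⟩ := exists_cutoff_error_seq hp hpn hs (hsq.trans hq) hK
  have hlim := isTestLimit_of_tendsto hp.le hs hsq hψk hK huK' hη0
    (fun R hR j => hη R hR _ (hψ _) (hgK' j) (huK' j)) hw hφw hg hφg
  exact ⟨k, w, hk, (memD_iff hp.le hs).2 ⟨g, hlim⟩, hw, hφw⟩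

/-- Compactness up to translations of almost optimal sequences of test functions. -/
lemma exists_translates_tendsto {G : ℝ} (hp : 1 < p) (hpn : p < (n : ℝ))
    (hs : 1 ≤ s) (hsq : s < q) (hq : q < (n : ℝ) * p / ((n : ℝ) - p))
    (hθ : θ / ((n : ℝ) * p / ((n : ℝ) - p)) + (1 - θ) / s = 1 / q) (hG : 0 < G)
    (hsharp : ∀ φ : Rn n → ℝ, IsTestFunction φ →
      G * norml q φ ≤ norml p (gradient φ) ^ θ * norml s φ ^ (1 - θ))
    {φ : ℕ → Rn n → ℝ} (hφ : ∀ h, IsTestFunction (φ h))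
    (hE : Tendsto (fun h => norml p (gradient (φ h))) atTop (𝓝 G))
    (hS : Tendsto (fun h => norml s (φ h)) atTop (𝓝 G))
    (hN : Tendsto (fun h => norml q (φ h)) atTop (𝓝 1)) :
    ∃ (y : ℕ → Rn n) (k : ℕ → ℕ) (w : Rn n → ℝ), StrictMono k ∧ MemD p s w ∧
      MemLp w (ENNReal.ofReal q) volume ∧
      Tendsto (fun j => eLpNorm (fun x => φ (k j) (x + y (k j)) - w x) (ENNReal.ofReal q) volume)
        atTop (𝓝 0) := by
  obtain ⟨C, hC0, hC⟩ := exists_sobolev_const hp hpn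
  obtain ⟨K₁, hK₁⟩ := hE.bddAbove_range
  obtain ⟨K₂, hK₂⟩ := hS.bddAbove_range
  obtain ⟨K, hK, hgK, huK⟩ : ∃ K : ENNReal, K ≠ ⊤ ∧
      (∀ h, eLpNorm (gradient (φ h)) (ENNReal.ofReal p) volume ≤ K) ∧
      ∀ h, eLpNorm (φ h) (ENNReal.ofReal s) volume ≤ K := by
    refine ⟨ENNReal.ofReal (max K₁ K₂), ENNReal.ofReal_ne_top, fun h => ?_, fun h => ?_⟩
    · rw [← ofReal_lpNorm ((hφ h).gradient_memLp _)]
      exact ENNReal.ofReal_le_ofReal ((hK₁ ⟨h, rfl⟩).trans (le_max_left _ _))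
    · rw [← ofReal_lpNorm ((hφ h).memLp _)]
      exact ENNReal.ofReal_le_ofReal ((hK₂ ⟨h, rfl⟩).trans (le_max_right _ _))
  obtain ⟨c, hc, hnv⟩ := exists_nonvanishing_const hp.le (lt_sobolev_exponent hp hpn) hs
    hsq hq hC hK
    (c₀ := ENNReal.ofReal (1 / 2)) (by simp)
  have hev : ∀ᶠ h in atTop, ∃ y : Rn n,
      c ≤ eLpNorm (φ h) (ENNReal.ofReal q) (volume.restrict (Metric.closedBall y 2)) := by
    filter_upwards [hN.eventually_const_lt (by norm_num : (1 / 2 : ℝ) < 1)] with h hh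
    refine hnv (φ h) (hφ h) (hgK h) (huK h) ?_
    rw [← ofReal_lpNorm ((hφ h).memLp _)]
    exact ENNReal.ofReal_le_ofReal hh.le
  obtain ⟨y, hy⟩ := hev.choice
  obtain ⟨k, w, hk, hw⟩ := exists_subseq_tendsto_of_nonvanishing hp hpn hs hsq hq hθ hG hsharp
    (ψ := fun h x => φ h (x + y h)) (fun h => (hφ h).translate (y h)) hK
    (fun h => ((hφ h).eLpNorm_gradient_translate (y h) _).trans_le (hgK h))
    (fun h => ((hφ h).eLpNorm_translate (y h) _).trans_le (huK h))
    (hE.congr fun h => ((hφ h).norml_gradient_translate (y h) _).symm)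
    (hS.congr fun h => ((hφ h).norml_translate (y h) _).symm)
    (hN.congr fun h => ((hφ h).norml_translate (y h) _).symm) hc
    (hy.mono fun h hh => hh.trans_eq ((hφ h).eLpNorm_translate_restrict (y h) 2 _).symm)
  exact ⟨y, k, w, hk, hw⟩

end Compactness

/-! ### Normalisation by scaling -/

section Normalisation

variable {n : ℕ} {p s q θ : ℝ}

lemma norml_const_mul {F : Type*} [NormedAddCommGroup F] [NormedSpace ℝ F] (r : ℝ) {c : ℝ}
    (hc : 0 ≤ c) (f : Rn n → F) : norml r (fun x => c • f x) = c * norml r f := by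
  have := lpNorm_const_smul (p := ENNReal.ofReal r) c f volume
  rw [coe_nnnorm, Real.norm_of_nonneg hc] at this
  exact this

lemma IsTestLimit.const_mul {c : ℝ} (hp : 0 < p) (hs : 0 < s) (hc : 0 ≤ c) {u : Rn n → ℝ}
    {g : Rn n → Rn n} (h : IsTestLimit p s u g) :
    IsTestLimit p s (fun x => c * u x) (fun x => c • g x) := by
  simpa using h.comp_affine hp hs one_pos hc 0

lemma tendsto_norml_of_tendsto_eLpNorm_sub {F : Type*} [NormedAddCommGroup F] {r : ℝ}
    (hr : 1 ≤ r) {f : ℕ → Rn n → F} {f₀ : Rn n → F} (hf : ∀ k, AEStronglyMeasurable (f k) volume)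
    (hf₀ : MemLp f₀ (ENNReal.ofReal r) volume)
    (h : Tendsto (fun k => eLpNorm (fun x => f k x - f₀ x) (ENNReal.ofReal r) volume)
      atTop (𝓝 0)) : Tendsto (fun k => norml r (f k)) atTop (𝓝 (norml r f₀)) := by
  have h1 := tendsto_eLpNorm_of_tendsto_sub (one_le_ofReal hr) hf hf₀ h
  rw [norml_eq_toReal hf₀.1]
  exact ((ENNReal.tendsto_toReal hf₀.2.ne).comp h1).congr fun k => (norml_eq_toReal (hf k)).symm

lemma tendsto_norml_sub_zero {F : Type*} [NormedAddCommGroup F] {r : ℝ} {f : ℕ → Rn n → F}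
    {f₀ : Rn n → F} (hf : ∀ k, AEStronglyMeasurable (f k) volume)
    (hf₀ : AEStronglyMeasurable f₀ volume)
    (h : Tendsto (fun k => eLpNorm (fun x => f k x - f₀ x) (ENNReal.ofReal r) volume)
      atTop (𝓝 0)) : Tendsto (fun k => norml r (fun x => f₀ x - f k x)) atTop (𝓝 0) := by
  refine ((ENNReal.tendsto_toReal ENNReal.zero_ne_top).comp h).congr fun k => ?_
  exact (congrArg ENNReal.toReal (eLpNorm_sub_comm (f k) f₀ _ _)).trans
    (norml_eq_toReal (hf₀.sub (hf k))).symm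

/-- The test functions approximating an element of `D^{p,s}` also converge in `L^q`. -/
lemma IsTestLimit.exists_seq (hp : 1 < p) (hpn : p < (n : ℝ)) (hs : 1 ≤ s) (hsq : s < q)
    (hq : q < (n : ℝ) * p / ((n : ℝ) - p))
    (hθ : θ / ((n : ℝ) * p / ((n : ℝ) - p)) + (1 - θ) / s = 1 / q) {u : Rn n → ℝ}
    {g : Rn n → Rn n} (h : IsTestLimit p s u g) :
    ∃ φ : ℕ → Rn n → ℝ, (∀ k, IsTestFunction (φ k)) ∧
      Tendsto (fun k => norml p (gradient (φ k))) atTop (𝓝 (norml p g)) ∧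
      Tendsto (fun k => norml s (φ k)) atTop (𝓝 (norml s u)) ∧
      Tendsto (fun k => norml q (φ k)) atTop (𝓝 (norml q u)) ∧
      Tendsto (fun k => eLpNorm (fun x => φ k x - u x) (ENNReal.ofReal q) volume)
        atTop (𝓝 0) := by
  obtain ⟨C, hC0, hC⟩ := exists_gns_const hp hpn hs hsq hq hθ
  obtain ⟨hθ0, hθ1⟩ := theta_bounds hs hsq hq hθ
  obtain ⟨hu, hg, φ, hφ, hφu, hφg⟩ := h
  have hl : IsTestLimit p s u g := ⟨hu, hg, φ, hφ, hφu, hφg⟩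
  have huq := (hC u g hl).2.1
  have hφq : Tendsto (fun k => eLpNorm (fun x => φ k x - u x) (ENNReal.ofReal q) volume)
      atTop (𝓝 0) := by
    have h1 := tendsto_norml_sub_zero
      (fun k => (hφ k).gradient_continuous.aestronglyMeasurable) hg.1 hφg
    have h2 := tendsto_norml_sub_zero (fun k => (hφ k).continuous.aestronglyMeasurable) hu.1 hφu
    have h3 := ((h1.rpow_const (p := θ) (Or.inr hθ0.le)).mul
      (h2.rpow_const (p := 1 - θ) (Or.inr (by linarith)))).const_mul C
    rw [Real.zero_rpow hθ0.ne', zero_mul, mul_zero] at h3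
    have h4 := ENNReal.tendsto_ofReal h3
    rw [ENNReal.ofReal_zero] at h4
    refine tendsto_of_tendsto_of_tendsto_of_le_of_le tendsto_const_nhds h4 (fun _ => zero_le)
      fun k => ?_
    obtain ⟨-, h5, h6⟩ := hC _ _ (hl.sub_test (hφ k))
    have h7 : eLpNorm (fun x => φ k x - u x) (ENNReal.ofReal q) volume
        = eLpNorm (fun x => u x - φ k x) (ENNReal.ofReal q) volume :=
      eLpNorm_sub_comm (φ k) u _ _
    rw [h7, ← ofReal_lpNorm h5]
    exact ENNReal.ofReal_le_ofReal h6
  exact ⟨φ, hφ, tendsto_norml_of_tendsto_eLpNorm_sub hp.le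
      (fun k => (hφ k).gradient_continuous.aestronglyMeasurable) hg hφg,
    tendsto_norml_of_tendsto_eLpNorm_sub hs
      (fun k => (hφ k).continuous.aestronglyMeasurable) hu hφu,
    tendsto_norml_of_tendsto_eLpNorm_sub (by linarith)
      (fun k => (hφ k).continuous.aestronglyMeasurable) huq hφq, hφq⟩

lemma IsTestLimit.exists_approx (hp : 1 < p) (hpn : p < (n : ℝ)) (hs : 1 ≤ s) (hsq : s < q)
    (hq : q < (n : ℝ) * p / ((n : ℝ) - p))
    (hθ : θ / ((n : ℝ) * p / ((n : ℝ) - p)) + (1 - θ) / s = 1 / q) {u : Rn n → ℝ}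
    {g : Rn n → Rn n} (h : IsTestLimit p s u g) {ε : ℝ} (hε : 0 < ε) :
    ∃ φ : Rn n → ℝ, IsTestFunction φ ∧ dist (norml p (gradient φ)) (norml p g) < ε ∧
      dist (norml s φ) (norml s u) < ε ∧ dist (norml q φ) (norml q u) < ε ∧
      eLpNorm (fun x => φ x - u x) (ENNReal.ofReal q) volume < ENNReal.ofReal ε := by
  obtain ⟨φ, hφ, h1, h2, h3, h4⟩ := h.exists_seq hp hpn hs hsq hq hθ
  obtain ⟨k, hk1, hk2, hk3, hk4⟩ := ((Metric.tendsto_nhds.1 h1 _ hε).and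
    ((Metric.tendsto_nhds.1 h2 _ hε).and ((Metric.tendsto_nhds.1 h3 _ hε).and
      (h4.eventually_lt_const (ENNReal.ofReal_pos.2 hε))))).exists
  exact ⟨φ k, hφ k, hk1, hk2, hk3, hk4⟩

lemma eLpNorm_translate_sub_le {r : ENNReal} (hr : 1 ≤ r) (y : Rn n) {v φ w : Rn n → ℝ}
    (hv : AEStronglyMeasurable v volume) (hφ : AEStronglyMeasurable φ volume)
    (hw : AEStronglyMeasurable w volume) :
    eLpNorm (fun x => v (x + y) - w x) r volume ≤
      eLpNorm (fun x => φ x - v x) r volume + eLpNorm (fun x => φ (x + y) - w x) r volume := by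
  have hmp := measurePreserving_add_right (volume : Measure (Rn n)) y
  have m1 : AEStronglyMeasurable (fun x => v (x + y)) volume := hv.comp_measurePreserving hmp
  have m2 : AEStronglyMeasurable (fun x => φ (x + y)) volume := hφ.comp_measurePreserving hmp
  have h1 : eLpNorm (fun x => v (x + y) - φ (x + y)) r volume
      = eLpNorm (fun x => v x - φ x) r volume :=
    eLpNorm_comp_measurePreserving (g := fun x => v x - φ x) (hv.sub hφ) hmp
  have h2 : eLpNorm (fun x => v x - φ x) r volume = eLpNorm (fun x => φ x - v x) r volume :=
    eLpNorm_sub_comm v φ _ _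
  have h3 := eLpNorm_add_le (m1.sub m2) (m2.sub hw) hr
  rw [sub_add_sub_cancel] at h3
  rw [← h2, ← h1]
  exact h3

/-- Compactness up to translations of almost optimal sequences in `D^{p,s}`. -/
lemma exists_translates_tendsto_of_isTestLimit {G : ℝ} (hp : 1 < p) (hpn : p < (n : ℝ))
    (hs : 1 ≤ s) (hsq : s < q) (hq : q < (n : ℝ) * p / ((n : ℝ) - p))
    (hθ : θ / ((n : ℝ) * p / ((n : ℝ) - p)) + (1 - θ) / s = 1 / q) (hG : 0 < G)
    (hsharp : ∀ φ : Rn n → ℝ, IsTestFunction φ →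
      G * norml q φ ≤ norml p (gradient φ) ^ θ * norml s φ ^ (1 - θ))
    {v : ℕ → Rn n → ℝ} {g : ℕ → Rn n → Rn n} (hv : ∀ h, IsTestLimit p s (v h) (g h))
    (hE : Tendsto (fun h => norml p (g h)) atTop (𝓝 G))
    (hS : Tendsto (fun h => norml s (v h)) atTop (𝓝 G))
    (hN : Tendsto (fun h => norml q (v h)) atTop (𝓝 1)) :
    ∃ (y : ℕ → Rn n) (k : ℕ → ℕ) (w : Rn n → ℝ), StrictMono k ∧ MemD p s w ∧
      MemLp w (ENNReal.ofReal q) volume ∧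
      Tendsto (fun j => eLpNorm (fun x => v (k j) (x + y (k j)) - w x) (ENNReal.ofReal q) volume)
        atTop (𝓝 0) := by
  have hpos : ∀ h : ℕ, (0 : ℝ) < 1 / ((h : ℝ) + 1) := fun h => by positivity
  choose φ hφ hφE hφS hφN hφv using fun h =>
    (hv h).exists_approx hp hpn hs hsq hq hθ (hpos h)
  have hz := tendsto_one_div_add_atTop_nhds_zero_nat (𝕜 := ℝ)
  have hlim : ∀ {a b : ℕ → ℝ} {l : ℝ}, Tendsto b atTop (𝓝 l) →
      (∀ h, dist (a h) (b h) < 1 / ((h : ℝ) + 1)) → Tendsto a atTop (𝓝 l) := by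
    intro a b l hb hab
    exact tendsto_iff_of_dist (squeeze_zero (fun _ => dist_nonneg) (fun h => (hab h).le) hz)
      |>.2 hb
  obtain ⟨y, k, w, hk, hw, hwq, ht⟩ := exists_translates_tendsto hp hpn hs hsq hq hθ hG hsharp hφ
    (hlim hE hφE) (hlim hS hφS) (hlim hN hφN)
  refine ⟨y, k, w, hk, hw, hwq, ?_⟩
  have hz' := (ENNReal.tendsto_ofReal hz).comp hk.tendsto_atTop
  rw [ENNReal.ofReal_zero] at hz'
  have hsum := hz'.add ht
  rw [add_zero] at hsum
  refine tendsto_of_tendsto_of_tendsto_of_le_of_le tendsto_const_nhds hsum (fun _ => zero_le)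
    fun j => ?_
  exact (eLpNorm_translate_sub_le (one_le_ofReal (by linarith)) (y (k j)) (hv (k j)).1.1
    (hφ (k j)).continuous.aestronglyMeasurable hwq.1).trans
    (add_le_add (hφv (k j)).le le_rfl)

/-- A dilation makes `‖∇u‖_p` and `‖u‖_s` equal; the common value is then `gnsFunctional`. -/
lemma exists_balanced_rescale (hp : 1 < p) (hpn : p < (n : ℝ)) (hs : 1 ≤ s) (hsq : s < q)
    (hq : q < (n : ℝ) * p / ((n : ℝ) - p))
    (hθ : θ / ((n : ℝ) * p / ((n : ℝ) - p)) + (1 - θ) / s = 1 / q) {u : Rn n → ℝ}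
    (hu : MemD p s u) (hu0 : IsNonzero u) :
    ∃ lam : ℝ, 0 < lam ∧ ∀ x₀ : Rn n,
      norml p (weakGradient (rescale q lam x₀ u)) = gnsFunctional p s θ u ∧
      norml s (rescale q lam x₀ u) = gnsFunctional p s θ u := by
  obtain ⟨-, -, hsu, hgu, -⟩ := gns_sharp hp hpn hs hsq hq hθ hu hu0
  have hn : (0 : ℝ) < n := by linarith
  have he : 0 < 1 + (n : ℝ) / s - n / p := by
    have h1 := one_div_lt_one_div_of_lt (by linarith : 0 < s) (hsq.trans hq)
    rw [inv_sobolev_exponent hp hpn] at h1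
    have h2 : (n : ℝ) * (1 / p - 1 / n) < n * (1 / s) := by gcongr
    have h3 : (n : ℝ) * (1 / n) = 1 := by field_simp
    rw [mul_sub, h3, mul_one_div, mul_one_div] at h2
    linarith
  set lam : ℝ := (norml s u / norml p (weakGradient u)) ^ (1 / (1 + (n : ℝ) / s - n / p))
  have hl : 0 < lam := by positivity
  have hle : lam ^ (1 + (n : ℝ) / s - n / p) = norml s u / norml p (weakGradient u) := by
    rw [← Real.rpow_mul (by positivity), one_div_mul_cancel he.ne', Real.rpow_one]
  refine ⟨lam, hl, fun x₀ => ?_⟩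
  have heq : norml p (weakGradient (rescale q lam x₀ u)) = norml s (rescale q lam x₀ u) := by
    rw [norml_weakGradient_rescale hp.le hs hl x₀ hu, norml_rescale hl (by linarith) x₀ hu.1.1,
      show (n : ℝ) / q + 1 - n / p = (n / q - n / s) + (1 + n / s - n / p) by ring,
      Real.rpow_add hl, hle]
    field_simp
  have h1 := gnsFunctional_rescale hp hpn hs hθ hl x₀ hu
  have h2 : 0 < norml s (rescale q lam x₀ u) := by
    rw [norml_rescale hl (by linarith) x₀ hu.1.1]; positivity
  rw [gnsFunctional, heq, ← Real.rpow_add h2, show θ + (1 - θ) = 1 by ring, Real.rpow_one] at h1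
  exact ⟨heq.trans h1, h1⟩

end Normalisation

theorem theorem2p1 (n : ℕ) (p s q θ : ℝ)
    (hp : 1 < p) (hpn : p < (n : ℝ))
    (hs : 1 ≤ s) (hsq : s < q) (hq : q < (n : ℝ) * p / ((n : ℝ) - p))
    (hθ : θ / ((n : ℝ) * p / ((n : ℝ) - p)) + (1 - θ) / s = 1 / q)
    (M : ℝ) :
    ∃ C₀ C₁ : ℝ, 0 < C₀ ∧ 0 < C₁ ∧
      ∀ u : ℕ → Rn n → ℝ,
        (∀ h, MemD p s (u h)) → (∀ h, IsNonzero (u h)) →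
        Tendsto (fun h => deficit p s q θ (u h)) atTop (𝓝 0) →
        ∃ (lam : ℕ → ℝ) (x₀ : ℕ → Rn n) (w : ℕ → Rn n → ℝ),
          (∀ h, 0 < lam h) ∧
          (∀ h, w h = rescale q (lam h) (x₀ h) (u h)) ∧
          (∀ h, MemD p s (w h)) ∧
          (∀ h, deficit p s q θ (w h) = deficit p s q θ (u h) ∧
            asymmetry p s q θ (w h) = asymmetry p s q θ (u h)) ∧
          (∀ h, norml q (w h) = norml q (u h)) ∧
          (∀ h, deficit p s q θ (u h) ≤ M →
            (1 / C₀ * norml q (u h) ≤ norml p (weakGradient (w h)) ∧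
              norml p (weakGradient (w h)) ≤ C₀ * norml q (u h)) ∧
            (1 / C₁ * norml q (u h) ≤ norml s (w h) ∧
              norml s (w h) ≤ C₁ * norml q (u h))) ∧
          ∃ (k : ℕ → ℕ) (wlim : Rn n → ℝ), StrictMono k ∧ MemD p s wlim ∧
            MemLp wlim (ENNReal.ofReal q) volume ∧
            Tendsto (fun j =>
              eLpNorm (fun x => (norml q (u (k j)))⁻¹ * w (k j) x - wlim x)
                (ENNReal.ofReal q) volume) atTop (𝓝 0) := by
  set G := gnsConst n p s q θ with hGdef
  -- the first term keeps `C` positive even if there were no nonzero function in `D^{p,s}`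
  set C := 1 + |1 + M| * |G| + |G⁻¹| with hCdef
  have hC : 0 < C := by positivity
  refine ⟨C, C, hC, hC, fun u hu hu0 hδ => ?_⟩
  have hq0 : 0 < q := by linarith
  have hsharp := fun h => gns_sharp hp hpn hs hsq hq hθ (hu h) (hu0 h)
  have hG : 0 < G := (hsharp 0).1
  have hN : ∀ h, 0 < norml q (u h) := fun h => (hsharp h).2.1
  have hF : ∀ h, gnsFunctional p s θ (u h) =
      (1 + deficit p s q θ (u h)) * G * norml q (u h) := fun h => by
    have := (hN h).ne'
    rw [deficit, ← hGdef]
    field_simp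
    ring
  choose lam hlam hbal using fun h =>
    exists_balanced_rescale hp hpn hs hsq hq hθ (hu h) (hu0 h)
  have hbound : ∀ h, deficit p s q θ (u h) ≤ M →
      1 / C * norml q (u h) ≤ gnsFunctional p s θ (u h) ∧
        gnsFunctional p s θ (u h) ≤ C * norml q (u h) := by
    intro h hM
    have hCG : 1 / C ≤ G := by
      rw [one_div, inv_le_comm₀ hC hG]
      have : 0 ≤ |1 + M| * |G| := by positivity
      linarith [le_abs_self G⁻¹]
    refine ⟨(mul_le_mul_of_nonneg_right hCG (hN h).le).trans (hsharp h).2.2.2.2, ?_⟩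
    rw [hF]
    refine mul_le_mul_of_nonneg_right ?_ (hN h).le
    have h1 : (1 + deficit p s q θ (u h)) * G ≤ |1 + M| * |G| := by
      rw [abs_of_pos hG]
      exact mul_le_mul_of_nonneg_right ((by linarith : _ ≤ 1 + M).trans (le_abs_self _)) hG.le
    linarith [abs_nonneg G⁻¹]
  -- the balanced rescalings of `u h`, normalised in `L^q`
  set v : ℕ → Rn n → ℝ := fun h x => (norml q (u h))⁻¹ * rescale q (lam h) 0 (u h) x with hvdef
  choose g hg using fun h =>
    (memD_iff hp.le hs).1 ((hu h).rescale (q := q) hp.le hs (hlam h) 0)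
  have hv : ∀ h, IsTestLimit p s (v h) (fun x => (norml q (u h))⁻¹ • g h x) := fun h =>
    (hg h).const_mul (by linarith) (by linarith) (inv_nonneg.2 (hN h).le)
  have hlimF : Tendsto (fun h => (norml q (u h))⁻¹ * gnsFunctional p s θ (u h)) atTop (𝓝 G) := by
    have h1 := (hδ.const_add 1).mul_const G
    rw [add_zero, one_mul] at h1
    refine h1.congr fun h => ?_
    rw [hF]
    have := (hN h).ne'
    field_simp
  obtain ⟨y, k, wlim, hk, hwD, hwq, hlim⟩ := exists_translates_tendsto_of_isTestLimit hp hpn hs hsq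
    hq hθ hG (fun φ hφ => gns_sharp_test hp hpn hs hsq hq hθ hφ) hv
    (hlimF.congr fun h => by
      rw [norml_const_mul _ (inv_nonneg.2 (hN h).le),
        ← norml_congr_ae ((hg h).weakGradient_ae hp.le hs), (hbal h 0).1])
    (hlimF.congr fun h => by
      have := norml_const_mul s (inv_nonneg.2 (hN h).le) (rescale q (lam h) 0 (u h))
      rw [(hbal h 0).2] at this
      exact this.symm)
    (tendsto_const_nhds.congr fun h => by
      have := norml_const_mul q (inv_nonneg.2 (hN h).le) (rescale q (lam h) 0 (u h))
      rw [norml_rescale_self (hlam h) hq0 0 (hu h).1.1, inv_mul_cancel₀ (hN h).ne'] at this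
      exact this.symm)
  refine ⟨lam, fun h => -y h, fun h => rescale q (lam h) (-y h) (u h), hlam, fun _ => rfl,
    fun h => (hu h).rescale hp.le hs (hlam h) _,
    fun h => ⟨deficit_rescale hp hpn hs hq0 hθ (hlam h) _ (hu h),
      asymmetry_rescale hp hpn hs hq0 hθ (hlam h) _ (hu h)⟩,
    fun h => norml_rescale_self (hlam h) hq0 _ (hu h).1.1, fun h hM => ?_,
    k, wlim, hk, hwD, hwq, ?_⟩
  · simp only [hbal]
    exact ⟨hbound h hM, hbound h hM⟩
  · refine hlim.congr fun j => ?_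
    simp only [hvdef, rescale, sub_zero, sub_neg_eq_add]
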